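/- Let $p_0,p_1,\dots,p_{n-1}$ $(n\ge 3)$ be distinct points of $\mathbb{R}^2$, indexed modulo $n$, such that any two different segments $[p_{i},p_{i+1}]$, $[p_{j},p_{j+1}]$ meet exactly in their common endpoints, and let $P=\bigcup_{i}[p_{i},p_{i+1}]$ be the simple closed $n$-gon with vertices $p_0,\dots,p_{n-1}$. Let $\operatorname{int}P$ and $\operatorname{ext}P$ denote the bounded and the unbounded connected component of $\mathbb{R}^2\setminus P$. For $S\subset\mathbb{R}^2$, a point $a$ sees a point $v$ via $S$ if the open segment $]a,v[$ is contained in $S$; and for $a,b\in S$, $\pi_S(a,b)$ is the smallest number of edges of a polygonal path that connects $a$ to $b$ within $S$ ($\infty$ if there is none). Two vertices of $P$ are at most $k$ edges apart on $P$ if one of the two arcs of $P$ between them consists of at most $k$ edges (a vertex is $0$ edges apart from itself). (i) If $n\ge 4$ and $a,b\in\operatorname{int}P$, then there are two (possibly equal) vertices $a',b'$ of $P$ such that $a$ sees $a'$ via $\operatorname{int}P$, $b$ sees $b'$ via $\operatorname{int}P$, and $a',b'$ are at most $\lfloor n/2\rfloor-2$ edges apart on $P$. (ii) If $n\ge 5$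 and $a,b\in\operatorname{ext}P$, then there are two (possibly equal) vertices $a',b'$ of $P$ such that $a$ sees $a'$ via $\operatorname{ext}P$, $b$ sees $b'$ via $\operatorname{ext}P$, and $a',b'$ are at most $\lceil n/2\rceil-2$ edges apart on $P$; or $\pi_{\operatorname{ext}P}(a,b)\le 3$ (or both). -/

import Mathlib

/-- The Euclidean plane. -/
abbrev Plane : Type := EuclideanSpace ℝ (Fin 2)

namespace PlanePolygon

variable {n : ℕ}

/-- The two endpoints of the `i`-th edge `[p i, p (i + 1)]` (indices cyclic). -/
def edgeEnds (P : Polygon Plane n) (i : Fin n) : Set Plane :=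
  {P i, P (finRotate n i)}

/-- `P` is a simple closed `n`-gon: `n ≥ 3`, the `n` vertices are distinct, and two different
edges meet exactly in their common endpoints. (Consecutive edges may be collinear.) -/
structure IsSimpleClosed (P : Polygon Plane n) : Prop where
  three_le : 3 ≤ n
  injective : Function.Injective P.vertices
  inter_edges : ∀ i j : Fin n, i ≠ j →
    P.edgeSet ℝ i ∩ P.edgeSet ℝ j = edgeEnds P i ∩ edgeEnds P j

/-- The interior of `P`: the points of the bounded connected component(s) of the complement
of the closed curve `P`. For a simple closed polygon there is exactly one such component. -/
def inside (P : Polygon Plane n) : Set Plane :=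
  {x | x ∉ P.boundary ℝ ∧ Bornology.IsBounded (connectedComponentIn (P.boundary ℝ)ᶜ x)}

/-- The exterior of `P`: the points of the unbounded connected component of the complement
of the closed curve `P`. -/
def outside (P : Polygon Plane n) : Set Plane :=
  {x | x ∉ P.boundary ℝ ∧ ¬ Bornology.IsBounded (connectedComponentIn (P.boundary ℝ)ᶜ x)}

/-- `a` sees `v` via `S`: the open segment `]a, v[` lies in `S`. -/
def SeesVia (S : Set Plane) (a v : Plane) : Prop :=
  openSegment ℝ a v ⊆ S

/-- The number of edges between the vertices with indices `i` and `j` along a closed `n`-gon: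
the two arcs joining them have `|i - j|` and `n - |i - j|` edges, and the shorter one counts. -/
def edgesApart (i j : Fin n) : ℕ :=
  min ((i : ℤ) - (j : ℤ)).natAbs (n - ((i : ℤ) - (j : ℤ)).natAbs)

/-- The points `q 0, …, q k` are the successive vertices of a polygonal path with `k` edges
that connects `a` to `b` within `S`. -/
structure IsPolygonalPath (S : Set Plane) (a b : Plane) (k : ℕ) (q : ℕ → Plane) : Prop where
  start : q 0 = a
  finish : q k = b
  vertex_mem : ∀ i ≤ k, q i ∈ S
  edge_subset : ∀ i < k, segment ℝ (q i) (q (i + 1)) ⊆ S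

/-- `π_S(a, b)`: the smallest number of edges of a polygonal path that connects `a` to `b`
within `S`, and `⊤` if there is none. -/
noncomputable def polygonalDist (S : Set Plane) (a b : Plane) : ℕ∞ :=
  ⨅ (k : ℕ) (_ : ∃ q : ℕ → Plane, IsPolygonalPath S a b k q), (k : ℕ∞)

end PlanePolygon

namespace PlanePolygon

/-! ## Segments and planar families -/

/-! Think of a triangulation of the convex hull of the vertices that contains all edges of P. A
point of the hull off P sees the three corners of a triangle containing it. If `a` and `b` lie in
the same component of the complement, no side of the triangle of `a` can separate, in the cyclic
order of the vertices, the ends of a side of the triangle of `b`: two such diagonals of one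
component would have to cross. If the two triples share no vertex, they therefore occupy disjoint
blocks of the cycle. At least two edges of P lie within each block, so the two gaps between the
blocks have at most n - 4 edges together, and the shorter gap gives (i).

For (ii), two points of the hull are treated as in (i). A point outside the hull sees both ends of a
hull side, and a triple against a pair leaves at most n - 3 edges for the two gaps. If both points
are outside the hull, both can move far away in a common direction without meeting P, and the far
ends are joined by a segment: three edges.

No full triangulation is built. `exists_isEmptyTriangle` puts each point of the hull in a triangle
that contains no further vertex and is not cut by a given planar family of segments. It is applied
first to the edges of P, then to the edges together with the sides of the first triangle, so that
the second triangle respects the first. For a generic point the triangle is a surrounding triangle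
of least area with corners visible from the point; other points follow by closure, since there are
finitely many triangles.

The topology is elementary too. `IsCycle.not_crossing` compares angle sums: a diagonal cuts P into
two closed polygons, and the three angle sums, transported to one end of the diagonal, contradict
each other if a second diagonal in the same component separates its ends. `IsCycle.component_eq`
gives at most two components, as P is locally two-sided and connected; hence any two interior points
share a component. The counting is done in `exists_close_of_triples` and
`exists_close_of_triple_pair`. -/

/-- The cross product (signed area) of two plane vectors. -/
def cross (u v : Plane) : ℝ := u 0 * v 1 - u 1 * v 0

/-- Coordinates with respect to two linearly independent vectors of the plane. -/
theorem exists_coords {u v : Plane} (h : cross u v ≠ 0) :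
    ∃ s t : Plane →L[ℝ] ℝ, (∀ q, q = s q • u + t q • v) ∧ s u = 1 ∧ t u = 0 ∧ s v = 0 ∧ t v = 1 := by
  let e0 : Plane →L[ℝ] ℝ := EuclideanSpace.proj 0
  let e1 : Plane →L[ℝ] ℝ := EuclideanSpace.proj 1
  have h0 : ∀ q, e0 q = q 0 := fun q => rfl
  have h1 : ∀ q, e1 q = q 1 := fun q => rfl
  refine ⟨(cross u v)⁻¹ • (v 1 • e0 - v 0 • e1), (cross u v)⁻¹ • (u 0 • e1 - u 1 • e0),
    fun q => ?_, ?_, ?_, ?_, ?_⟩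
  · ext i
    fin_cases i <;> simp [h0, h1] <;> field_simp <;> simp [cross] <;> ring
  all_goals
    simp only [smul_apply, sub_apply, h0, h1, smul_eq_mul]
    field_simp
    try simp only [cross]
    try ring

/-- A family of segments with end points in `V` that contain no other points of `V` and
that do not cross. -/
structure IsPlanarFamily (V : Set Plane) (G : Set (Plane × Plane)) : Prop where
  fst_mem : ∀ g ∈ G, g.1 ∈ V
  snd_mem : ∀ g ∈ G, g.2 ∈ V
  ne : ∀ g ∈ G, g.1 ≠ g.2
  free : ∀ g ∈ G, ∀ w ∈ V, w ∉ openSegment ℝ g.1 g.2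
  noncross : ∀ g ∈ G, ∀ h ∈ G, ∀ z, z ∈ openSegment ℝ g.1 g.2 → z ∈ openSegment ℝ h.1 h.2 →
    h = g ∨ h = g.swap

/-- `x` lies on no line through two points of `V`. -/
def Generic (V : Set Plane) (x : Plane) : Prop :=
  ∀ u ∈ V, ∀ v ∈ V, u ≠ v → cross (u - x) (v - x) ≠ 0

/-- The open segment from `x` to `w` avoids all segments of `G`. -/
def Visible (G : Set (Plane × Plane)) (x w : Plane) : Prop :=
  ∀ g ∈ G, ∀ z ∈ openSegment ℝ x w, z ∉ segment ℝ g.1 g.2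

theorem mem_openSegment_of_sub {x w y : Plane} {r : ℝ} (h0 : 0 < r) (h1 : r < 1)
    (h : y - x = r • (w - x)) : y ∈ openSegment ℝ x w := by
  rw [openSegment_eq_image']
  exact ⟨r, ⟨h0, h1⟩, by simp [← h]⟩

theorem Generic.notMem_segment {V : Set Plane} {x u v : Plane} (hx : Generic V x)
    (hu : u ∈ V) (hv : v ∈ V) (huv : u ≠ v) : x ∉ segment ℝ u v := by
  rintro ⟨a, b, ha, hb, hab, rfl⟩
  refine hx u hu v hv huv ?_
  obtain rfl : a = 1 - b := by linarith
  simp [cross]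
  ring

/-- Going down from a point `z` of a segment in the triangle `x u v`, one reaches a vertex. -/
theorem exists_vertex_below {V : Set Plane} {G : Set (Plane × Plane)} (hG : IsPlanarFamily V G)
    {x u v : Plane} (hx : Generic V x)
    (hvu : Visible G x u) (hvv : Visible G x v)
    {s t : Plane →L[ℝ] ℝ} (hst : ∀ q, q = s q • (u - x) + t q • (v - x))
    {g : Plane × Plane} (hg : g ∈ G) {z : Plane} (hz : z ∈ segment ℝ g.1 g.2)
    (hs : 0 < s (z - x)) (ht : 0 < t (z - x)) (hl : s (z - x) + t (z - x) < 1) :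
    ∃ e ∈ V, (e = g.1 ∨ e = g.2) ∧ 0 ≤ s (e - x) ∧ 0 ≤ t (e - x) ∧
      s (e - x) + t (e - x) ≤ s (z - x) + t (z - x) := by
  -- The level `s + t` is affine along `g`, so it does not increase from `z` towards one of the two
  -- ends.
  have hend : ∃ e, (e = g.1 ∨ e = g.2) ∧ s (e - x) + t (e - x) ≤ s (z - x) + t (z - x) := by
    by_contra! hcon
    obtain ⟨a, b, ha, hb, hab, rfl⟩ := hz
    have e1 := hcon _ (Or.inl rfl)
    have e2 := hcon _ (Or.inr rfl)
    simp only [map_sub, map_add, map_smul, smul_eq_mul] at e1 e2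
    obtain rfl : a = 1 - b := by linarith
    rcases eq_or_lt_of_le hb with h | h
    · subst h; simp at e1
    · nlinarith
  obtain ⟨e, heg, hle⟩ := hend
  have heV : e ∈ V := by
    rcases heg with rfl | rfl
    · exact hG.fst_mem g hg
    · exact hG.snd_mem g hg
  have hseg : segment ℝ z e ⊆ segment ℝ g.1 g.2 := by
    apply (convex_segment _ _).segment_subset hz
    rcases heg with rfl | rfl
    · exact left_mem_segment ..
    · exact right_mem_segment ..
  refine ⟨e, heV, heg, ?_⟩
  by_contra hneg
  have hneg' : min (s (e - x)) (t (e - x)) < 0 := by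
    by_contra! h
    exact hneg ⟨h.trans (min_le_left _ _), h.trans (min_le_right _ _), hle⟩
  -- If `e` were outside the cone spanned by `u - x` and `v - x`, the way from `z` to `e` would
  -- leave the cone where the minimum of the coordinates vanishes. The level there is below one, so
  -- the exit point is on `]x, u[` or `]x, v[`, against visibility, or is `x` itself, against
  -- genericity.
  have hcont : ContinuousOn (fun r : ℝ => min (s (z + r • (e - z) - x)) (t (z + r • (e - z) - x)))
      (Set.Icc 0 1) := by fun_prop
  obtain ⟨r, ⟨hr0, hr1⟩, hr⟩ := intermediate_value_Icc' zero_le_one hcont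
    (show (0 : ℝ) ∈ _ from ⟨by simpa using hneg'.le, by rw [zero_smul, add_zero]; exact le_min hs.le ht.le⟩)
  set y := z + r • (e - z) with hy
  have hyseg : y ∈ segment ℝ g.1 g.2 := hseg (by
    rw [segment_eq_image']; exact ⟨r, ⟨hr0, hr1⟩, rfl⟩)
  have hylev : s (y - x) + t (y - x) < 1 := by
    have : s (y - x) + t (y - x) = (1 - r) * (s (z - x) + t (z - x)) +
        r * (s (e - x) + t (e - x)) := by
      simp only [hy, map_sub, map_add, map_smul, smul_eq_mul]; ring
    nlinarith
  have hs0 : 0 ≤ s (y - x) := by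
    have := min_le_left (s (y - x)) (t (y - x)); simp only at hr; linarith
  have ht0 : 0 ≤ t (y - x) := by
    have := min_le_right (s (y - x)) (t (y - x)); simp only at hr; linarith
  have hyx : y ≠ x := by
    rintro h
    exact hx.notMem_segment (hG.fst_mem g hg) (hG.snd_mem g hg) (hG.ne g hg) (h ▸ hyseg)
  have hexp := hst (y - x)
  rcases min_choice (s (y - x)) (t (y - x)) with h | h
  · rw [show s (y - x) = 0 from h ▸ hr, zero_smul, zero_add] at hexp
    rcases ht0.eq_or_lt with h' | h'
    · rw [← h', zero_smul] at hexp
      exact hyx (sub_eq_zero.1 hexp)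
    · exact hvv g hg y (mem_openSegment_of_sub h' (by linarith) hexp) hyseg
  · rw [show t (y - x) = 0 from h ▸ hr, zero_smul, add_zero] at hexp
    rcases hs0.eq_or_lt with h' | h'
    · rw [← h', zero_smul] at hexp
      exact hyx (sub_eq_zero.1 hexp)
    · exact hvu g hg y (mem_openSegment_of_sub h' (by linarith) hexp) hyseg

/-- If the triangle `x u v`, with `u` and `v` visible from `x`, contains another vertex,
then it contains another vertex that is visible from `x`. -/
theorem exists_visible_in_triangle {V : Set Plane} (hV : V.Finite) {G : Set (Plane × Plane)}
    (hG : IsPlanarFamily V G) {x u v : Plane} (hx : Generic V x) (hu : u ∈ V) (hv : v ∈ V)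
    (hvu : Visible G x u) (hvv : Visible G x v)
    {s t : Plane →L[ℝ] ℝ} (hst : ∀ q, q = s q • (u - x) + t q • (v - x))
    (hsu : s (u - x) = 1) (htu : t (u - x) = 0) (hsv : s (v - x) = 0) (htv : t (v - x) = 1)
    (hex : ∃ w ∈ V, w ≠ u ∧ w ≠ v ∧ 0 ≤ s (w - x) ∧ 0 ≤ t (w - x) ∧ s (w - x) + t (w - x) ≤ 1) :
    ∃ w ∈ V, w ≠ u ∧ w ≠ v ∧ 0 ≤ s (w - x) ∧ 0 ≤ t (w - x) ∧ s (w - x) + t (w - x) ≤ 1 ∧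
      Visible G x w := by
  set A := {w ∈ V | w ≠ u ∧ w ≠ v ∧ 0 ≤ s (w - x) ∧ 0 ≤ t (w - x) ∧ s (w - x) + t (w - x) ≤ 1}
  have hA : A.Finite := hV.subset (fun w hw => hw.1)
  -- A vertex of least level is visible: a blocking segment would have an end in the triangle at a
  -- still lower level, and that end is neither `u` nor `v`, whose level is one.
  obtain ⟨w, hwA, hmin⟩ := Set.exists_min_image A (fun w => s (w - x) + t (w - x)) hA
    (by obtain ⟨w, hw⟩ := hex; exact ⟨w, hw⟩)
  obtain ⟨hwV, hwu, hwv, hs, ht, hl⟩ := hwA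
  refine ⟨w, hwV, hwu, hwv, hs, ht, hl, ?_⟩
  have hcr : ∀ p ∈ V, w ≠ p → ∀ c : ℝ, w - x ≠ c • (p - x) := by
    intro p hp hwp c hc
    refine hx w hwV p hp hwp ?_
    rw [hc]
    simp [cross]; ring
  have hs' : 0 < s (w - x) := by
    rcases hs.eq_or_lt with h | h
    · exact absurd (by simpa [← h] using hst (w - x)) (hcr v hv hwv (t (w - x)))
    · exact h
  have ht' : 0 < t (w - x) := by
    rcases ht.eq_or_lt with h | h
    · exact absurd (by simpa [← h] using hst (w - x)) (hcr u hu hwu (s (w - x)))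
    · exact h
  intro g hg z hz hzg
  rw [openSegment_eq_image'] at hz
  obtain ⟨r, ⟨hr0, hr1⟩, rfl⟩ := hz
  have hsz : s (x + r • (w - x) - x) = r * s (w - x) := by simp
  have htz : t (x + r • (w - x) - x) = r * t (w - x) := by simp
  obtain ⟨e, heV, -, hes, het, hel⟩ := exists_vertex_below hG hx hvu hvv hst hg hzg
    (by rw [hsz]; positivity) (by rw [htz]; positivity) (by rw [hsz, htz]; nlinarith)
  rw [hsz, htz] at hel
  have hlt : s (e - x) + t (e - x) < s (w - x) + t (w - x) := by nlinarith
  have : e ∈ A := by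
    refine ⟨heV, ?_, ?_, hes, het, by linarith⟩
    · rintro rfl; rw [hsu, htu] at hlt; linarith
    · rintro rfl; rw [hsv, htv] at hlt; linarith
  exact absurd (hmin e this) (by simpa using hlt)

end PlanePolygon

namespace PlanePolygon

/-! ## The nearest visible vertex -/

theorem Generic.notMem {V : Set Plane} {x u v : Plane} (hx : Generic V x)
    (hu : u ∈ V) (hv : v ∈ V) (huv : u ≠ v) : x ∉ V := by
  intro hxV
  by_cases h : x = u
  · exact hx u hu v hv huv (by simp [h, cross])
  · exact hx u hu x hxV (Ne.symm h) (by simp [cross])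

theorem cross_smul_self (c : ℝ) (v : Plane) : cross v (c • v) = 0 := by
  simp [cross]; ring

theorem IsPlanarFamily.finite {V : Set Plane} (hV : V.Finite) {G : Set (Plane × Plane)}
    (hG : IsPlanarFamily V G) : G.Finite :=
  (hV.prod hV).subset fun g hg => ⟨hG.fst_mem g hg, hG.snd_mem g hg⟩

theorem IsPlanarFamily.mem_open {V : Set Plane} {G : Set (Plane × Plane)}
    (hG : IsPlanarFamily V G) {g : Plane × Plane} (hg : g ∈ G) {y : Plane}
    (hy : y ∈ segment ℝ g.1 g.2) (hyV : y ∉ V) : y ∈ openSegment ℝ g.1 g.2 :=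
  mem_openSegment_of_ne_left_right (fun h => hyV (h ▸ hG.fst_mem g hg))
    (fun h => hyV (h ▸ hG.snd_mem g hg)) hy

theorem eq_zero_of_pos_comb {a b k l : ℝ} (ha : 0 < a) (hb : 0 < b) (hk : k ≤ 0) (hl : l ≤ 0)
    (h : a * k + b * l = 0) : k = 0 ∧ l = 0 := by
  have h1 := mul_nonpos_of_nonneg_of_nonpos ha.le hk
  have h2 := mul_nonpos_of_nonneg_of_nonpos hb.le hl
  have h3 : a * k = 0 := by linarith
  have h4 : b * l = 0 := by linarith
  exact ⟨(mul_eq_zero.1 h3).resolve_left ha.ne', (mul_eq_zero.1 h4).resolve_left hb.ne'⟩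

set_option maxHeartbeats 1000000 in
/-- In every closed half-plane bounded by a line through `x` that contains a vertex, some vertex
is visible from `x`. -/
theorem exists_visible_halfplane {V : Set Plane} (hV : V.Finite) {G : Set (Plane × Plane)}
    (hG : IsPlanarFamily V G) {x : Plane} (hx : Generic V x) (f : Plane →L[ℝ] ℝ)
    {w₀ : Plane} (hw₀ : w₀ ∈ V) (hf : 0 ≤ f (w₀ - x)) :
    ∃ w ∈ V, 0 ≤ f (w - x) ∧ Visible G x w := by
  by_cases hvis : Visible G x w₀
  · exact ⟨w₀, hw₀, hf, hvis⟩
  have hxG : ∀ g ∈ G, x ∉ segment ℝ g.1 g.2 := fun g hg =>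
    hx.notMem_segment (hG.fst_mem g hg) (hG.snd_mem g hg) (hG.ne g hg)
  -- the first point `y` of the segment from `x` to `w₀` on the family
  obtain ⟨r₀, ⟨⟨hr₀0, hr₀1⟩, g, hg, hyg⟩, hleast⟩ : ∃ r₀, IsLeast
      {r : ℝ | r ∈ Set.Icc 0 1 ∧ ∃ g ∈ G, x + r • (w₀ - x) ∈ segment ℝ g.1 g.2} r₀ := by
    apply IsCompact.exists_isLeast
    · have : IsClosed (⋃ g ∈ G, segment ℝ g.1 g.2) :=
        (hG.finite hV).isClosed_biUnion fun g _ => by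
          rw [segment_eq_image_lineMap]
          exact (isCompact_Icc.image (by fun_prop)).isClosed
      have h2 := this.preimage (f := fun r : ℝ => x + r • (w₀ - x)) (by fun_prop)
      convert! (isCompact_Icc (a := (0 : ℝ)) (b := 1)).inter_right h2 using 1
      ext r; simp
    · unfold Visible at hvis
      push Not at hvis
      obtain ⟨g, hg, z, hz, hzg⟩ := hvis
      rw [openSegment_eq_image'] at hz
      obtain ⟨r, hr, rfl⟩ := hz
      exact ⟨r, ⟨hr.1.le, hr.2.le⟩, g, hg, hzg⟩
  have hxV : x ∉ V := hx.notMem (hG.fst_mem g hg) (hG.snd_mem g hg) (hG.ne g hg)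
  have hr₀pos : 0 < r₀ := by
    rcases hr₀0.eq_or_lt with h | h
    · subst h; exact absurd (by simpa using hyg) (hxG g hg)
    · exact h
  have hr₀lt : r₀ < 1 := by
    unfold Visible at hvis
    push Not at hvis
    obtain ⟨h, hh, z, hz, hzg⟩ := hvis
    rw [openSegment_eq_image'] at hz
    obtain ⟨r, hr, rfl⟩ := hz
    exact (hleast ⟨⟨hr.1.le, hr.2.le⟩, h, hh, hzg⟩).trans_lt hr.2
  set y := x + r₀ • (w₀ - x) with hy
  have hyx : y - x = r₀ • (w₀ - x) := by simp [hy]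
  have hparV : ∀ w ∈ V, ∀ c : ℝ, w - x = c • (w₀ - x) → w = w₀ := by
    intro w hw c hc
    by_contra hne
    exact hx w₀ hw₀ w hw (Ne.symm hne) (by rw [hc, cross_smul_self])
  have hw₀x : w₀ - x ≠ 0 := fun h => hxV (sub_eq_zero.1 h ▸ hw₀)
  have hyV : y ∉ V := by
    intro h
    have h2 := hparV y h r₀ hyx
    rw [h2] at hyx
    have : (1 - r₀) • (w₀ - x) = 0 := by rw [sub_smul, one_smul, ← hyx, sub_self]
    rcases smul_eq_zero.1 this with h | h
    · linarith
    · exact hw₀x h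
  have hyo := hG.mem_open hg hyg hyV
  have hfy : 0 ≤ f (y - x) := by rw [hyx]; simp only [map_smul, smul_eq_mul]; positivity
  -- an end point `u` of the first segment in the half-plane
  obtain ⟨u, u', hu, hu', huu', hyu, hfu, hsegu⟩ : ∃ u u', u ∈ V ∧ u' ∈ V ∧ u ≠ u' ∧
      y ∈ openSegment ℝ u u' ∧ 0 ≤ f (u - x) ∧ openSegment ℝ u u' = openSegment ℝ g.1 g.2 := by
    by_cases h : 0 ≤ f (g.1 - x)
    · exact ⟨g.1, g.2, hG.fst_mem g hg, hG.snd_mem g hg, hG.ne g hg, hyo, h, rfl⟩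
    · refine ⟨g.2, g.1, hG.snd_mem g hg, hG.fst_mem g hg, (hG.ne g hg).symm,
        by rwa [openSegment_symm], ?_, openSegment_symm ..⟩
      by_contra h'
      obtain ⟨a, b, ha, hb, hab, h3⟩ := hyo
      rw [← h3] at hfy
      simp only [map_sub, map_add, map_smul, smul_eq_mul] at h h' hfy
      obtain rfl : a = 1 - b := by linarith
      nlinarith
  obtain ⟨a, b, ha, hb, hab, hyab⟩ := hyu
  have hw₀u : w₀ ≠ u := by
    rintro rfl
    have h1 : b • (u' - x) = (r₀ - a) • (w₀ - x) := by
      have : y - x = a • (w₀ - x) + b • (u' - x) := by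
        rw [← hyab, smul_sub, smul_sub]
        have : x = a • x + b • x := by rw [← add_smul, hab, one_smul]
        nth_rewrite 1 [this]; abel
      rw [sub_smul, ← hyx, this]; abel
    refine huu' (hparV u' hu' (b⁻¹ * (r₀ - a)) ?_).symm
    rw [mul_smul, ← h1, smul_smul, inv_mul_cancel₀ hb.ne', one_smul]
  have hcr : cross (y - x) (u - x) ≠ 0 := by
    rw [hyx]
    have : cross (r₀ • (w₀ - x)) (u - x) = r₀ * cross (w₀ - x) (u - x) := by
      simp [cross]; ring
    rw [this]
    exact mul_ne_zero hr₀pos.ne' (hx w₀ hw₀ u hu hw₀u)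
  obtain ⟨s, t, hst, hsy, hty, hsu, htu⟩ := exists_coords hcr
  -- the segment `g` has level one
  have hlevg : ∀ z ∈ openSegment ℝ u u', s (z - x) + t (z - x) = 1 := by
    have h1 : s (u' - x) + t (u' - x) = 1 := by
      have h2 : s (y - x) + t (y - x) = 1 := by rw [hsy, hty]; ring
      rw [← hyab] at h2
      simp only [map_sub, map_add, map_smul, smul_eq_mul] at h2 hsu htu ⊢
      obtain rfl : a = 1 - b := by linarith
      have : b * (s u' - s x + (t u' - t x) - 1) = 0 := by linear_combination h2 - (1-b)*hsu - (1-b)*htu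
      rcases mul_eq_zero.1 this with h | h <;> linarith
    rintro z ⟨a', b', ha', hb', hab', rfl⟩
    simp only [map_sub, map_add, map_smul, smul_eq_mul] at h1 hsu htu ⊢
    obtain rfl : a' = 1 - b' := by linarith
    linear_combination (1-b')*hsu + (1-b')*htu + b' * h1
  have hblock : ∀ h ∈ G, ∀ p, p ∈ segment ℝ h.1 h.2 → p ∈ openSegment ℝ u u' →
      segment ℝ h.1 h.2 = segment ℝ g.1 g.2 := by
    intro h hh p hp hpu
    rw [hsegu] at hpu
    have hpo := hG.mem_open hh hp (fun hpV => hG.free g hg p hpV hpu)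
    rcases hG.noncross g hg h hh p hpu hpo with rfl | rfl
    · rfl
    · exact segment_symm ..
  -- Among the vertices of the triangle `x y u` off the ray through `y`, the one angularly closest
  -- to that ray is taken. The positive combination of `y - x` and `u - x` stays in the half-plane;
  -- visibility is what remains.
  set A := {w ∈ V | 0 ≤ s (w - x) ∧ 0 < t (w - x) ∧ s (w - x) + t (w - x) ≤ 1}
  obtain ⟨w, ⟨hwV, hws, hwt, hwl⟩, hmax⟩ := Set.exists_max_image A (fun w => s (w - x) / t (w - x))
    (hV.subset fun w hw => hw.1) ⟨u, hu, hsu.ge, by simp [htu], by simp [hsu, htu]⟩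
  refine ⟨w, hwV, ?_, ?_⟩
  · rw [hst (w - x)]
    simp only [map_add, map_smul, smul_eq_mul]
    positivity
  intro h hh z hz hzh
  rw [openSegment_eq_image'] at hz
  obtain ⟨r, ⟨hr0, hr1⟩, hz⟩ := hz
  have hzx : z - x = r • (w - x) := by simp [← hz]
  have hwx : w - x ≠ 0 := fun h => hxV (sub_eq_zero.1 h ▸ hwV)
  have hparw : ∀ p ∈ V, ∀ c : ℝ, p - x = c • (w - x) → p = w := by
    intro p hp c hc
    by_contra hne
    exact hx w hwV p hp (Ne.symm hne) (by rw [hc, cross_smul_self])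
  have hzV : z ∉ V := by
    intro h
    have h2 := hparw z h r hzx
    rw [h2] at hzx
    have : (1 - r) • (w - x) = 0 := by rw [sub_smul, one_smul, ← hzx, sub_self]
    rcases smul_eq_zero.1 this with h | h
    · linarith
    · exact hwx h
  have hzo := hG.mem_open hh hzh hzV
  have hsz : s (z - x) = r * s (w - x) := by rw [hzx]; simp
  have htz : t (z - x) = r * t (w - x) := by rw [hzx]; simp
  have hexp : ∀ p, t (w - x) • (p - x) = t (p - x) • (w - x) +
      (s (p - x) * t (w - x) - t (p - x) * s (w - x)) • (y - x) := by
    intro p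
    conv_lhs => rw [hst (p - x)]
    conv_rhs => enter [1]; rw [hst (w - x)]
    module
  -- an end point of the blocking segment on the side of `y`
  obtain ⟨e, heV, heh, heφ⟩ : ∃ e ∈ V, (e = h.1 ∨ e = h.2) ∧
      0 < s (e - x) * t (w - x) - t (e - x) * s (w - x) := by
    by_contra! hcon
    have e1 := hcon _ (hG.fst_mem h hh) (Or.inl rfl)
    have e2 := hcon _ (hG.snd_mem h hh) (Or.inr rfl)
    obtain ⟨a', b', ha', hb', hab', h3⟩ := hzo
    have hz0 : s (z - x) * t (w - x) - t (z - x) * s (w - x) = 0 := by rw [hsz, htz]; ring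
    have hcomb : a' * (s (h.1 - x) * t (w - x) - t (h.1 - x) * s (w - x)) +
        b' * (s (h.2 - x) * t (w - x) - t (h.2 - x) * s (w - x)) = 0 := by
      rw [← hz0, ← h3]
      obtain rfl : a' = 1 - b' := by linarith
      simp only [map_sub, map_add, map_smul, smul_eq_mul]; ring
    obtain ⟨z1, z2⟩ := eq_zero_of_pos_comb ha' hb' e1 e2 hcomb
    have key : ∀ p ∈ V, s (p - x) * t (w - x) - t (p - x) * s (w - x) = 0 → p = w := by
      intro p hp h0
      refine hparw p hp ((t (w - x))⁻¹ * t (p - x)) ?_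
      have := hexp p
      rw [h0, zero_smul, add_zero] at this
      rw [mul_smul, ← this, smul_smul, inv_mul_cancel₀ hwt.ne', one_smul]
    exact hG.ne h hh ((key _ (hG.fst_mem h hh) z1).trans (key _ (hG.snd_mem h hh) z2).symm)
  have hseg : segment ℝ z e ⊆ segment ℝ h.1 h.2 := by
    apply (convex_segment _ _).segment_subset hzh
    rcases heh with rfl | rfl
    · exact left_mem_segment ..
    · exact right_mem_segment ..
  have hφt : ∀ p, 0 < s (p - x) * t (w - x) - t (p - x) * s (w - x) → 0 ≤ t (p - x) →
      0 < s (p - x) := by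
    intro p hp ht
    by_contra! hc
    nlinarith [mul_nonneg ht hws, mul_nonneg (neg_nonneg.2 hc) hwt.le]
  have hlz : s (z - x) + t (z - x) < 1 := by rw [hsz, htz]; nlinarith
  have htz' : 0 < t (z - x) := by rw [htz]; positivity
  -- The end `e` is angularly closer to `y` than `w` is, so maximality keeps it out of the triangle.
  -- On the ray through `y` the only possible vertex is `w₀`, which lies beyond `y` at a level above
  -- one.
  have hout : min (t (e - x)) (1 - (s (e - x) + t (e - x))) < 0 := by
    by_contra! hin
    have ht := hin.trans (min_le_left _ _)
    have hl := hin.trans (min_le_right _ _)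
    have hs := hφt e heφ ht
    rcases ht.eq_or_lt with h0 | h0
    · have h1 := hst (e - x)
      rw [← h0, zero_smul, add_zero, hyx, smul_smul] at h1
      have h2 := hparV e heV _ h1
      rw [h2] at h1
      have h3 : (1 - s (w₀ - x) * r₀) • (w₀ - x) = 0 := by
        rw [sub_smul, one_smul, ← h1, sub_self]
      rcases smul_eq_zero.1 h3 with h4 | h4
      · rw [h2] at hl h0
        nlinarith
      · exact hw₀x h4
    · have h1 := hmax e ⟨heV, hs.le, h0, by linarith⟩
      rw [div_le_div_iff₀ h0 hwt] at h1
      linarith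
  have hcont : ContinuousOn (fun ρ : ℝ => min (t (z + ρ • (e - z) - x))
      (1 - (s (z + ρ • (e - z) - x) + t (z + ρ • (e - z) - x)))) (Set.Icc 0 1) := by fun_prop
  obtain ⟨ρ, ⟨hρ0, hρ1⟩, hρ⟩ := intermediate_value_Icc' zero_le_one hcont
    (show (0 : ℝ) ∈ _ from ⟨by rw [one_smul, add_sub_cancel]; exact hout.le,
      by rw [zero_smul, add_zero]; exact le_min htz'.le (by linarith)⟩)
  set p := z + ρ • (e - z) with hp
  simp only at hρ
  have hph : p ∈ segment ℝ h.1 h.2 := hseg (by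
    rw [segment_eq_image']; exact ⟨ρ, ⟨hρ0, hρ1⟩, rfl⟩)
  have hρpos : 0 < ρ := by
    rcases hρ0.eq_or_lt with h0 | h0
    · exfalso
      rw [← h0, zero_smul, add_zero] at hρ
      have : 0 < min (t (z - x)) (1 - (s (z - x) + t (z - x))) := lt_min htz' (by linarith)
      linarith
    · exact h0
  have hφp : 0 < s (p - x) * t (w - x) - t (p - x) * s (w - x) := by
    have : s (p - x) * t (w - x) - t (p - x) * s (w - x) =
        ρ * (s (e - x) * t (w - x) - t (e - x) * s (w - x)) := by
      have h1 : s (p - x) = s (z - x) + ρ * (s (e - x) - s (z - x)) := by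
        simp only [hp, map_sub, map_add, map_smul, smul_eq_mul]; ring
      have h2 : t (p - x) = t (z - x) + ρ * (t (e - x) - t (z - x)) := by
        simp only [hp, map_sub, map_add, map_smul, smul_eq_mul]; ring
      rw [h1, h2, hsz, htz]; ring
    rw [this]; positivity
  have htp : 0 ≤ t (p - x) := hρ ▸ min_le_left _ _
  have hlp : s (p - x) + t (p - x) ≤ 1 := by
    have := min_le_right (t (p - x)) (1 - (s (p - x) + t (p - x)))
    linarith
  have hsp := hφt p hφp htp
  have hpexp := hst (p - x)
  have hyu : y ∈ openSegment ℝ u u' := ⟨a, b, ha, hb, hab, hyab⟩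
  -- The blocking segment leaves the triangle at `p`. If `p` is on the side `y u`, noncrossing
  -- identifies the segment with `g`, although `z` has level below one; if `p` is on `x y` before
  -- `y`, then `y` was not the first obstacle.
  have hfinish : p ∈ openSegment ℝ u u' → False := by
    intro hpo
    have h1 := hblock h hh p hph hpo
    have h2 : z ∈ openSegment ℝ u u' := by
      rw [hsegu]
      exact hG.mem_open hg (h1 ▸ hzh) hzV
    have := hlevg z h2
    linarith
  rcases hlp.lt_or_eq with hlt | heq
  · have ht0 : t (p - x) = 0 := by
      rcases min_choice (t (p - x)) (1 - (s (p - x) + t (p - x))) with h0 | h0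
      · exact h0 ▸ hρ
      · linarith
    rw [ht0, zero_smul, add_zero, hyx, smul_smul] at hpexp
    have h1 := hleast (a := s (p - x) * r₀) ⟨⟨by positivity, by nlinarith⟩, h, hh, by
      rw [← hpexp, add_sub_cancel]; exact hph⟩
    nlinarith
  · rcases htp.eq_or_lt with ht0 | ht0
    · rw [← ht0, zero_smul, add_zero, show s (p - x) = 1 by linarith, one_smul] at hpexp
      exact hfinish ((sub_left_inj.1 hpexp) ▸ hyu)
    · apply hfinish
      clear_value p y
      generalize s (p - x) = σ at *
      generalize t (p - x) = τ at *
      obtain rfl : σ = 1 - τ := by linarith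
      refine ⟨(1 - τ) * a + τ, (1 - τ) * b, by positivity, by positivity, ?_, ?_⟩
      · linear_combination (1 - τ) * hab
      · rw [eq_comm, ← sub_eq_zero]
        rw [← hyab, ← sub_eq_zero] at hpexp
        rw [← hpexp]
        module

end PlanePolygon

namespace PlanePolygon

/-! ## Surrounding triangles -/

/-- Three vertices, visible from `x`, whose open triangle contains `x`. -/
structure Surrounds (V : Set Plane) (G : Set (Plane × Plane)) (x A B C : Plane) : Prop where
  memA : A ∈ V
  memB : B ∈ V
  memC : C ∈ V
  visA : Visible G x A
  visB : Visible G x B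
  visC : Visible G x C
  comb : ∃ α β γ : ℝ, 0 < α ∧ 0 < β ∧ 0 < γ ∧ α + β + γ = 1 ∧ α • A + β • B + γ • C = x

theorem exists_le_le (a b c : ℝ) : (a ≤ b ∧ a ≤ c) ∨ (b ≤ c ∧ b ≤ a) ∨ (c ≤ a ∧ c ≤ b) := by
  grind

theorem exists_ge_ge (a b c : ℝ) : (b ≤ a ∧ c ≤ a) ∨ (c ≤ b ∧ a ≤ b) ∨ (a ≤ c ∧ b ≤ c) := by
  grind

section Triangle

variable {V : Set Plane} {G : Set (Plane × Plane)} {x A B C : Plane}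

theorem Surrounds.rotate (h : Surrounds V G x A B C) : Surrounds V G x B C A := by
  obtain ⟨α, β, γ, h1, h2, h3, h4, h5⟩ := h.comb
  exact ⟨h.memB, h.memC, h.memA, h.visB, h.visC, h.visA, β, γ, α, h2, h3, h1, by linarith,
    by rw [← h5]; abel⟩

theorem Generic.notMem' (hx : Generic V x) (hV : V.Nontrivial) : x ∉ V := by
  obtain ⟨u, hu, v, hv, huv⟩ := hV
  exact hx.notMem hu hv huv

theorem Surrounds.ne (h : Surrounds V G x A B C) (hx : Generic V x) (hV : V.Nontrivial) :
    A ≠ B := by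
  rintro rfl
  obtain ⟨α, β, γ, h1, h2, h3, h4, h5⟩ := h.comb
  by_cases hAC : A = C
  · subst hAC
    apply hx.notMem' hV
    rw [← add_smul, ← add_smul, h4, one_smul] at h5
    exact h5 ▸ h.memA
  · refine hx.notMem_segment h.memA h.memC hAC ⟨α + β, γ, by positivity, h3.le, h4, ?_⟩
    rw [add_smul, h5]

/-- Twice the signed area of a triangle. -/
def area (A B C : Plane) : ℝ := cross (B - A) (C - A)

theorem area_rotate (A B C : Plane) : area B C A = area A B C := by
  simp [area, cross]; ring

/-- Applying `s` to the relation `α (A - x) + β (B - x) + γ (C - x) = 0` leaves `α + γ s (C - x) =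
0`. The sign keeps `C` out of the cone over `A B`, where the arguments about the subtriangle `x A B`
take place. -/
theorem Surrounds.coords (h : Surrounds V G x A B C) (hx : Generic V x) (hV : V.Nontrivial) :
    ∃ s t : Plane →L[ℝ] ℝ, (∀ q, q = s q • (A - x) + t q • (B - x)) ∧
      s (A - x) = 1 ∧ t (A - x) = 0 ∧ s (B - x) = 0 ∧ t (B - x) = 1 ∧ s (C - x) < 0 := by
  obtain ⟨s, t, hst, h1, h2, h3, h4⟩ := exists_coords (hx A h.memA B h.memB (h.ne hx hV))
  refine ⟨s, t, hst, h1, h2, h3, h4, ?_⟩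
  obtain ⟨α, β, γ, hα, hβ, hγ, h5, h6⟩ := h.comb
  have : α * s (A - x) + β * s (B - x) + γ * s (C - x) = 0 := by
    rw [← h6]
    simp only [map_sub, map_add, map_smul, smul_eq_mul]
    obtain rfl : α = 1 - β - γ := by linarith
    ring
  rw [h1, h3] at this
  by_contra! hc
  have := mul_nonneg hγ.le hc
  linarith

/-- Every other vertex in a surrounding triangle gives one that is visible. -/
theorem Surrounds.exists_visible_of_le (h : Surrounds V G x A B C) (hx : Generic V x)
    (hV : V.Nontrivial) (hVf : V.Finite) (hG : IsPlanarFamily V G)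
    {α β γ m₁ m₂ m₃ : ℝ} (hα : 0 < α) (hβ : 0 < β) (hγ : 0 < γ) (h1 : α + β + γ = 1)
    (h2 : α • A + β • B + γ • C = x) (hm₁ : 0 ≤ m₁) (hm₃ : 0 ≤ m₃)
    (hm : m₁ + m₂ + m₃ = 1) (hle₁ : m₃ / γ ≤ m₁ / α) (hle₂ : m₃ / γ ≤ m₂ / β)
    (heV : m₁ • A + m₂ • B + m₃ • C ∈ V) (heA : m₁ • A + m₂ • B + m₃ • C ≠ A)
    (heB : m₁ • A + m₂ • B + m₃ • C ≠ B) :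
    ∃ n₁ n₂ n₃ : ℝ, 0 ≤ n₁ ∧ 0 ≤ n₂ ∧ 0 ≤ n₃ ∧ n₁ + n₂ + n₃ = 1 ∧
      n₁ • A + n₂ • B + n₃ • C ∈ V ∧ n₁ • A + n₂ • B + n₃ • C ≠ A ∧
      n₁ • A + n₂ • B + n₃ • C ≠ B ∧ n₁ • A + n₂ • B + n₃ • C ≠ C ∧
      Visible G x (n₁ • A + n₂ • B + n₃ • C) := by
  obtain ⟨s, t, hst, hsA, htA, hsB, htB, hsC⟩ := h.coords hx hV
  -- Subtracting `l` times the relation for `x` eliminates `C`. That the ratio at `C` is the least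
  -- one says exactly that the remaining coefficients of `A - x` and `B - x` are nonnegative, so the
  -- point is in the subtriangle `x A B`.
  set l := m₃ / γ with hl
  have hl0 : 0 ≤ l := by positivity
  have hlγ : l * γ = m₃ := div_mul_cancel₀ _ hγ.ne'
  rw [le_div_iff₀ hα] at hle₁
  rw [le_div_iff₀ hβ] at hle₂
  have hexp : m₁ • A + m₂ • B + m₃ • C - x = (m₁ - l * α) • (A - x) + (m₂ - l * β) • (B - x) := by
    have hx0 : α • (A - x) + β • (B - x) + γ • (C - x) = 0 := by
      obtain rfl : α = 1 - β - γ := by linarith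
      rw [← sub_eq_zero.2 h2]
      module
    have h3 : m₁ • A + m₂ • B + m₃ • C - x = m₁ • (A - x) + m₂ • (B - x) + m₃ • (C - x) := by
      obtain rfl : m₁ = 1 - m₂ - m₃ := by linarith
      module
    rw [h3, ← hlγ, mul_smul, show γ • (C - x) = - (α • (A - x) + β • (B - x)) by
      rw [eq_neg_iff_add_eq_zero, ← hx0]; abel]
    module
  have hse : s (m₁ • A + m₂ • B + m₃ • C - x) = m₁ - l * α := by
    rw [hexp, map_add, map_smul, map_smul, hsA, hsB]; simp
  have hte : t (m₁ • A + m₂ • B + m₃ • C - x) = m₂ - l * β := by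
    rw [hexp, map_add, map_smul, map_smul, htA, htB]; simp
  obtain ⟨w, hwV, hwA, hwB, hs, ht, hlev, hvis⟩ := exists_visible_in_triangle hVf hG hx h.memA
    h.memB h.visA h.visB hst hsA htA hsB htB ⟨_, heV, heA, heB, by rw [hse]; linarith,
      by rw [hte]; linarith, by rw [hse, hte]; nlinarith⟩
  have hw : (s (w - x) + (1 - s (w - x) - t (w - x)) * α) • A +
      (t (w - x) + (1 - s (w - x) - t (w - x)) * β) • B +
      ((1 - s (w - x) - t (w - x)) * γ) • C = w := by
    have h3 := hst (w - x)
    generalize s (w - x) = σ at *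
    generalize t (w - x) = τ at *
    have h4 : w = (1 - σ - τ) • x + σ • A + τ • B := by
      rw [← sub_eq_zero] at h3 ⊢
      rw [← h3]; module
    rw [h4, ← h2]; module
  refine ⟨_, _, _, ?_, ?_, ?_, ?_, by rw [hw]; exact hwV, by rw [hw]; exact hwA,
    by rw [hw]; exact hwB, ?_, by rw [hw]; exact hvis⟩
  · nlinarith
  · nlinarith
  · nlinarith
  · linear_combination (1 - s (w - x) - t (w - x)) * h1
  · rw [hw]; rintro rfl; linarith

/-- The subtriangles `x A B`, `x B C`, `x C A` cover the triangle; the least of the three ratios of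
barycentric coordinates tells which one contains the given vertex, and rotation reduces to the
first. -/
theorem Surrounds.exists_visible (h : Surrounds V G x A B C) (hx : Generic V x)
    (hV : V.Nontrivial) (hVf : V.Finite) (hG : IsPlanarFamily V G)
    {m₁ m₂ m₃ : ℝ} (hm₁ : 0 ≤ m₁) (hm₂ : 0 ≤ m₂) (hm₃ : 0 ≤ m₃)
    (hm : m₁ + m₂ + m₃ = 1)
    (heV : m₁ • A + m₂ • B + m₃ • C ∈ V) (heA : m₁ • A + m₂ • B + m₃ • C ≠ A)
    (heB : m₁ • A + m₂ • B + m₃ • C ≠ B) (heC : m₁ • A + m₂ • B + m₃ • C ≠ C) :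
    ∃ n₁ n₂ n₃ : ℝ, 0 ≤ n₁ ∧ 0 ≤ n₂ ∧ 0 ≤ n₃ ∧ n₁ + n₂ + n₃ = 1 ∧
      n₁ • A + n₂ • B + n₃ • C ∈ V ∧ n₁ • A + n₂ • B + n₃ • C ≠ A ∧
      n₁ • A + n₂ • B + n₃ • C ≠ B ∧ n₁ • A + n₂ • B + n₃ • C ≠ C ∧
      Visible G x (n₁ • A + n₂ • B + n₃ • C) := by
  obtain ⟨α, β, γ, hα, hβ, hγ, h1, h2⟩ := h.comb
  have r1 : ∀ a b c : ℝ, b • B + c • C + a • A = a • A + b • B + c • C := fun a b c => by abel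
  have r2 : ∀ a b c : ℝ, c • C + a • A + b • B = a • A + b • B + c • C := fun a b c => by abel
  by_cases hc : m₃ / γ ≤ m₁ / α ∧ m₃ / γ ≤ m₂ / β
  · exact h.exists_visible_of_le hx hV hVf hG hα hβ hγ h1 h2 hm₁ hm₃ hm hc.1 hc.2 heV heA heB
  by_cases hb : m₂ / β ≤ m₃ / γ ∧ m₂ / β ≤ m₁ / α
  · obtain ⟨n₃, n₁, n₂, h3, h4, h5, h6, h7, h8, h9, h10, h11⟩ :=
      h.rotate.rotate.exists_visible_of_le hx hV hVf hG hγ hα hβ (by linarith)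
        (by rw [r2, h2]) hm₃ hm₂ (by linarith) hb.1 hb.2 (by rwa [r2]) (by rwa [r2])
        (by rwa [r2])
    rw [r2] at h7 h8 h9 h10 h11
    exact ⟨n₁, n₂, n₃, h4, h5, h3, by linarith, h7, h9, h10, h8, h11⟩
  have ha : m₁ / α ≤ m₂ / β ∧ m₁ / α ≤ m₃ / γ := by
    rcases exists_le_le (m₁ / α) (m₂ / β) (m₃ / γ) with h | h | h
    · exact h
    · exact absurd h hb
    · exact absurd h hc
  obtain ⟨n₂, n₃, n₁, h3, h4, h5, h6, h7, h8, h9, h10, h11⟩ :=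
    h.rotate.exists_visible_of_le hx hV hVf hG hβ hγ hα (by linarith)
      (by rw [r1, h2]) hm₂ hm₁ (by linarith) ha.1 ha.2 (by rwa [r1]) (by rwa [r1])
      (by rwa [r1])
  rw [r1] at h7 h8 h9 h10 h11
  exact ⟨n₁, n₂, n₃, h5, h3, h4, by linarith, h7, h10, h8, h9, h11⟩

theorem area_ne_zero (h : Surrounds V G x A B C) (hx : Generic V x) (hV : V.Nontrivial) :
    area A B C ≠ 0 := by
  obtain ⟨α, β, γ, hα, hβ, hγ, h1, h2⟩ := h.comb
  have h3 := hx A h.memA B h.memB (h.ne hx hV)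
  intro h0
  apply h3
  have : cross (A - x) (B - x) = γ * area A B C := by
    rw [← h2]
    obtain rfl : α = 1 - β - γ := by linarith
    simp [area, cross]; ring
  rw [this, h0, mul_zero]

/-- The corner with the largest ratio is replaced by the new vertex `e`. Solving for `C` and
substituting gives `x` the weights `α - γ m₁ / m₃`, `β - γ m₂ / m₃`, `γ / m₃`; the first two are
nonnegative by the choice of corner and nonzero by genericity. The area is multiplied by `m₃ < 1`.
-/
theorem Surrounds.exists_smaller_of_le (h : Surrounds V G x A B C) (hx : Generic V x)
    (hV : V.Nontrivial)
    {α β γ m₁ m₂ m₃ : ℝ} (hα : 0 < α) (hβ : 0 < β) (hγ : 0 < γ) (h1 : α + β + γ = 1)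
    (h2 : α • A + β • B + γ • C = x) (hm₁ : 0 ≤ m₁) (hm₂ : 0 ≤ m₂) (hm₃ : 0 ≤ m₃)
    (hm : m₁ + m₂ + m₃ = 1) (hle₁ : m₁ / α ≤ m₃ / γ) (hle₂ : m₂ / β ≤ m₃ / γ)
    (heV : m₁ • A + m₂ • B + m₃ • C ∈ V) (heA : m₁ • A + m₂ • B + m₃ • C ≠ A)
    (heB : m₁ • A + m₂ • B + m₃ • C ≠ B) (heC : m₁ • A + m₂ • B + m₃ • C ≠ C)
    (hvis : Visible G x (m₁ • A + m₂ • B + m₃ • C)) :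
    ∃ A' B' C', Surrounds V G x A' B' C' ∧ |area A' B' C'| < |area A B C| := by
  rw [div_le_div_iff₀ hα hγ] at hle₁
  rw [div_le_div_iff₀ hβ hγ] at hle₂
  have hm₃' : 0 < m₃ := by
    rcases hm₃.eq_or_lt with h0 | h0
    · rw [← h0] at hle₁ hle₂ hm; nlinarith
    · exact h0
  have hm₃1 : m₃ < 1 := by
    by_contra! hc
    obtain rfl : m₁ = 0 := by linarith
    obtain rfl : m₂ = 0 := by linarith
    obtain rfl : m₃ = 1 := by linarith
    simp at heC
  set e := m₁ • A + m₂ • B + m₃ • C with he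
  have hxe : (α - γ / m₃ * m₁) • A + (β - γ / m₃ * m₂) • B + (γ / m₃) • e = x := by
    rw [← h2, he]
    match_scalars <;> field_simp <;> ring
  have hsum : (α - γ / m₃ * m₁) + (β - γ / m₃ * m₂) + γ / m₃ = 1 := by
    field_simp
    linear_combination m₃ * h1 - γ * hm
  have hα' : 0 ≤ α - γ / m₃ * m₁ := by
    rw [sub_nonneg, div_mul_eq_mul_div, div_le_iff₀ hm₃']; linarith
  have hβ' : 0 ≤ β - γ / m₃ * m₂ := by
    rw [sub_nonneg, div_mul_eq_mul_div, div_le_iff₀ hm₃']; linarith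
  refine ⟨A, B, e, ⟨h.memA, h.memB, heV, h.visA, h.visB, hvis, _, _, _, ?_, ?_, by positivity,
    hsum, hxe⟩, ?_⟩
  · refine lt_of_le_of_ne hα' fun h0 => ?_
    rw [← h0, zero_smul, zero_add] at hxe
    exact hx.notMem_segment h.memB heV (Ne.symm heB) ⟨_, _, hβ', by positivity,
      by linarith, hxe⟩
  · refine lt_of_le_of_ne hβ' fun h0 => ?_
    rw [← h0, zero_smul, add_zero] at hxe
    exact hx.notMem_segment h.memA heV (Ne.symm heA) ⟨_, _, hα', by positivity,
      by linarith, hxe⟩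
  · have : area A B e = m₃ * area A B C := by
      rw [he]
      obtain rfl : m₁ = 1 - m₂ - m₃ := by linarith
      simp [area, cross]; ring
    rw [this, abs_mul, abs_of_pos hm₃']
    exact mul_lt_of_lt_one_left (abs_pos.2 (area_ne_zero h hx hV)) hm₃1

theorem Surrounds.exists_smaller (h : Surrounds V G x A B C) (hx : Generic V x)
    (hV : V.Nontrivial)
    {m₁ m₂ m₃ : ℝ} (hm₁ : 0 ≤ m₁) (hm₂ : 0 ≤ m₂) (hm₃ : 0 ≤ m₃)
    (hm : m₁ + m₂ + m₃ = 1)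
    (heV : m₁ • A + m₂ • B + m₃ • C ∈ V) (heA : m₁ • A + m₂ • B + m₃ • C ≠ A)
    (heB : m₁ • A + m₂ • B + m₃ • C ≠ B) (heC : m₁ • A + m₂ • B + m₃ • C ≠ C)
    (hvis : Visible G x (m₁ • A + m₂ • B + m₃ • C)) :
    ∃ A' B' C', Surrounds V G x A' B' C' ∧ |area A' B' C'| < |area A B C| := by
  obtain ⟨α, β, γ, hα, hβ, hγ, h1, h2⟩ := h.comb
  have r1 : ∀ a b c : ℝ, b • B + c • C + a • A = a • A + b • B + c • C := fun a b c => by abel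
  have r2 : ∀ a b c : ℝ, c • C + a • A + b • B = a • A + b • B + c • C := fun a b c => by abel
  by_cases hc : m₁ / α ≤ m₃ / γ ∧ m₂ / β ≤ m₃ / γ
  · exact h.exists_smaller_of_le hx hV hα hβ hγ h1 h2 hm₁ hm₂ hm₃ hm hc.1 hc.2 heV heA heB heC hvis
  by_cases hb : m₃ / γ ≤ m₂ / β ∧ m₁ / α ≤ m₂ / β
  · rw [← area_rotate, ← area_rotate]
    exact h.rotate.rotate.exists_smaller_of_le hx hV hγ hα hβ (by linarith)
        (by rw [r2, h2]) hm₃ hm₁ hm₂ (by linarith) hb.1 hb.2 (by rwa [r2]) (by rwa [r2])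
        (by rwa [r2]) (by rwa [r2]) (by rwa [r2])
  have ha : m₂ / β ≤ m₁ / α ∧ m₃ / γ ≤ m₁ / α := by
    rcases exists_ge_ge (m₁ / α) (m₂ / β) (m₃ / γ) with h | h | h
    · exact h
    · exact absurd h hb
    · exact absurd h hc
  rw [← area_rotate]
  exact h.rotate.exists_smaller_of_le hx hV hβ hγ hα (by linarith)
      (by rw [r1, h2]) hm₂ hm₃ hm₁ (by linarith) ha.1 ha.2 (by rwa [r1]) (by rwa [r1])
      (by rwa [r1]) (by rwa [r1]) (by rwa [r1])

end Triangle

/-- A generic point of the convex hull is surrounded by three visible vertices. -/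
theorem exists_surrounds {V : Set Plane} (hV : V.Nontrivial) (hVf : V.Finite)
    {G : Set (Plane × Plane)} (hG : IsPlanarFamily V G) {x : Plane} (hx : Generic V x)
    (hxV : x ∈ convexHull ℝ V) : ∃ A B C, Surrounds V G x A B C := by
  -- Otherwise a line separates `x` from all visible vertices. As `x` is in the hull of `V`, the
  -- half-plane at `x` away from them contains some vertex, hence a visible one.
  have hmem : x ∈ convexHull ℝ {w ∈ V | Visible G x w} := by
    by_contra hcon
    obtain ⟨f, u, hf1, hf2⟩ := geometric_hahn_banach_closed_point (convex_convexHull ℝ {w ∈ V | Visible G x w})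
      ((hVf.subset (Set.sep_subset V _)).isCompact_convexHull ℝ).isClosed hcon
    obtain ⟨w₀, hw₀, hf⟩ : ∃ w₀ ∈ V, f x ≤ f w₀ := by
      by_contra! hlt
      have : convexHull ℝ V ⊆ {y | f y < f x} :=
        convexHull_min hlt (convex_halfSpace_lt f.toLinearMap.isLinear _)
      exact lt_irrefl (f x) (this hxV)
    obtain ⟨w, hwV, hw, hvis⟩ := exists_visible_halfplane hVf hG hx f hw₀
      (by rw [map_sub]; linarith)
    have := hf1 w (subset_convexHull ℝ _ ⟨hwV, hvis⟩)
    rw [map_sub] at hw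
    linarith
  -- Carathéodory: affinely independent points in the plane number at most three. One or two would
  -- put `x` at a vertex or on a line through two vertices.
  obtain ⟨ι, _, z, w, hz, hind, hw0, hw1, hwx⟩ := eq_pos_convex_span_of_mem_convexHull hmem
  have hzV : ∀ i, z i ∈ V ∧ Visible G x (z i) := fun i => hz ⟨i, rfl⟩
  have hcard : Fintype.card ι ≤ 3 := by
    refine hind.card_le_finrank_succ.trans ?_
    have : Module.finrank ℝ (vectorSpan ℝ (Set.range z)) ≤ 2 := by
      simpa using Submodule.finrank_le (vectorSpan ℝ (Set.range z))
    omega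
  have e := Fintype.equivFin ι
  have hsum1 : ∑ k, w (e.symm k) = 1 := by rw [← hw1]; exact e.symm.sum_comp w
  have hsumx : ∑ k, w (e.symm k) • z (e.symm k) = x := by
    rw [← hwx]; exact e.symm.sum_comp (fun i => w i • z i)
  generalize Fintype.card ι = m at *
  interval_cases m
  · simp at hsum1
  · exfalso
    simp only [Fin.sum_univ_one] at hsum1 hsumx
    rw [hsum1, one_smul] at hsumx
    exact hx.notMem' hV (hsumx ▸ (hzV _).1)
  · exfalso
    simp only [Fin.sum_univ_two] at hsum1 hsumx
    refine hx.notMem_segment (hzV (e.symm 0)).1 (hzV (e.symm 1)).1 ?_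
      ⟨_, _, (hw0 _).le, (hw0 _).le, hsum1, hsumx⟩
    exact fun h => by simpa using e.symm.injective (hind.injective h)
  · simp only [Fin.sum_univ_three] at hsum1 hsumx
    exact ⟨_, _, _, (hzV _).1, (hzV _).1, (hzV _).1, (hzV _).2, (hzV _).2, (hzV _).2,
      _, _, _, hw0 _, hw0 _, hw0 _, hsum1, hsumx⟩

end PlanePolygon

namespace PlanePolygon

/-! ## Empty triangles -/

/-- On the open side `A B`, a segment of `G` can only be that side itself. -/
def IsSide (G : Set (Plane × Plane)) (A B : Plane) : Prop :=
  ∀ g ∈ G, ∀ z ∈ openSegment ℝ A B, z ∈ segment ℝ g.1 g.2 → g = (A, B) ∨ g = (B, A)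

theorem IsSide.symm {G : Set (Plane × Plane)} {A B : Plane} (h : IsSide G A B) : IsSide G B A :=
  fun g hg z hz hzg => (h g hg z (by rwa [openSegment_symm]) hzg).symm

/-- A triangle with vertices in `V` that contains no other point of `V` and whose interior misses
the family `G`. -/
structure IsEmptyTriangle (V : Set Plane) (G : Set (Plane × Plane)) (A B C : Plane) : Prop where
  memA : A ∈ V
  memB : B ∈ V
  memC : C ∈ V
  area_ne : area A B C ≠ 0
  empty : ∀ a b c : ℝ, 0 ≤ a → 0 ≤ b → 0 ≤ c → a + b + c = 1 → a • A + b • B + c • C ∈ V →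
    a • A + b • B + c • C = A ∨ a • A + b • B + c • C = B ∨ a • A + b • B + c • C = C
  interior : ∀ a b c : ℝ, 0 < a → 0 < b → 0 < c → a + b + c = 1 →
    ∀ g ∈ G, a • A + b • B + c • C ∉ segment ℝ g.1 g.2
  sideAB : IsSide G A B
  sideBC : IsSide G B C
  sideCA : IsSide G C A

section Triangle

variable {V : Set Plane} {G : Set (Plane × Plane)} {x A B C : Plane}

/-- No other vertices lie in the triangle `A B C`. -/
def NoVertex (V : Set Plane) (A B C : Plane) : Prop :=
  ∀ a b c : ℝ, 0 ≤ a → 0 ≤ b → 0 ≤ c → a + b + c = 1 → a • A + b • B + c • C ∈ V →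
    a • A + b • B + c • C = A ∨ a • A + b • B + c • C = B ∨ a • A + b • B + c • C = C

theorem NoVertex.rotate (h : NoVertex V A B C) : NoVertex V B C A := by
  intro b c a hb hc ha hs
  have r1 : b • B + c • C + a • A = a • A + b • B + c • C := by abel
  rw [r1]
  intro hV
  have := h a b c ha hb hc (by linarith) hV
  tauto

theorem comb_of_coords {s t : Plane →L[ℝ] ℝ}
    (hst : ∀ q, q = s q • (A - x) + t q • (B - x)) {α β γ : ℝ}
    (h2 : α • A + β • B + γ • C = x) (w : Plane) :
    (s (w - x) + (1 - s (w - x) - t (w - x)) * α) • A +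
      (t (w - x) + (1 - s (w - x) - t (w - x)) * β) • B +
      ((1 - s (w - x) - t (w - x)) * γ) • C = w := by
  have h3 := hst (w - x)
  generalize s (w - x) = σ at *
  generalize t (w - x) = τ at *
  have h4 : w = (1 - σ - τ) • x + σ • A + τ • B := by
    rw [← sub_eq_zero] at h3 ⊢
    rw [← h3]; module
  rw [h4, ← h2]; module

/-- The subtriangle `x A B` lies in `A B C`, so such a vertex would be a corner. But `A` and `B`
have level one, and `C` has a negative coordinate. -/
theorem Surrounds.not_low (h : Surrounds V G x A B C) (hE : NoVertex V A B C)
    {s t : Plane →L[ℝ] ℝ} (hst : ∀ q, q = s q • (A - x) + t q • (B - x))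
    (hsA : s (A - x) = 1) (htA : t (A - x) = 0) (hsB : s (B - x) = 0) (htB : t (B - x) = 1)
    (hsC : s (C - x) < 0) {e : Plane} (he : e ∈ V) (hs : 0 ≤ s (e - x)) (ht : 0 ≤ t (e - x))
    (hl : s (e - x) + t (e - x) < 1) : False := by
  obtain ⟨α, β, γ, hα, hβ, hγ, h1, h2⟩ := h.comb
  have h3 := comb_of_coords hst h2 e
  have h4 := hE (s (e - x) + (1 - s (e - x) - t (e - x)) * α)
    (t (e - x) + (1 - s (e - x) - t (e - x)) * β) ((1 - s (e - x) - t (e - x)) * γ)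
    (add_nonneg hs (mul_nonneg (by linarith) hα.le))
    (add_nonneg ht (mul_nonneg (by linarith) hβ.le))
    (mul_nonneg (by linarith : 0 ≤ 1 - s (e - x) - t (e - x)) hγ.le)
    (by linear_combination (1 - s (e - x) - t (e - x)) * h1) (by rw [h3]; exact he)
  rw [h3] at h4
  rcases h4 with rfl | rfl | rfl <;> linarith

/-- A segment of `G` entering the subtriangle `x A B` below the side `A B` either meets `]x, A[` or
`]x, B[`, against visibility, or leads down to a vertex, which `Surrounds.not_low` forbids. -/
theorem Surrounds.interior_of_le (h : Surrounds V G x A B C) (hE : NoVertex V A B C)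
    (hx : Generic V x) (hV : V.Nontrivial) (hG : IsPlanarFamily V G)
    {α β γ m₁ m₂ m₃ : ℝ} (hα : 0 < α) (hβ : 0 < β) (hγ : 0 < γ) (h1 : α + β + γ = 1)
    (h2 : α • A + β • B + γ • C = x) (hm₃ : 0 < m₃)
    (hm : m₁ + m₂ + m₃ = 1) (hle₁ : m₃ / γ ≤ m₁ / α) (hle₂ : m₃ / γ ≤ m₂ / β)
    {g : Plane × Plane} (hg : g ∈ G) : m₁ • A + m₂ • B + m₃ • C ∉ segment ℝ g.1 g.2 := by
  intro hz
  obtain ⟨s, t, hst, hsA, htA, hsB, htB, hsC⟩ := h.coords hx hV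
  set l := m₃ / γ with hl
  have hl0 : 0 < l := by positivity
  have hlγ : l * γ = m₃ := div_mul_cancel₀ _ hγ.ne'
  clear_value l
  rw [le_div_iff₀ hα] at hle₁
  rw [le_div_iff₀ hβ] at hle₂
  set z := m₁ • A + m₂ • B + m₃ • C with hzdef
  have hexp : z - x = (m₁ - l * α) • (A - x) + (m₂ - l * β) • (B - x) := by
    have h4 : z = (1 - l) • x + l • x + (z - x) := by module
    have h5 : z = l • x + (m₁ - l * α) • A + (m₂ - l * β) • B := by
      rw [hzdef, ← hlγ, ← h2]; module
    have h6 : (1 - l : ℝ) = (m₁ - l * α) + (m₂ - l * β) := by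
      linear_combination l * h1 - hm - hlγ
    have h7 : x = (1 - l) • x + l • x := by module
    rw [h6] at h7
    rw [← sub_eq_zero, h5]
    nth_rewrite 2 [h7]
    module
  have hse : s (z - x) = m₁ - l * α := by
    rw [hexp, map_add, map_smul, map_smul, hsA, hsB]; simp
  have hte : t (z - x) = m₂ - l * β := by
    rw [hexp, map_add, map_smul, map_smul, htA, htB]; simp
  have hlev : (m₁ - l * α) + (m₂ - l * β) < 1 := by nlinarith
  have hzx : z ≠ x := by
    rintro h0
    exact hx.notMem_segment (hG.fst_mem g hg) (hG.snd_mem g hg) (hG.ne g hg) (h0 ▸ hz)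
  rcases (sub_nonneg.2 hle₁).eq_or_lt with h0 | h0
  · rw [← h0, zero_smul, zero_add] at hexp
    rcases (sub_nonneg.2 hle₂).eq_or_lt with h3 | h3
    · rw [← h3, zero_smul] at hexp; exact hzx (sub_eq_zero.1 hexp)
    · exact h.visB g hg z (mem_openSegment_of_sub h3 (by linarith) hexp) hz
  rcases (sub_nonneg.2 hle₂).eq_or_lt with h3 | h3
  · rw [← h3, zero_smul, add_zero] at hexp
    exact h.visA g hg z (mem_openSegment_of_sub h0 (by linarith) hexp) hz
  obtain ⟨e, heV, -, hes, het, hel⟩ := exists_vertex_below hG hx h.visA h.visB hst hg hz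
    (by rwa [hse]) (by rwa [hte]) (by rwa [hse, hte])
  exact h.not_low hE hst hsA htA hsB htB hsC heV hes het (by linarith)

theorem Surrounds.interior (h : Surrounds V G x A B C) (hE : NoVertex V A B C)
    (hx : Generic V x) (hV : V.Nontrivial) (hG : IsPlanarFamily V G)
    {m₁ m₂ m₃ : ℝ} (hm₁ : 0 < m₁) (hm₂ : 0 < m₂) (hm₃ : 0 < m₃)
    (hm : m₁ + m₂ + m₃ = 1)
    {g : Plane × Plane} (hg : g ∈ G) : m₁ • A + m₂ • B + m₃ • C ∉ segment ℝ g.1 g.2 := by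
  obtain ⟨α, β, γ, hα, hβ, hγ, h1, h2⟩ := h.comb
  have r1 : ∀ a b c : ℝ, b • B + c • C + a • A = a • A + b • B + c • C := fun a b c => by abel
  have r2 : ∀ a b c : ℝ, c • C + a • A + b • B = a • A + b • B + c • C := fun a b c => by abel
  rcases exists_le_le (m₁ / α) (m₂ / β) (m₃ / γ) with h3 | h3 | h3
  · rw [← r1]
    exact h.rotate.interior_of_le hE.rotate hx hV hG hβ hγ hα (by linarith) (by rw [r1, h2]) hm₁
      (by linarith) h3.1 h3.2 hg
  · rw [← r2]
    exact h.rotate.rotate.interior_of_le hE.rotate.rotate hx hV hG hγ hα hβ (by linarith)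
      (by rw [r2, h2]) hm₂ (by linarith) h3.1 h3.2 hg
  · exact h.interior_of_le hE hx hV hG hα hβ hγ h1 h2 hm₃ hm h3.1 h3.2 hg

/-- If an end of `g` were below the line `A B`, points of `g` near `z` would be inside `x A B` and
lead to a forbidden vertex. So both ends have level at least one; since `z` is inside `g` at level
one, `g` lies on the line `A B`. No vertex is inside the side and neither `A` nor `B` is inside `g`,
which forces equality of the ends. -/
theorem Surrounds.isSide (h : Surrounds V G x A B C) (hE : NoVertex V A B C)
    (hx : Generic V x) (hV : V.Nontrivial) (hG : IsPlanarFamily V G) : IsSide G A B := by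
  intro g hg z hz hzg
  obtain ⟨s, t, hst, hsA, htA, hsB, htB, hsC⟩ := h.coords hx hV
  have hAB := h.ne hx hV
  have hCA := h.rotate.rotate.ne hx hV
  have hBC := h.rotate.ne hx hV
  rw [openSegment_eq_image'] at hz
  obtain ⟨r, ⟨hr0, hr1⟩, hz⟩ := hz
  simp only at hz
  have hzx : z - x = (1 - r) • (A - x) + r • (B - x) := by rw [← hz]; module
  have hsz : s (z - x) = 1 - r := by rw [hzx, map_add, map_smul, map_smul, hsA, hsB]; simp
  have htz : t (z - x) = r := by rw [hzx, map_add, map_smul, map_smul, htA, htB]; simp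
  have hlow : ∀ e, (e = g.1 ∨ e = g.2) → 1 ≤ s (e - x) + t (e - x) := by
    intro e he
    by_contra! hlt
    set δ := min (1 - r) r with hδ
    have hδ0 : 0 < δ := lt_min (by linarith) hr0
    -- a point of the segment slightly below the side
    obtain ⟨c, hc0, hc1, hcs, hct⟩ : ∃ c : ℝ, 0 < c ∧ c < 1 ∧
        0 < (1 - r) + c * (s (e - x) - (1 - r)) ∧ 0 < r + c * (t (e - x) - r) := by
      have h1 : Filter.Tendsto (fun c : ℝ => (1 - r) + c * (s (e - x) - (1 - r)))
          (nhdsWithin 0 (Set.Ioi 0)) (nhds (1 - r)) := by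
        have : Continuous (fun c : ℝ => (1 - r) + c * (s (e - x) - (1 - r))) := by fun_prop
        simpa using (this.tendsto 0).mono_left nhdsWithin_le_nhds
      have h2 : Filter.Tendsto (fun c : ℝ => r + c * (t (e - x) - r))
          (nhdsWithin 0 (Set.Ioi 0)) (nhds r) := by
        have : Continuous (fun c : ℝ => r + c * (t (e - x) - r)) := by fun_prop
        simpa using (this.tendsto 0).mono_left nhdsWithin_le_nhds
      have h3 := h1.eventually (lt_mem_nhds (by linarith : (0 : ℝ) < 1 - r))
      have h4 := h2.eventually (lt_mem_nhds hr0)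
      obtain ⟨c, ⟨h5, h6⟩, h7⟩ := ((h3.and h4).and
        (Ioo_mem_nhdsGT (zero_lt_one (α := ℝ)))).exists
      exact ⟨c, h7.1, h7.2, h5, h6⟩
    have hseg : z + c • (e - z) ∈ segment ℝ g.1 g.2 := by
      apply (convex_segment g.1 g.2).segment_subset hzg (y := e)
      · rcases he with rfl | rfl
        · exact left_mem_segment ..
        · exact right_mem_segment ..
      · rw [segment_eq_image']; exact ⟨c, ⟨hc0.le, hc1.le⟩, rfl⟩
    have hs' : s (z + c • (e - z) - x) = (1 - r) + c * (s (e - x) - (1 - r)) := by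
      rw [← hsz]; simp only [map_sub, map_add, map_smul, smul_eq_mul]; ring
    have ht' : t (z + c • (e - z) - x) = r + c * (t (e - x) - r) := by
      simp only [map_sub, map_add, map_smul, smul_eq_mul] at htz ⊢
      linear_combination (1 - c) * htz
    have hl' : s (z + c • (e - z) - x) + t (z + c • (e - z) - x) < 1 := by
      rw [hs', ht']; nlinarith
    obtain ⟨e', heV, -, hes, het, hel⟩ := exists_vertex_below hG hx h.visA h.visB hst hg hseg
      (by rwa [hs']) (by rwa [ht']) hl'
    exact h.not_low hE hst hsA htA hsB htB hsC heV hes het (by linarith)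
  have hzA : z ≠ A := by
    intro h0; rw [h0, hsA] at hsz; linarith
  have hzB : z ≠ B := by
    intro h0; rw [h0, htB] at htz; linarith
  have hnV : ∀ p ∈ V, ∀ c : ℝ, 0 < c → c < 1 → p - x ≠ (1 - c) • (A - x) + c • (B - x) := by
    intro p hp c hc0 hc1 hpx
    have hpc : (1 - c) • A + c • B + (0 : ℝ) • C = p := by
      rw [← sub_eq_zero] at hpx ⊢
      rw [← neg_eq_zero, ← hpx]; module
    have hsp : s (p - x) = 1 - c := by rw [hpx, map_add, map_smul, map_smul, hsA, hsB]; simp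
    have htp : t (p - x) = c := by rw [hpx, map_add, map_smul, map_smul, htA, htB]; simp
    rcases hE (1 - c) c 0 (by linarith) hc0.le le_rfl (by ring) (by rw [hpc]; exact hp) with h0 | h0 | h0
    · rw [hpc] at h0; rw [h0] at hsp; linarith
    · rw [hpc] at h0; rw [h0] at htp; linarith
    · rw [hpc] at h0; rw [h0] at hsp; linarith
  have hzV : z ∉ V := fun hzV => hnV z hzV r hr0 hr1 hzx
  obtain ⟨a, b, ha, hb, hab, hz'⟩ := hG.mem_open hg hzg hzV
  have hl1 := hlow g.1 (Or.inl rfl)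
  have hl2 := hlow g.2 (Or.inr rfl)
  have hcs : a * s (g.1 - x) + b * s (g.2 - x) = 1 - r := by
    rw [← hsz, ← hz']
    obtain rfl : a = 1 - b := by linarith
    simp only [map_sub, map_add, map_smul, smul_eq_mul]; ring
  have hct : a * t (g.1 - x) + b * t (g.2 - x) = r := by
    rw [← htz, ← hz']
    obtain rfl : a = 1 - b := by linarith
    simp only [map_sub, map_add, map_smul, smul_eq_mul]; ring
  obtain ⟨e1, e2⟩ := eq_zero_of_pos_comb ha hb (sub_nonpos.2 hl1) (sub_nonpos.2 hl2)
    (by linear_combination hab - hcs - hct)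
  have hl1 : s (g.1 - x) = 1 - t (g.1 - x) := by linarith
  have hl2 : s (g.2 - x) = 1 - t (g.2 - x) := by linarith
  have hx1 := hst (g.1 - x)
  have hx2 := hst (g.2 - x)
  rw [hl1] at hx1
  rw [hl2] at hx2
  -- `c₁` and `c₂` are the positions of the ends of `g` on the line `A B`, with `A` at 0 and `B` at
  -- 1.
  generalize t (g.1 - x) = c₁ at *
  generalize t (g.2 - x) = c₂ at *
  have hout1 : c₁ ≤ 0 ∨ 1 ≤ c₁ := by
    by_contra! hc; exact hnV _ (hG.fst_mem g hg) c₁ hc.1 hc.2 hx1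
  have hout2 : c₂ ≤ 0 ∨ 1 ≤ c₂ := by
    by_contra! hc; exact hnV _ (hG.snd_mem g hg) c₂ hc.1 hc.2 hx2
  -- the end points of the side do not lie in the open segment
  have hno : ∀ k : ℝ, (k = 0 ∨ k = 1) → ∀ a b : ℝ, 0 < a → 0 < b → a + b = 1 →
      a * c₁ + b * c₂ ≠ k := by
    intro k hk a b ha hb hab hkk
    have : a • g.1 + b • g.2 = (1 - k) • A + k • B := by
      have : a • g.1 + b • g.2 = x + a • (g.1 - x) + b • (g.2 - x) := by
        obtain rfl : a = 1 - b := by linarith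
        module
      rw [this, hx1, hx2, ← hkk]
      obtain rfl : a = 1 - b := by linarith
      module
    rcases hk with rfl | rfl
    · exact hG.free g hg A h.memA ⟨a, b, ha, hb, hab, by rw [this]; module⟩
    · exact hG.free g hg B h.memB ⟨a, b, ha, hb, hab, by rw [this]; module⟩
  have hk : ∀ k : ℝ, (k = 0 ∨ k = 1) → ¬ (c₁ < k ∧ k < c₂) ∧ ¬ (c₂ < k ∧ k < c₁) := by
    refine fun k hk => ⟨fun ⟨h3, h4⟩ => ?_, fun ⟨h3, h4⟩ => ?_⟩
    · refine hno k hk ((c₂ - k) / (c₂ - c₁)) ((k - c₁) / (c₂ - c₁)) (div_pos (by linarith)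
        (by linarith)) (div_pos (by linarith) (by linarith)) ?_ ?_
      · have : c₂ - c₁ ≠ 0 := by linarith
        field_simp; ring
      · have : c₂ - c₁ ≠ 0 := by linarith
        field_simp; ring
    · refine hno k hk ((k - c₂) / (c₁ - c₂)) ((c₁ - k) / (c₁ - c₂)) (div_pos (by linarith)
        (by linarith)) (div_pos (by linarith) (by linarith)) ?_ ?_
      · have : c₁ - c₂ ≠ 0 := by linarith
        field_simp; ring
      · have : c₁ - c₂ ≠ 0 := by linarith
        field_simp; ring
  have hk0 := hk 0 (Or.inl rfl)
  have hk1 := hk 1 (Or.inr rfl)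
  have hcase : (c₁ = 0 ∧ c₂ = 1) ∨ (c₁ = 1 ∧ c₂ = 0) := by
    rcases hout1 with h3 | h3 <;> rcases hout2 with h4 | h4
    · exfalso; nlinarith
    · left; constructor <;> grind
    · right; constructor <;> grind
    · exfalso; nlinarith
  rcases hcase with ⟨rfl, rfl⟩ | ⟨rfl, rfl⟩
  · left
    simp only [sub_zero, one_smul, zero_smul, add_zero, sub_self, zero_add, sub_left_inj] at hx1 hx2
    exact Prod.ext hx1 hx2
  · right
    simp only [sub_zero, one_smul, zero_smul, add_zero, sub_self, zero_add, sub_left_inj] at hx1 hx2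
    exact Prod.ext hx1 hx2

/-- A surrounding triangle of least area works: a further vertex in it would yield a visible one in
it, and then a smaller surrounding triangle. -/
theorem exists_isEmptyTriangle_generic (hV : V.Nontrivial) (hVf : V.Finite)
    (hG : IsPlanarFamily V G) (hx : Generic V x)
    (hxV : x ∈ convexHull ℝ V) :
    ∃ A B C, IsEmptyTriangle V G A B C ∧ x ∈ convexHull ℝ {A, B, C} := by
  obtain ⟨A, B, C, h⟩ := exists_surrounds hV hVf hG hx hxV
  set S : Set (Plane × Plane × Plane) := {T | Surrounds V G x T.1 T.2.1 T.2.2}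
  have hS : S.Finite := (hVf.prod (hVf.prod hVf)).subset fun T hT =>
    ⟨hT.memA, hT.memB, hT.memC⟩
  obtain ⟨⟨A, B, C⟩, hT, hmin⟩ := Set.exists_min_image S (fun T => |area T.1 T.2.1 T.2.2|) hS
    ⟨(A, B, C), h⟩
  replace hT : Surrounds V G x A B C := hT
  have hE : NoVertex V A B C := by
    intro a b c ha hb hc hs hV'
    by_contra! hcon
    obtain ⟨n₁, n₂, n₃, h1, h2, h3, h4, h5, h6, h7, h8, h9⟩ :=
      hT.exists_visible hx hV hVf hG ha hb hc hs hV' hcon.1 hcon.2.1 hcon.2.2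
    obtain ⟨A', B', C', h10, h11⟩ := hT.exists_smaller hx hV h1 h2 h3 h4 h5 h6 h7 h8 h9
    exact absurd (hmin (A', B', C') h10) (not_le.2 h11)
  refine ⟨A, B, C, ⟨hT.memA, hT.memB, hT.memC, area_ne_zero hT hx hV, hE,
    fun a b c ha hb hc hs g hg => hT.interior hE hx hV hG ha hb hc hs hg, hT.isSide hE hx hV hG,
    hT.rotate.isSide hE.rotate hx hV hG, hT.rotate.rotate.isSide hE.rotate.rotate hx hV hG⟩, ?_⟩
  obtain ⟨α, β, γ, h1, h2, h3, h4, h5⟩ := hT.comb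
  rw [← h5]
  have hc := convex_convexHull ℝ ({A, B, C} : Set Plane)
  exact hc.sum_mem (t := Finset.univ) (w := ![α, β, γ]) (z := ![A, B, C])
    (by intro i _; fin_cases i <;> simp <;> linarith) (by simp [Fin.sum_univ_three, h4])
    (by intro i _; fin_cases i <;> exact subset_convexHull ℝ _ (by simp))
    |> (by simpa [Fin.sum_univ_three] using ·)

end Triangle

end PlanePolygon

namespace PlanePolygon

/-! ## The planar hull is covered by empty triangles -/

theorem continuous_cross {X : Type*} [TopologicalSpace X] {f g : X → Plane} (hf : Continuous f)
    (hg : Continuous g) : Continuous fun x => cross (f x) (g x) := by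
  unfold cross
  fun_prop

theorem dense_cross_ne_zero {p q : Plane} (hpq : p ≠ q) :
    Dense {y : Plane | cross (p - y) (q - y) ≠ 0} := by
  intro y
  by_cases hy : cross (p - y) (q - y) ≠ 0
  · exact subset_closure hy
  push Not at hy
  -- A normal to the line `p q`: along it the cross product changes at a nonzero constant rate.
  set ν : Plane := !₂[-(p 1 - q 1), p 0 - q 0] with hν
  have hpos : (p 0 - q 0) ^ 2 + (p 1 - q 1) ^ 2 ≠ 0 := by
    intro h
    apply hpq
    ext i
    fin_cases i
    · simp; nlinarith [sq_nonneg (p 0 - q 0), sq_nonneg (p 1 - q 1)]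
    · simp; nlinarith [sq_nonneg (p 0 - q 0), sq_nonneg (p 1 - q 1)]
  have hval : ∀ ε : ℝ, cross (p - (y + ε • ν)) (q - (y + ε • ν)) =
      cross (p - y) (q - y) - ε * ((p 0 - q 0) ^ 2 + (p 1 - q 1) ^ 2) := by
    intro ε
    simp [cross, hν]; ring
  have hlim : Filter.Tendsto (fun ε : ℝ => y + ε • ν) (nhdsWithin 0 (Set.Ioi 0)) (nhds y) := by
    have : Continuous (fun ε : ℝ => y + ε • ν) := by fun_prop
    simpa using (this.tendsto 0).mono_left nhdsWithin_le_nhds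
  refine mem_closure_of_tendsto hlim ?_
  filter_upwards [self_mem_nhdsWithin] with ε hε
  rw [hval, hy, zero_sub]
  exact neg_ne_zero.2 (mul_ne_zero (ne_of_gt hε) hpos)

theorem dense_finite_cross_ne_zero {L : Set (Plane × Plane)} (hL : L.Finite)
    (hne : ∀ l ∈ L, l.1 ≠ l.2) :
    Dense {y : Plane | ∀ l ∈ L, cross (l.1 - y) (l.2 - y) ≠ 0} := by
  have := dense_biInter_of_isOpen (S := L)
    (f := fun l => {y : Plane | cross (l.1 - y) (l.2 - y) ≠ 0})
    (fun l _ => isOpen_ne_fun (continuous_cross (by fun_prop) (by fun_prop)) continuous_const)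
    hL.countable (fun l hl => dense_cross_ne_zero (hne l hl))
  convert! this using 1
  ext y; simp

theorem dense_generic {V : Set Plane} (hV : V.Finite) : Dense {y | Generic V y} := by
  have := dense_finite_cross_ne_zero (L := {l ∈ V ×ˢ V | l.1 ≠ l.2})
    ((hV.prod hV).subset (Set.sep_subset _ _)) (fun l hl => hl.2)
  refine this.mono ?_
  intro y (hy : ∀ l ∈ _, _) u hu v hv huv
  exact hy (u, v) ⟨⟨hu, hv⟩, huv⟩

/-- Every point of the convex hull lies in an empty triangle. -/
theorem exists_isEmptyTriangle {V : Set Plane} {G : Set (Plane × Plane)} (hVf : V.Finite)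
    (hV : V.Nontrivial) (hint : (interior (convexHull ℝ V)).Nonempty)
    (hG : IsPlanarFamily V G) {x : Plane} (hx : x ∈ convexHull ℝ V) :
    ∃ A B C, IsEmptyTriangle V G A B C ∧ x ∈ convexHull ℝ {A, B, C} := by
  set S : Set (Plane × Plane × Plane) := {T | IsEmptyTriangle V G T.1 T.2.1 T.2.2}
  have hS : S.Finite := (hVf.prod (hVf.prod hVf)).subset fun T hT =>
    ⟨hT.memA, hT.memB, hT.memC⟩
  -- The finitely many empty triangles form a closed set that contains the generic interior points
  -- of the hull. These are dense in the interior, and the hull lies in the closure of its interior.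
  have hcl : IsClosed (⋃ T ∈ S, convexHull ℝ ({T.1, T.2.1, T.2.2} : Set Plane)) :=
    hS.isClosed_biUnion fun T _ => (Set.Finite.isCompact_convexHull ℝ (by simp)).isClosed
  have h1 : x ∈ closure (interior (convexHull ℝ V)) := by
    rw [(convex_convexHull ℝ V).closure_interior_eq_closure_of_nonempty_interior hint]
    exact subset_closure hx
  have h2 : closure (interior (convexHull ℝ V)) ⊆
      ⋃ T ∈ S, convexHull ℝ ({T.1, T.2.1, T.2.2} : Set Plane) := by
    refine (closure_minimal ((dense_generic hVf).open_subset_closure_inter isOpen_interior)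
      isClosed_closure).trans (closure_minimal ?_ hcl)
    rintro y ⟨hy, hgen⟩
    obtain ⟨A, B, C, hT, hyT⟩ := exists_isEmptyTriangle_generic hV hVf hG hgen
      (interior_subset hy)
    exact Set.mem_biUnion (show (A, B, C) ∈ S from hT) hyT
  obtain ⟨T, hT, hxT⟩ := Set.mem_iUnion₂.1 (h2 h1)
  exact ⟨T.1, T.2.1, T.2.2, hT, hxT⟩

end PlanePolygon

namespace PlanePolygon

/-! ## Cyclic polygons -/

/-! ### Adjoining the sides of an empty triangle to a planar family -/

section Triangle

variable {V : Set Plane} {G : Set (Plane × Plane)} {A B C : Plane}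

theorem IsEmptyTriangle.rotate (h : IsEmptyTriangle V G A B C) : IsEmptyTriangle V G B C A := by
  refine ⟨h.memB, h.memC, h.memA, by rw [area_rotate]; exact h.area_ne,
    NoVertex.rotate h.empty, ?_, h.sideBC, h.sideCA, h.sideAB⟩
  intro b c a hb hc ha hs
  have r1 : b • B + c • C + a • A = a • A + b • B + c • C := by abel
  rw [r1]
  exact h.interior a b c ha hb hc (by linarith)

theorem ne_of_area_ne (h : area A B C ≠ 0) : A ≠ B := by
  rintro rfl
  exact h (by simp [area, cross])

theorem notMem_openSegment_of_area_ne (h : area A B C ≠ 0) : C ∉ openSegment ℝ A B := by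
  rintro ⟨a, b, ha, hb, hab, rfl⟩
  obtain rfl : a = 1 - b := by linarith
  refine h ?_
  simp [area, cross]; ring

theorem notMem_openSegment_inter (h : area A B C ≠ 0) {z : Plane} (h1 : z ∈ openSegment ℝ A B)
    (h2 : z ∈ openSegment ℝ B C) : False := by
  obtain ⟨a, b, ha, hb, hab, rfl⟩ := h1
  obtain ⟨c, d, hc, hd, hcd, h3⟩ := h2
  obtain rfl : b = 1 - a := by linarith
  obtain rfl : c = 1 - d := by linarith
  have h4 : ∀ i, (1 - d) * B i + d * C i = a * A i + (1 - a) * B i := by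
    intro i
    have := congrArg (fun v : Plane => v i) h3
    simpa using this
  have : a * area A B C = 0 := by
    simp only [area, cross, PiLp.sub_apply]
    linear_combination (C 1 - B 1) * (h4 0) - (C 0 - B 0) * (h4 1)
  exact h ((mul_eq_zero.1 this).resolve_left ha.ne')

theorem IsEmptyTriangle.free (h : IsEmptyTriangle V G A B C) {w : Plane} (hw : w ∈ V) :
    w ∉ openSegment ℝ A B := by
  intro hwo
  have hne := ne_of_area_ne h.area_ne
  obtain ⟨a, b, ha, hb, hab, hz⟩ := hwo
  have := h.empty a b 0 ha.le hb.le le_rfl (by linarith) (by simpa [hz] using hw)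
  rw [zero_smul, add_zero, hz] at this
  have hwo : w ∈ openSegment ℝ A B := ⟨a, b, ha, hb, hab, hz⟩
  rcases this with rfl | rfl | rfl
  · exact hne (left_mem_openSegment_iff.1 hwo)
  · exact hne (right_mem_openSegment_iff.1 hwo)
  · exact notMem_openSegment_of_area_ne h.area_ne hwo

/-- Adding the sides of an empty triangle to a planar family. -/
theorem IsEmptyTriangle.extend (hG : IsPlanarFamily V G) (h : IsEmptyTriangle V G A B C) :
    IsPlanarFamily V (G ∪ {(A, B), (B, C), (C, A)}) := by
  have hAB := ne_of_area_ne h.area_ne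
  have hBC := ne_of_area_ne h.rotate.area_ne
  have hCA := ne_of_area_ne h.rotate.rotate.area_ne
  have hmem : ∀ g ∈ G ∪ ({(A, B), (B, C), (C, A)} : Set (Plane × Plane)),
      g ∈ G ∨ g = (A, B) ∨ g = (B, C) ∨ g = (C, A) := by
    rintro g (hg | hg)
    · exact Or.inl hg
    · exact Or.inr (by simpa using hg)
  have hside : ∀ {A B : Plane}, IsSide G A B → ∀ g ∈ G, ∀ z, z ∈ openSegment ℝ g.1 g.2 →
      z ∈ openSegment ℝ A B → g = (A, B) ∨ g = (B, A) := fun hs g hg z hzg hz =>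
    hs g hg z hz (openSegment_subset_segment _ _ _ hzg)
  have h12 : ∀ z, z ∈ openSegment ℝ A B → z ∈ openSegment ℝ B C → False :=
    fun z => notMem_openSegment_inter h.area_ne
  have h23 : ∀ z, z ∈ openSegment ℝ B C → z ∈ openSegment ℝ C A → False :=
    fun z => notMem_openSegment_inter h.rotate.area_ne
  have h31 : ∀ z, z ∈ openSegment ℝ C A → z ∈ openSegment ℝ A B → False :=
    fun z => notMem_openSegment_inter h.rotate.rotate.area_ne
  constructor
  · intro g hg
    rcases hmem g hg with hg | rfl | rfl | rfl
    exacts [hG.fst_mem g hg, h.memA, h.memB, h.memC]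
  · intro g hg
    rcases hmem g hg with hg | rfl | rfl | rfl
    exacts [hG.snd_mem g hg, h.memB, h.memC, h.memA]
  · intro g hg
    rcases hmem g hg with hg | rfl | rfl | rfl
    exacts [hG.ne g hg, hAB, hBC, hCA]
  · intro g hg w hw
    rcases hmem g hg with hg | rfl | rfl | rfl
    exacts [hG.free g hg w hw, h.free hw, h.rotate.free hw, h.rotate.rotate.free hw]
  · intro g hg k hk z hzg hzk
    rcases hmem g hg with hg | rfl | rfl | rfl <;> rcases hmem k hk with hk | rfl | rfl | rfl
    · exact hG.noncross g hg k hk z hzg hzk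
    · rcases hside h.sideAB g hg z hzg hzk with rfl | rfl <;> simp
    · rcases hside h.sideBC g hg z hzg hzk with rfl | rfl <;> simp
    · rcases hside h.sideCA g hg z hzg hzk with rfl | rfl <;> simp
    · rcases hside h.sideAB k hk z hzk hzg with rfl | rfl <;> simp
    · simp
    · exact (h12 z hzg hzk).elim
    · exact (h31 z hzk hzg).elim
    · rcases hside h.sideBC k hk z hzk hzg with rfl | rfl <;> simp
    · exact (h12 z hzk hzg).elim
    · simp
    · exact (h23 z hzg hzk).elim
    · rcases hside h.sideCA k hk z hzk hzg with rfl | rfl <;> simp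
    · exact (h31 z hzg hzk).elim
    · exact (h23 z hzk hzg).elim
    · simp

end Triangle

/-- The vertices of a simple closed polygon, as a periodic sequence. -/
structure IsCycle (n : ℕ) (p : ℕ → Plane) : Prop where
  three_le : 3 ≤ n
  period : ∀ k, p (k + n) = p k
  inj : ∀ i j, p i = p j → i ≡ j [MOD n]
  inter : ∀ i j, ¬ i ≡ j [MOD n] → ∀ x ∈ segment ℝ (p i) (p (i + 1)),
    x ∈ segment ℝ (p j) (p (j + 1)) → (x = p i ∨ x = p (i + 1)) ∧ (x = p j ∨ x = p (j + 1))

/-- The closed curve through the points of the sequence. -/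
def curve (p : ℕ → Plane) : Set Plane := ⋃ k, segment ℝ (p k) (p (k + 1))

/-- The edges of the polygon, as a family of segments. -/
def edges (p : ℕ → Plane) : Set (Plane × Plane) := Set.range fun k => (p k, p (k + 1))

section Cycle

variable {n : ℕ} {p : ℕ → Plane}

theorem IsCycle.modEq (h : IsCycle n p) {i j : ℕ} (hij : i ≡ j [MOD n]) : p i = p j := by
  have key : ∀ k, p k = p (k % n) := by
    intro k
    have : ∀ q r, p (r + n * q) = p r := by
      intro q r
      induction q with
      | zero => simp
      | succ q ih => rw [Nat.mul_succ, ← add_assoc, h.period, ih]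
    conv_lhs => rw [← Nat.mod_add_div k n]
    exact this _ _
  rw [key i, key j, hij]

theorem IsCycle.eq_iff (h : IsCycle n p) {i j : ℕ} : p i = p j ↔ i ≡ j [MOD n] :=
  ⟨h.inj i j, h.modEq⟩

theorem IsCycle.not_modEq_succ (h : IsCycle n p) (i : ℕ) : ¬ i ≡ i + 1 [MOD n] := by
  intro hc
  have := h.three_le
  have h1 := (Nat.modEq_iff_dvd' (by omega)).1 hc
  rw [show i + 1 - i = 1 by omega, Nat.dvd_one] at h1
  omega

theorem IsCycle.not_modEq_succ_succ (h : IsCycle n p) (i : ℕ) : ¬ i ≡ i + 2 [MOD n] := by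
  intro hc
  have := h.three_le
  have h1 := Nat.le_of_dvd (by omega) ((Nat.modEq_iff_dvd' (by omega)).1 hc)
  omega

theorem IsCycle.mem_edge (h : IsCycle n p) {i k : ℕ} (hk : p k ∈ segment ℝ (p i) (p (i + 1))) :
    k ≡ i [MOD n] ∨ k ≡ i + 1 [MOD n] := by
  by_cases hki : i ≡ k [MOD n]
  · exact Or.inl hki.symm
  · have := (h.inter i k hki _ hk (left_mem_segment ..)).1
    rwa [h.eq_iff, h.eq_iff] at this

theorem IsCycle.finite_range (h : IsCycle n p) : (Set.range p).Finite := by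
  have : Set.range p ⊆ p '' (Set.Iio n) := by
    rintro _ ⟨k, rfl⟩
    exact ⟨k % n, Nat.mod_lt _ (by have := h.three_le; omega), h.modEq (Nat.mod_modEq k n)⟩
  exact ((Set.finite_Iio n).image p).subset this

theorem IsCycle.isPlanarFamily (h : IsCycle n p) : IsPlanarFamily (Set.range p) (edges p) := by
  have hne : ∀ i, p i ≠ p (i + 1) := fun i => by rw [Ne, h.eq_iff]; exact h.not_modEq_succ i
  have hfree : ∀ i k, p k ∉ openSegment ℝ (p i) (p (i + 1)) := by
    intro i k hk
    rcases h.mem_edge (openSegment_subset_segment _ _ _ hk) with h1 | h1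
    · rw [h.modEq h1, left_mem_openSegment_iff] at hk
      exact hne i hk
    · rw [h.modEq h1, right_mem_openSegment_iff] at hk
      exact hne i hk
  constructor
  · rintro _ ⟨i, rfl⟩; exact ⟨i, rfl⟩
  · rintro _ ⟨i, rfl⟩; exact ⟨i + 1, rfl⟩
  · rintro _ ⟨i, rfl⟩; exact hne i
  · rintro _ ⟨i, rfl⟩ _ ⟨k, rfl⟩; exact hfree i k
  · rintro _ ⟨i, rfl⟩ _ ⟨j, rfl⟩ z hzi hzj
    left
    by_cases hij : i ≡ j [MOD n]
    · simp only [h.modEq hij, h.modEq (hij.add_right 1)]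
    · rcases (h.inter i j hij z (openSegment_subset_segment _ _ _ hzi)
        (openSegment_subset_segment _ _ _ hzj)).1 with rfl | rfl
      · exact (hfree i i hzi).elim
      · exact (hfree i (i + 1) hzi).elim

theorem IsCycle.isCompact_curve (h : IsCycle n p) : IsCompact (curve p) := by
  have : curve p = ⋃ k ∈ Set.Iio n, segment ℝ (p k) (p (k + 1)) := by
    apply Set.Subset.antisymm
    · refine Set.iUnion_subset fun k => ?_
      rw [h.modEq (Nat.mod_modEq k n).symm, h.modEq ((Nat.mod_modEq k n).symm.add_right 1)]
      exact Set.subset_biUnion_of_mem (u := fun k => segment ℝ (p k) (p (k + 1)))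
        (Nat.mod_lt _ (by have := h.three_le; omega))
    · exact Set.iUnion₂_subset fun k _ => Set.subset_iUnion
        (fun k => segment ℝ (p k) (p (k + 1))) k
  rw [this]
  refine (Set.finite_Iio n).isCompact_biUnion fun k _ => ?_
  rw [segment_eq_image_lineMap]
  exact isCompact_Icc.image (by fun_prop)

theorem isPreconnected_curve (p : ℕ → Plane) : IsPreconnected (curve p) :=
  IsPreconnected.iUnion_of_chain (fun _ => (convex_segment _ _).isPreconnected)
    fun k => ⟨p (k + 1), right_mem_segment .., left_mem_segment ..⟩

theorem edge_subset_curve (p : ℕ → Plane) (k : ℕ) : segment ℝ (p k) (p (k + 1)) ⊆ curve p :=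
  Set.subset_iUnion (fun k => segment ℝ (p k) (p (k + 1))) k

theorem vertex_mem_curve (p : ℕ → Plane) (k : ℕ) : p k ∈ curve p :=
  edge_subset_curve p k (left_mem_segment ..)

theorem curve_subset_convexHull (p : ℕ → Plane) : curve p ⊆ convexHull ℝ (Set.range p) :=
  Set.iUnion_subset fun k => (convex_convexHull ℝ _).segment_subset
    (subset_convexHull ℝ _ ⟨k, rfl⟩) (subset_convexHull ℝ _ ⟨k + 1, rfl⟩)

theorem IsCycle.nontrivial (h : IsCycle n p) : (Set.range p).Nontrivial :=
  ⟨p 0, ⟨0, rfl⟩, p 1, ⟨1, rfl⟩, by rw [Ne, h.eq_iff]; exact h.not_modEq_succ 0⟩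

/-- The vertices of a simple closed polygon are not collinear. -/
theorem IsCycle.exists_cross_ne (h : IsCycle n p) : ∃ j, cross (p 1 - p 0) (p j - p 0) ≠ 0 := by
  by_contra! hcon
  have hd : p 1 - p 0 ≠ 0 := by
    rw [sub_ne_zero, Ne, h.eq_iff]
    exact fun hc => h.not_modEq_succ 0 hc.symm
  have hc : ∀ j, ∃ c : ℝ, p j - p 0 = c • (p 1 - p 0) := by
    intro j
    have hj := hcon j
    set d := p 1 - p 0
    set q := p j - p 0
    simp only [cross] at hj
    have hpos : d 0 ^ 2 + d 1 ^ 2 ≠ 0 := by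
      intro h0
      apply hd
      ext i
      fin_cases i
      · simp; nlinarith [sq_nonneg (d 0), sq_nonneg (d 1)]
      · simp; nlinarith [sq_nonneg (d 0), sq_nonneg (d 1)]
    refine ⟨(d 0 * q 0 + d 1 * q 1) / (d 0 ^ 2 + d 1 ^ 2), ?_⟩
    ext i
    fin_cases i
    · simp; field_simp; linear_combination -d 1 * hj
    · simp; field_simp; linear_combination d 0 * hj
  choose c hc using hc
  -- On a common line, the extreme vertex has both neighbours on the same side. The nearer neighbour
  -- would then lie on the edge to the farther one.
  obtain ⟨_, ⟨k', rfl⟩, hmax⟩ := Set.exists_max_image (Set.range c) id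
    (by
      have : Set.range c ⊆ c '' (Set.Iio n) := by
        rintro _ ⟨k, rfl⟩
        refine ⟨k % n, Nat.mod_lt _ (by have := h.three_le; omega), ?_⟩
        have h1 := hc (k % n)
        rw [h.modEq (Nat.mod_modEq k n), hc k, ← sub_eq_zero, ← sub_smul] at h1
        linarith [(smul_eq_zero.1 h1).resolve_right hd]
      exact ((Set.finite_Iio n).image c).subset this) ⟨c 0, 0, rfl⟩
  have hcper : c (k' + n) = c k' := by
    have h1 := hc (k' + n)
    rw [h.period, hc k', ← sub_eq_zero, ← sub_smul] at h1
    linarith [(smul_eq_zero.1 h1).resolve_right hd]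
  -- One full turn is added so that the extreme vertex has a predecessor among the natural numbers.
  obtain ⟨k, hk⟩ : ∃ k, k + 1 = k' + n := ⟨k' + n - 1, by have := h.three_le; omega⟩
  have h0 : c k ≤ c (k + 1) := by rw [hk, hcper]; exact hmax _ ⟨k, rfl⟩
  have h2 : c (k + 2) ≤ c (k + 1) := by rw [hk, hcper]; exact hmax _ ⟨k + 2, rfl⟩
  have hseg : ∀ i j l, c i ≤ c j → c j ≤ c l → p j ∈ segment ℝ (p i) (p l) := by
    intro i j l hij hjl
    have hp : ∀ j, p j = p 0 + c j • (p 1 - p 0) := fun j => by rw [← hc j]; abel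
    have hm : c j ∈ segment ℝ (c i) (c l) := by
      rw [segment_eq_Icc (hij.trans hjl)]; exact ⟨hij, hjl⟩
    obtain ⟨a, b, ha, hb, hab, habc⟩ := hm
    refine ⟨a, b, ha, hb, hab, ?_⟩
    rw [hp i, hp j, hp l, ← habc]
    obtain rfl : a = 1 - b := by linarith
    simp only [smul_eq_mul]
    module
  rcases le_total (c k) (c (k + 2)) with h3 | h3
  · rcases h.mem_edge (hseg k (k + 2) (k + 1) h3 h2) with h4 | h4
    · exact h.not_modEq_succ_succ k h4.symm
    · exact h.not_modEq_succ (k + 1) h4.symm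
  · have h5 := hseg (k + 2) k (k + 1) h3 h0
    rw [segment_symm] at h5
    rcases h.mem_edge h5 with h4 | h4
    · exact h.not_modEq_succ k h4
    · exact h.not_modEq_succ_succ k h4

theorem IsCycle.interior_nonempty (h : IsCycle n p) :
    (interior (convexHull ℝ (Set.range p))).Nonempty := by
  rw [interior_convexHull_nonempty_iff_affineSpan_eq_top]
  obtain ⟨j, hj⟩ := h.exists_cross_ne
  obtain ⟨s, t, hst, -⟩ := exists_coords hj
  rw [eq_top_iff]
  intro q _
  have hm : ∀ i, p i ∈ affineSpan ℝ (Set.range p) := fun i => subset_affineSpan ℝ _ ⟨i, rfl⟩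
  have h1 := AffineSubspace.smul_vsub_vadd_mem _ (s (q - p 0)) (hm 1) (hm 0) (hm 0)
  have h2 := AffineSubspace.smul_vsub_vadd_mem _ (t (q - p 0)) (hm j) (hm 0) h1
  convert! h2 using 1
  have := hst (q - p 0)
  simp only [vsub_eq_sub, vadd_eq_add]
  rw [← sub_eq_zero] at this ⊢
  rw [← this]; abel

end Cycle

end PlanePolygon

namespace PlanePolygon

open Filter Topology

/-! ## Winding angles -/

/-- The plane as the complex numbers. -/
noncomputable def toC : Plane ≃L[ℝ] ℂ :=
  Complex.orthonormalBasisOneI.repr.symm.toContinuousLinearEquiv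

/-- The oriented angle under which the segment from `a` to `b` is seen from `x`. -/
noncomputable def ang (a b x : Plane) : ℝ := ((toC b - toC x) / (toC a - toC x)).arg

/-- A nonpositive real quotient would mean that `a` and `b` are seen in opposite directions, or that
`x = b`, so that `x` is on the segment. Off the segment the principal argument is therefore
continuous. -/
theorem div_mem_slitPlane {a b x : Plane} (hx : x ∉ segment ℝ a b) :
    (toC b - toC x) / (toC a - toC x) ∈ Complex.slitPlane := by
  have hxa : toC a - toC x ≠ 0 := by
    rw [sub_ne_zero]
    intro h
    exact hx (toC.injective h ▸ left_mem_segment ..)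
  rw [Complex.mem_slitPlane_iff_not_le_zero]
  intro hle
  obtain ⟨r, hr⟩ : ∃ r : ℝ, (toC b - toC x) / (toC a - toC x) = r :=
    ⟨_, Complex.ext (Complex.ofReal_re _).symm (Complex.nonpos_iff.1 hle).2⟩
  have hr0 : r ≤ 0 := by rw [hr] at hle; exact_mod_cast hle
  rw [div_eq_iff hxa] at hr
  apply hx
  refine ⟨-r / (1 - r), 1 / (1 - r), div_nonneg (by linarith) (by linarith),
    div_nonneg zero_le_one (by linarith), ?_, ?_⟩
  · have : 1 - r ≠ 0 := by linarith
    field_simp; ring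
  · apply toC.injective
    rw [map_add, map_smul, map_smul]
    have h1 : (1 - r : ℂ) ≠ 0 := by
      have : (1 - r : ℝ) ≠ 0 := by linarith
      exact_mod_cast this
    simp only [Complex.real_smul, Complex.ofReal_div, Complex.ofReal_sub, Complex.ofReal_one,
      Complex.ofReal_neg]
    field_simp
    linear_combination hr

theorem continuousAt_ang {a b x : Plane} (hx : x ∉ segment ℝ a b) :
    ContinuousAt (ang a b) x := by
  have hxa : toC a - toC x ≠ 0 := by
    rw [sub_ne_zero]
    intro h
    exact hx (toC.injective h ▸ left_mem_segment ..)
  unfold ang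
  refine (Complex.continuousAt_arg (div_mem_slitPlane hx)).comp
    (f := fun x => (toC b - toC x) / (toC a - toC x)) ?_
  exact ContinuousAt.div (by fun_prop) (by fun_prop) hxa

theorem ang_symm {a b x : Plane} (hx : x ∉ segment ℝ a b) : ang b a x = - ang a b x := by
  have h := div_mem_slitPlane hx
  unfold ang
  rw [← inv_div, Complex.arg_inv, if_neg (Complex.mem_slitPlane_iff_arg.1 h).1]

theorem ang_coe {a b x : Plane} (ha : x ≠ a) (hb : x ≠ b) :
    (ang a b x : Real.Angle) = (toC b - toC x).arg - (toC a - toC x).arg := by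
  unfold ang
  rw [Complex.arg_div_coe_angle]
  · rw [sub_ne_zero]; exact fun h => hb (toC.injective h).symm
  · rw [sub_ne_zero]; exact fun h => ha (toC.injective h).symm

/-- A continuous multiple of `2π` is constant on preconnected sets. -/
theorem eq_of_coe_angle_eq_zero {S : Set Plane} (hS : IsPreconnected S) {f : Plane → ℝ}
    (hf : ContinuousOn f S) (h0 : ∀ x ∈ S, (f x : Real.Angle) = 0) {x y : Plane} (hx : x ∈ S)
    (hy : y ∈ S) : f x = f y := by
  refine hS.constant_of_mapsTo (T := (AddSubgroup.zmultiples (2 * Real.pi) : Set ℝ))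
    ⟨inferInstanceAs (DiscreteTopology (AddSubgroup.zmultiples (2 * Real.pi)))⟩ hf ?_ hx hy
  intro z hz
  exact (QuotientAddGroup.eq_zero_iff _).1 (h0 z hz)

/-- The total angle of the edges with indices in `[i, j)`. -/
noncomputable def arcAng (p : ℕ → Plane) (i j : ℕ) (x : Plane) : ℝ :=
  ∑ k ∈ Finset.Ico i j, ang (p k) (p (k + 1)) x

theorem continuousAt_arcAng {p : ℕ → Plane} {i j : ℕ} {x : Plane}
    (hx : ∀ k, i ≤ k → k < j → x ∉ segment ℝ (p k) (p (k + 1))) :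
    ContinuousAt (arcAng p i j) x := by
  unfold arcAng
  refine tendsto_finsetSum _ fun k hk => ?_
  rw [Finset.mem_Ico] at hk
  exact continuousAt_ang (hx k hk.1 hk.2)

/-- Modulo `2π` the angle sum telescopes. Around a closed polygon it is thus a multiple of `2π`, and
by continuity it is constant on connected sets that avoid the polygon. -/
theorem arcAng_coe {p : ℕ → Plane} {i j : ℕ} (hij : i ≤ j) {x : Plane}
    (hx : ∀ k, i ≤ k → k ≤ j → x ≠ p k) :
    (arcAng p i j x : Real.Angle) = (toC (p j) - toC x).arg - (toC (p i) - toC x).arg := by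
  induction j, hij using Nat.le_induction with
  | base => simp [arcAng]
  | succ j hij ih =>
    have h1 : arcAng p i (j + 1) x = arcAng p i j x + ang (p j) (p (j + 1)) x := by
      unfold arcAng
      rw [Finset.sum_Ico_succ_top hij]
    rw [h1, Real.Angle.coe_add, ih (fun k h1 h2 => hx k h1 (by omega)),
      ang_coe (hx j hij (by omega)) (hx (j + 1) (by omega) le_rfl)]
    abel

theorem arcAng_add {p : ℕ → Plane} {i j k : ℕ} (hij : i ≤ j) (hjk : j ≤ k) (x : Plane) :
    arcAng p i j x + arcAng p j k x = arcAng p i k x :=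
  Finset.sum_Ico_consecutive _ hij hjk

/-- The angle of the closed polygon made of the arc `[i, j]` and the chord from `p j` to `p i`. -/
theorem chord_const {p : ℕ → Plane} {i j : ℕ} (hij : i ≤ j) {S : Set Plane}
    (hS : IsPreconnected S)
    (h1 : ∀ x ∈ S, ∀ k, i ≤ k → k < j → x ∉ segment ℝ (p k) (p (k + 1)))
    {a b : Plane} (ha : a = p j) (hb : b = p i)
    (h2 : ∀ x ∈ S, x ∉ segment ℝ a b) {x y : Plane} (hx : x ∈ S) (hy : y ∈ S) :
    arcAng p i j x + ang a b x = arcAng p i j y + ang a b y := by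
  subst ha hb
  refine eq_of_coe_angle_eq_zero hS (f := fun x => arcAng p i j x + ang (p j) (p i) x) ?_ ?_ hx hy
  · intro z hz
    exact ((continuousAt_arcAng (h1 z hz)).add (continuousAt_ang (h2 z hz))).continuousWithinAt
  · intro z hz
    have hj : z ≠ p j := fun h => h2 z hz (h ▸ left_mem_segment ..)
    have hi : z ≠ p i := fun h => h2 z hz (h ▸ right_mem_segment ..)
    rw [Real.Angle.coe_add, arcAng_coe hij, ang_coe hj hi]
    · abel
    · intro k h3 h4
      rcases h4.lt_or_eq with h5 | rfl
      · exact fun h => h1 z hz k h3 h5 (h ▸ left_mem_segment ..)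
      · exact hj

theorem arg_smul_pos {ε : ℝ} (hε : 0 < ε) (z : ℂ) : ((ε : ℂ) * z).arg = z.arg :=
  Complex.arg_real_mul z hε

/-- The limit of the angle of an edge arriving at `c`, along the direction `w`. -/
theorem tendsto_ang_in {a c w : Plane} (hac : a ≠ c)
    (hs : -(toC w) / (toC a - toC c) ∈ Complex.slitPlane) :
    Tendsto (fun ε : ℝ => ang a c (c + ε • w)) (𝓝[>] 0)
      (𝓝 (-(toC w) / (toC a - toC c)).arg) := by
  have hac' : toC a - toC c ≠ 0 := by rw [sub_ne_zero]; exact fun h => hac (toC.injective h)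
  have h1 : ContinuousAt (fun ε : ℝ => (-(toC w) / (toC a - toC c - (ε : ℂ) * toC w)).arg) 0 := by
    refine ContinuousAt.comp (g := Complex.arg)
      (f := fun ε : ℝ => -(toC w) / (toC a - toC c - (ε : ℂ) * toC w))
      (Complex.continuousAt_arg (by simpa using hs)) ?_
    exact ContinuousAt.div (by fun_prop) (by fun_prop) (by simpa using hac')
  have h2 := h1.tendsto.mono_left (nhdsWithin_le_nhds (s := Set.Ioi 0))
  simp only [Complex.ofReal_zero, zero_mul, sub_zero] at h2
  refine h2.congr' ?_
  filter_upwards [self_mem_nhdsWithin] with ε hε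
  unfold ang
  rw [map_add, map_smul, Complex.real_smul, ← arg_smul_pos hε]
  congr 1
  rw [mul_div_assoc']
  congr 1 <;> ring

/-- The limit of the angle of an edge leaving `c`, along the direction `w`. -/
theorem tendsto_ang_out {b c w : Plane} (hw : w ≠ 0)
    (hs : -(toC b - toC c) / (toC w) ∈ Complex.slitPlane) :
    Tendsto (fun ε : ℝ => ang c b (c + ε • w)) (𝓝[>] 0)
      (𝓝 (-(toC b - toC c) / (toC w)).arg) := by
  have hw' : toC w ≠ 0 := by simpa using hw
  have h1 : ContinuousAt (fun ε : ℝ => (-(toC b - toC c - (ε : ℂ) * toC w) / (toC w)).arg) 0 := by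
    refine ContinuousAt.comp (g := Complex.arg)
      (f := fun ε : ℝ => -(toC b - toC c - (ε : ℂ) * toC w) / (toC w))
      (Complex.continuousAt_arg (by simpa using hs)) ?_
    exact ContinuousAt.div (by fun_prop) (by fun_prop) (by simpa using hw)
  have h2 := h1.tendsto.mono_left (nhdsWithin_le_nhds (s := Set.Ioi 0))
  simp only [Complex.ofReal_zero, zero_mul, sub_zero] at h2
  refine h2.congr' ?_
  filter_upwards [self_mem_nhdsWithin] with ε hε
  have hε' : (ε : ℂ) ≠ 0 := by exact_mod_cast (ne_of_gt hε : ε ≠ 0)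
  unfold ang
  rw [map_add, map_smul, Complex.real_smul, ← arg_smul_pos hε (_ / (toC c - _))]
  congr 1
  rw [show toC c - (toC c + (ε : ℂ) * toC w) = -((ε : ℂ) * toC w) by ring]
  field_simp
  ring

/-- The quotient leaves the slit plane only when `a` and `b` lie in the same direction from `c`, and
then the two open segments overlap. This makes the limits of angles at a vertex continuous in the
principal argument. -/
theorem neg_div_mem_slitPlane {a b c : Plane} (ha : a ≠ c) (hb : b ≠ c)
    (h : ∀ x, x ∈ openSegment ℝ c a → x ∈ openSegment ℝ c b → False) :
    -(toC b - toC c) / (toC a - toC c) ∈ Complex.slitPlane := by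
  have ha' : toC a - toC c ≠ 0 := by rw [sub_ne_zero]; exact fun h => ha (toC.injective h)
  rw [Complex.mem_slitPlane_iff_not_le_zero]
  intro hle
  obtain ⟨r, hr⟩ : ∃ r : ℝ, -(toC b - toC c) / (toC a - toC c) = r :=
    ⟨_, Complex.ext (Complex.ofReal_re _).symm (Complex.nonpos_iff.1 hle).2⟩
  have hr0 : r ≤ 0 := by rw [hr] at hle; exact_mod_cast hle
  rw [div_eq_iff ha'] at hr
  have hbc : b - c = (-r) • (a - c) := by
    apply toC.injective
    rw [map_smul, map_sub, map_sub, Complex.real_smul]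
    push_cast
    linear_combination -hr
  have hr1 : 0 < -r := by
    refine lt_of_le_of_ne (by linarith) fun h0 => hb ?_
    rw [← h0, zero_smul] at hbc
    exact sub_eq_zero.1 hbc
  have h3 : 0 < 1 - r := by linarith
  refine h (c + (1 / (1 - r)) • (b - c)) ?_ ?_
  · refine mem_openSegment_of_sub (r := (-r) / (1 - r)) (by positivity)
      ((div_lt_one h3).2 (by linarith)) ?_
    rw [add_sub_cancel_left, hbc, smul_smul]
    congr 1; ring
  · exact mem_openSegment_of_sub (r := 1 / (1 - r)) (by positivity)
      ((div_lt_one h3).2 (by linarith)) (by rw [add_sub_cancel_left])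

end PlanePolygon

namespace PlanePolygon

open Filter Topology

/-! ## Chords of a closed polygon do not cross -/

theorem not_modEq_of_lt {a b n : ℕ} (hab : a < b) (hb : b < a + n) : ¬ a ≡ b [MOD n] := by
  intro h
  have := Nat.le_of_dvd (by omega) ((Nat.modEq_iff_dvd' hab.le).1 h)
  omega

variable {n : ℕ} {p : ℕ → Plane}

/-- Distinct edges meet only in common ends. The index bounds stay within one turn, so the only
possible coincidence is the end of edge `r'` with the start of edge `r`. -/
theorem IsCycle.edges_disjoint (h : IsCycle n p) {r r' c : ℕ} {x : Plane}
    (hx : x ∈ segment ℝ (p r) (p (r + 1))) (hx' : x ∈ segment ℝ (p r') (p (r' + 1)))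
    (hc : c = r' + 1) (hr : c ≤ r) (hr' : r + 1 < r' + n) : x = p c ∧ c = r := by
  subst hc
  obtain ⟨h1, h2⟩ := h.inter r r' (fun h0 => not_modEq_of_lt (by omega) (by omega) h0.symm) x hx hx'
  rcases h1 with rfl | rfl <;> rcases h2 with h2 | h2 <;> rw [h.eq_iff] at h2
  · exact absurd h2.symm (not_modEq_of_lt (by omega) (by omega))
  · rcases hr.eq_or_lt with h3 | h3
    · exact ⟨by rw [h3], h3⟩
    · exact absurd h2.symm (not_modEq_of_lt (by omega) (by omega))
  · exact absurd h2.symm (not_modEq_of_lt (by omega) (by omega))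
  · exact absurd h2.symm (not_modEq_of_lt (by omega) (by omega))

/-- Points of the arc `[j, l]` other than `p j` are not on the arc `[i, j]`. -/
theorem IsCycle.arc_disjoint (h : IsCycle n p) {i j l r r' : ℕ} {x : Plane} (hjr : j ≤ r)
    (hrl : r < l) (hl : l < i + n) (hir : i ≤ r') (hrj : r' < j)
    (hx : x ∈ segment ℝ (p r) (p (r + 1))) (hxj : x ≠ p j) :
    x ∉ segment ℝ (p r') (p (r' + 1)) := by
  intro hx'
  obtain ⟨h1, h2⟩ := h.edges_disjoint hx hx' rfl (by omega) (by omega)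
  exact hxj (by rw [h1]; congr 1; omega)

/-- Points of the arc `[k, j]` other than `p j` are not on the arc `[j, m]`. -/
theorem IsCycle.arc_disjoint' (h : IsCycle n p) {j k m r r' : ℕ} {x : Plane} (hkr : k ≤ r)
    (hrj : r < j) (hm : m < k + n) (hjr : j ≤ r') (hrm : r' < m)
    (hx : x ∈ segment ℝ (p r) (p (r + 1))) (hxj : x ≠ p j) :
    x ∉ segment ℝ (p r') (p (r' + 1)) := by
  intro hx'
  obtain ⟨h1, h2⟩ := h.edges_disjoint hx' hx rfl (by omega) (by omega)
  exact hxj (by rw [h1]; congr 1; omega)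

theorem mem_segment_iff_open {a b x : Plane} (hx : x ∈ segment ℝ a b) :
    x = a ∨ x = b ∨ x ∈ openSegment ℝ a b := by
  by_cases ha : x = a
  · exact Or.inl ha
  by_cases hb : x = b
  · exact Or.inr (Or.inl hb)
  exact Or.inr (Or.inr (mem_openSegment_of_ne_left_right (Ne.symm ha) (Ne.symm hb) hx))

theorem isPreconnected_segment_diff (a b : Plane) : IsPreconnected (segment ℝ a b \ {a}) := by
  by_cases hab : a = b
  · subst hab; simp [isPreconnected_empty]
  have : segment ℝ a b \ {a} = (fun θ : ℝ => a + θ • (b - a)) '' Set.Ioc 0 1 := by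
    rw [segment_eq_image']
    ext x
    constructor
    · rintro ⟨⟨θ, ⟨h0, h1⟩, rfl⟩, hne⟩
      refine ⟨θ, ⟨lt_of_le_of_ne h0 ?_, h1⟩, rfl⟩
      rintro rfl; simp at hne
    · rintro ⟨θ, ⟨h0, h1⟩, rfl⟩
      refine ⟨⟨θ, ⟨h0.le, h1⟩, rfl⟩, ?_⟩
      simp [sub_ne_zero.2 (Ne.symm hab), h0.ne']
  rw [this]
  exact isPreconnected_Ioc.image _ (by fun_prop)

theorem add_smul_mem_openSegment {a b : Plane} {ε : ℝ} (h0 : 0 < ε) (h1 : ε < 1) :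
    a + ε • (b - a) ∈ openSegment ℝ a b := by
  rw [openSegment_eq_image']; exact ⟨ε, ⟨h0, h1⟩, rfl⟩

/-- The total angle along the arc with a chord, transported from one chord end to a vertex. -/
theorem eq_along_arc {f : Plane → ℝ} {a b : ℕ} (hab : a ≤ b)
    (hf : ∀ r, a ≤ r → r < b → f (p r) = f (p (r + 1))) : f (p a) = f (p b) := by
  induction b, hab using Nat.le_induction with
  | base => rfl
  | succ b hab ih => exact (ih fun r h1 h2 => hf r h1 (by omega)).trans (hf b hab (by omega))

set_option maxHeartbeats 1000000 in
/-- Two disjoint chords of a simple closed polygon, whose ends separate each other on the polygon,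
do not lie in the same component of the complement. -/
theorem IsCycle.not_crossing (h : IsCycle n p) {i j k l : ℕ} (hik : i < k) (hkj : k < j)
    (hjl : j < l) (hl : l < i + n)
    (hd : ∀ x ∈ openSegment ℝ (p i) (p j), x ∉ curve p)
    (he : ∀ x ∈ openSegment ℝ (p k) (p l), x ∉ curve p)
    (hde : ∀ x ∈ openSegment ℝ (p i) (p j), x ∉ openSegment ℝ (p k) (p l))
    {S : Set Plane} (hS : IsPreconnected S) (hSc : ∀ x ∈ S, x ∉ curve p) {m m' : Plane}
    (hm : m ∈ S) (hm' : m' ∈ S) (hmd : m ∈ openSegment ℝ (p i) (p j))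
    (hme : m' ∈ openSegment ℝ (p k) (p l)) : False := by
  obtain ⟨j', rfl⟩ : ∃ j', j = j' + 1 := ⟨j - 1, by omega⟩
  set c := p (j' + 1) with hc
  set u := p j' with hu
  set v := p (j' + 2) with hv
  set d := p i with hdd
  have huc : u ≠ c := by rw [Ne, h.eq_iff]; exact h.not_modEq_succ j'
  have hvc : v ≠ c := by rw [Ne, eq_comm, h.eq_iff]; exact h.not_modEq_succ (j' + 1)
  have hdc : d ≠ c := by rw [Ne, h.eq_iff]; exact not_modEq_of_lt (by omega) (by omega)
  -- which points are off the chord `d`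
  have hoffd : ∀ x ∈ curve p, x ≠ d → x ≠ c → x ∉ segment ℝ d c := by
    intro x hx h1 h2 h3
    rcases mem_segment_iff_open h3 with h4 | h4 | h4
    exacts [h1 h4, h2 h4, hd x h4 hx]
  have hcurve : ∀ x r, x ∈ segment ℝ (p r) (p (r + 1)) → x ∈ curve p := fun x r hx =>
    edge_subset_curve p r hx
  have hdedge : d ∈ segment ℝ (p i) (p (i + 1)) := left_mem_segment ..
  have hdedge' : d ∈ segment ℝ (p (i + n - 1)) (p (i + n - 1 + 1)) := by
    rw [show i + n - 1 + 1 = i + n by omega, h.period]; exact right_mem_segment ..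
  -- the points of the chord `e`
  have hoffe : ∀ x ∈ openSegment ℝ (p k) (p l), x ∉ segment ℝ d c := by
    intro x hx h3
    rcases mem_segment_iff_open h3 with h4 | h4 | h4
    · exact he x hx (h4 ▸ vertex_mem_curve p i)
    · exact he x hx (h4 ▸ vertex_mem_curve p (j' + 1))
    · exact hde x h4 hx
  -- transport of the first closed polygon's angle
  set F₁ : Plane → ℝ := fun x => arcAng p i (j' + 1) x + ang c d x with hF₁
  set F₂ : Plane → ℝ := fun x => arcAng p (j' + 1) (i + n) x + ang d c x with hF₂
  have hoff₁ : ∀ r, j' + 1 ≤ r → r < l → ∀ x ∈ segment ℝ (p r) (p (r + 1)), x ≠ c →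
      (∀ s, i ≤ s → s < j' + 1 → x ∉ segment ℝ (p s) (p (s + 1))) ∧ x ∉ segment ℝ c d := by
    intro r h1 h2 x hx hxc
    have h3 : ∀ s, i ≤ s → s < j' + 1 → x ∉ segment ℝ (p s) (p (s + 1)) := fun s h3 h4 =>
      h.arc_disjoint h1 h2 hl h3 h4 hx hxc
    refine ⟨h3, ?_⟩
    rw [segment_symm]
    refine hoffd x (hcurve x r hx) ?_ hxc
    rintro rfl
    exact h3 i le_rfl (by omega) hdedge
  have hoff₂ : ∀ r, k ≤ r → r < j' + 1 → ∀ x ∈ segment ℝ (p r) (p (r + 1)), x ≠ c →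
      (∀ s, j' + 1 ≤ s → s < i + n → x ∉ segment ℝ (p s) (p (s + 1))) ∧ x ∉ segment ℝ d c := by
    intro r h1 h2 x hx hxc
    have h3 : ∀ s, j' + 1 ≤ s → s < i + n → x ∉ segment ℝ (p s) (p (s + 1)) := fun s h3 h4 =>
      h.arc_disjoint' h1 h2 (by omega : i + n < k + n) h3 h4 hx hxc
    refine ⟨h3, hoffd x (hcurve x r hx) ?_ hxc⟩
    rintro rfl
    exact h3 (i + n - 1) (by omega) (by omega) hdedge'
  have hc₁ : ∀ {T : Set Plane}, IsPreconnected T →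
      (∀ x ∈ T, (∀ s, i ≤ s → s < j' + 1 → x ∉ segment ℝ (p s) (p (s + 1))) ∧
        x ∉ segment ℝ c d) → ∀ {x y}, x ∈ T → y ∈ T → F₁ x = F₁ y := fun hT hT' _ _ hx hy =>
    chord_const (by omega) hT (fun x hx => (hT' x hx).1) rfl rfl (fun x hx => (hT' x hx).2) hx hy
  have hc₂ : ∀ {T : Set Plane}, IsPreconnected T →
      (∀ x ∈ T, (∀ s, j' + 1 ≤ s → s < i + n → x ∉ segment ℝ (p s) (p (s + 1))) ∧
        x ∉ segment ℝ d c) → ∀ {x y}, x ∈ T → y ∈ T → F₂ x = F₂ y := fun hT hT' _ _ hx hy =>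
    chord_const (by omega) hT (fun x hx => (hT' x hx).1) (h.period i).symm rfl
      (fun x hx => (hT' x hx).2) hx hy
  have hne : ∀ r, j' + 1 < r → r ≤ l → p r ≠ c := fun r h1 h2 => by
    rw [Ne, eq_comm, h.eq_iff]; exact not_modEq_of_lt (by omega) (by omega)
  have hne' : ∀ r, k ≤ r → r < j' + 1 → p r ≠ c := fun r h1 h2 => by
    rw [Ne, h.eq_iff]; exact not_modEq_of_lt (by omega) (by omega)
  obtain ⟨l', rfl⟩ : ∃ l', l = l' + 1 := ⟨l - 1, by omega⟩
  -- `F₁` belongs to the polygon formed by the arc from `i` to `j` and the chord. It is transported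
  -- without meeting that polygon: along the second chord to `p l`, back along the other arc, and
  -- down the edge from `v` towards `c`. `F₂` is transported symmetrically via `p k` and the edge
  -- from `u`.
  have hF₁m : F₁ m' = F₁ (p (l' + 1)) := by
    refine hc₁ (isPreconnected_segment_diff (p k) (p (l' + 1))) ?_
      ⟨openSegment_subset_segment _ _ _ hme, ?_⟩ ⟨right_mem_segment .., ?_⟩
    · rintro x ⟨hx, hxk⟩
      rcases mem_segment_iff_open hx with h1 | h1 | h1
      · exact absurd h1 hxk
      · subst h1
        exact hoff₁ l' (by omega) (by omega) _ (right_mem_segment ..) (hne _ (by omega) le_rfl)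
      · refine ⟨fun s _ _ hs => he x h1 (hcurve x s hs), ?_⟩
        rw [segment_symm]; exact hoffe x h1
    · rintro rfl
      exact he _ hme (vertex_mem_curve p k)
    · intro h0
      rw [Set.mem_singleton_iff, eq_comm, h.eq_iff] at h0
      exact not_modEq_of_lt (by omega) (by omega) h0
  have hF₂m : F₂ m' = F₂ (p k) := by
    refine hc₂ (isPreconnected_segment_diff (p (l' + 1)) (p k)) ?_
      ⟨segment_symm ℝ (p k) _ ▸ openSegment_subset_segment _ _ _ hme, ?_⟩
      ⟨right_mem_segment .., ?_⟩
    · rintro x ⟨hx, hxk⟩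
      rcases mem_segment_iff_open hx with h1 | h1 | h1
      · exact absurd h1 hxk
      · subst h1
        exact hoff₂ k le_rfl (by omega) _ (left_mem_segment ..) (hne' _ le_rfl (by omega))
      · rw [openSegment_symm] at h1
        exact ⟨fun s _ _ hs => he x h1 (hcurve x s hs), hoffe x h1⟩
    · rintro rfl
      exact he _ hme (vertex_mem_curve p (l' + 1))
    · intro h0
      rw [Set.mem_singleton_iff, h.eq_iff] at h0
      exact not_modEq_of_lt (by omega) (by omega) h0
  have hF₁l : F₁ (p (j' + 2)) = F₁ (p (l' + 1)) := by
    refine eq_along_arc (by omega) fun r h1 h2 => ?_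
    refine hc₁ (convex_segment (p r) (p (r + 1))).isPreconnected ?_ (left_mem_segment ..)
      (right_mem_segment ..)
    intro x hx
    refine hoff₁ r (by omega) h2 x hx ?_
    rintro rfl
    rcases h.mem_edge hx with h3 | h3
    · exact not_modEq_of_lt (by omega) (by omega) h3
    · exact not_modEq_of_lt (by omega) (by omega) h3
  have hF₂l : F₂ (p k) = F₂ (p j') := by
    refine eq_along_arc (by omega) fun r h1 h2 => ?_
    refine hc₂ (convex_segment (p r) (p (r + 1))).isPreconnected ?_ (left_mem_segment ..)
      (right_mem_segment ..)
    intro x hx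
    refine hoff₂ r (by omega) (by omega) x hx ?_
    rintro rfl
    rcases h.mem_edge hx with h3 | h3
    · exact not_modEq_of_lt (by omega) (by omega) h3.symm
    · exact not_modEq_of_lt (by omega) (by omega) h3.symm
  have hF₁ε : ∀ ε : ℝ, 0 < ε → ε < 1 → F₁ m' = F₁ (c + ε • (v - c)) := by
    intro ε h0 h1
    rw [hF₁m, ← hF₁l]
    have h2 := add_smul_mem_openSegment (a := c) (b := v) h0 h1
    refine hc₁ (isPreconnected_segment_diff c v) (fun x hx => hoff₁ (j' + 1) le_rfl (by omega) x
      hx.1 hx.2) ⟨right_mem_segment .., hvc⟩ ⟨openSegment_subset_segment _ _ _ h2, ?_⟩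
    intro h3
    rw [Set.mem_singleton_iff.1 h3, left_mem_openSegment_iff] at h2
    exact hvc h2.symm
  have hF₂ε : ∀ ε : ℝ, 0 < ε → ε < 1 → F₂ m' = F₂ (c + ε • (u - c)) := by
    intro ε h0 h1
    rw [hF₂m, hF₂l]
    have h2 := add_smul_mem_openSegment (a := c) (b := u) h0 h1
    refine hc₂ (isPreconnected_segment_diff c u) (fun x hx => hoff₂ j' (by omega) (by omega) x
      (by rw [segment_symm]; exact hx.1) hx.2) ⟨right_mem_segment .., huc⟩
      ⟨openSegment_subset_segment _ _ _ h2, ?_⟩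
    intro h3
    rw [Set.mem_singleton_iff.1 h3, left_mem_openSegment_iff] at h2
    exact huc h2.symm
  set W : Plane → ℝ := fun x => arcAng p i (i + n) x with hW
  have hWc : ∀ {T : Set Plane}, IsPreconnected T → (∀ x ∈ T, x ∉ curve p) → ∀ {x y}, x ∈ T →
      y ∈ T → W x = W y := by
    intro T hT hT' x y hx hy
    refine eq_of_coe_angle_eq_zero hT (f := W) ?_ ?_ hx hy
    · exact fun z hz => (continuousAt_arcAng fun s _ _ hs =>
        hT' z hz (hcurve z s hs)).continuousWithinAt
    · intro z hz
      have h1 := arcAng_coe (p := p) (i := i) (j := i + n) (by omega) (x := z)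
        fun s _ _ hs => hT' z hz (hs ▸ vertex_mem_curve p s)
      rw [h.period, sub_self] at h1
      exact h1
  have hWm : W m' = W m := hWc hS hSc hm' hm
  have hWε : ∀ ε : ℝ, 0 < ε → ε < 1 → W m = W (c + ε • (d - c)) := by
    intro ε h0 h1
    refine hWc (convex_openSegment d c).isPreconnected hd hmd ?_
    rw [openSegment_symm]
    exact add_smul_mem_openSegment h0 h1
  -- The chord is traversed in opposite directions by the two polygons, so its contributions cancel.
  have hsum : W m' = F₁ m' + F₂ m' := by
    rw [hF₁, hF₂, hW]
    simp only
    rw [ang_symm (hoffe m' hme), ← arcAng_add (by omega : i ≤ j' + 1) (by omega : j' + 1 ≤ i + n)]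
    ring
  -- limits at the vertex `c`
  have hsVU : -(toC v - toC c) / (toC u - toC c) ∈ Complex.slitPlane := by
    refine neg_div_mem_slitPlane huc hvc fun x h1 h2 => ?_
    have h3 := (h.inter j' (j' + 1) (h.not_modEq_succ j') x
      (by rw [segment_symm]; exact openSegment_subset_segment _ _ _ h1)
      (openSegment_subset_segment _ _ _ h2)).1
    rcases h3 with rfl | rfl
    · exact huc (right_mem_openSegment_iff.1 h1).symm
    · exact huc (left_mem_openSegment_iff.1 h1).symm
  have hsDV : -(toC d - toC c) / (toC v - toC c) ∈ Complex.slitPlane := by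
    refine neg_div_mem_slitPlane hvc hdc fun x h1 h2 => ?_
    exact hd x (by rw [openSegment_symm]; exact h2)
      (hcurve x (j' + 1) (openSegment_subset_segment _ _ _ h1))
  have hsUD : -(toC u - toC c) / (toC d - toC c) ∈ Complex.slitPlane := by
    refine neg_div_mem_slitPlane hdc huc fun x h1 h2 => ?_
    exact hd x (by rw [openSegment_symm]; exact h1)
      (hcurve x j' (by rw [segment_symm]; exact openSegment_subset_segment _ _ _ h2))
  have hinv : ∀ z w : ℂ, -z / w = (-w / z)⁻¹ := by
    intro z w; rw [inv_div, div_neg, neg_div]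
  have hargneg : ∀ z w : ℂ, -w / z ∈ Complex.slitPlane → -z / w ∈ Complex.slitPlane ∧
      (-z / w).arg = - (-w / z).arg := by
    intro z w hs
    rw [hinv z w]
    have h1 := Complex.mem_slitPlane_iff_arg.1 hs
    have h2 : (-w / z)⁻¹.arg = -(-w / z).arg := by rw [Complex.arg_inv, if_neg h1.1]
    refine ⟨Complex.mem_slitPlane_iff_arg.2 ⟨?_, inv_ne_zero h1.2⟩, h2⟩
    rw [h2]
    have := Complex.neg_pi_lt_arg (-w / z)
    linarith
  set U := toC u - toC c with hU
  set V := toC v - toC c with hV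
  set D := toC d - toC c with hD
  have htoC : ∀ a, toC (a - c) = toC a - toC c := fun a => map_sub _ _ _
  have hA₁ : ∀ w : Plane, Tendsto (fun ε : ℝ => arcAng p i j' (c + ε • w)) (𝓝[>] 0)
      (𝓝 (arcAng p i j' c)) := by
    intro w
    have h1 : ContinuousAt (fun ε : ℝ => arcAng p i j' (c + ε • w)) 0 := by
      have h0 : ContinuousAt (fun ε : ℝ => c + ε • w) 0 := Continuous.continuousAt (by fun_prop)
      have hg : ContinuousAt (arcAng p i j') c := by
        refine continuousAt_arcAng fun s h1 h2 hs => ?_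
        rcases h.mem_edge hs with h3 | h3
        · exact not_modEq_of_lt (by omega) (by omega) h3.symm
        · exact not_modEq_of_lt (by omega) (by omega) h3.symm
      exact hg.comp_of_eq h0 (by simp)
    simpa using h1.tendsto.mono_left (nhdsWithin_le_nhds (s := Set.Ioi 0))
  have hA₂ : ∀ w : Plane, Tendsto (fun ε : ℝ => arcAng p (j' + 2) (i + n) (c + ε • w)) (𝓝[>] 0)
      (𝓝 (arcAng p (j' + 2) (i + n) c)) := by
    intro w
    have h1 : ContinuousAt (fun ε : ℝ => arcAng p (j' + 2) (i + n) (c + ε • w)) 0 := by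
      have h0 : ContinuousAt (fun ε : ℝ => c + ε • w) 0 := Continuous.continuousAt (by fun_prop)
      have hg : ContinuousAt (arcAng p (j' + 2) (i + n)) c := by
        refine continuousAt_arcAng fun s h1 h2 hs => ?_
        rcases h.mem_edge hs with h3 | h3
        · exact not_modEq_of_lt (by omega) (by omega) h3
        · exact not_modEq_of_lt (by omega) (by omega) h3
      exact hg.comp_of_eq h0 (by simp)
    simpa using h1.tendsto.mono_left (nhdsWithin_le_nhds (s := Set.Ioi 0))
  have hs1 : ∀ x, arcAng p i (j' + 1) x = arcAng p i j' x + ang u c x := by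
    intro x
    unfold arcAng
    rw [Finset.sum_Ico_succ_top (by omega)]
  have hs2 : ∀ x, arcAng p (j' + 1) (i + n) x = ang c v x + arcAng p (j' + 2) (i + n) x := by
    intro x
    unfold arcAng
    rw [Finset.sum_eq_sum_Ico_succ_bot (by omega)]
  have hevent : ∀ᶠ ε : ℝ in 𝓝[>] 0, 0 < ε ∧ ε < 1 := Ioo_mem_nhdsGT zero_lt_one
  have hlim₁ : F₁ m' = arcAng p i j' c + (-V / U).arg + (-D / V).arg := by
    refine tendsto_nhds_unique (tendsto_const_nhds (f := 𝓝[>] (0 : ℝ))) ?_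
    have h1 := tendsto_ang_in (w := v - c) huc (by rw [htoC]; exact hsVU)
    have h2 := tendsto_ang_out (b := d) (c := c) (w := v - c) (sub_ne_zero.2 hvc)
      (by rw [htoC]; exact hsDV)
    rw [htoC] at h1 h2
    refine (((hA₁ (v - c)).add h1).add h2).congr' ?_
    filter_upwards [hevent] with ε hε
    rw [hF₁ε ε hε.1 hε.2, hF₁]
    simp only [hs1]
  have hlim₂ : F₂ m' = (-V / U).arg + arcAng p (j' + 2) (i + n) c + (-U / D).arg := by
    refine tendsto_nhds_unique (tendsto_const_nhds (f := 𝓝[>] (0 : ℝ))) ?_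
    have h1 := tendsto_ang_in (w := u - c) hdc (by rw [htoC]; exact hsUD)
    have h2 := tendsto_ang_out (b := v) (c := c) (w := u - c) (sub_ne_zero.2 huc)
      (by rw [htoC]; exact hsVU)
    rw [htoC] at h1 h2
    refine ((h2.add (hA₂ (u - c))).add h1).congr' ?_
    filter_upwards [hevent] with ε hε
    rw [hF₂ε ε hε.1 hε.2, hF₂]
    simp only [hs2]
  have hlim₃ : W m = arcAng p i j' c + (-D / U).arg +
      ((-V / D).arg + arcAng p (j' + 2) (i + n) c) := by
    refine tendsto_nhds_unique (tendsto_const_nhds (f := 𝓝[>] (0 : ℝ))) ?_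
    have h1 := tendsto_ang_in (w := d - c) huc (by rw [htoC]; exact (hargneg _ _ hsUD).1)
    have h2 := tendsto_ang_out (b := v) (c := c) (w := d - c) (sub_ne_zero.2 hdc)
      (by rw [htoC]; exact (hargneg _ _ hsDV).1)
    rw [htoC] at h1 h2
    refine (((hA₁ (d - c)).add h1).add (h2.add (hA₂ (d - c)))).congr' ?_
    filter_upwards [hevent] with ε hε
    rw [hWε ε hε.1 hε.2, hW]
    simp only
    rw [← arcAng_add (by omega : i ≤ j' + 1) (by omega : j' + 1 ≤ i + n), hs1, hs2]
  rw [(hargneg D U hsUD).2, (hargneg V D hsDV).2] at hlim₃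
  -- The arcs away from `c` contribute the same to `W` as to `F₁ + F₂`. The angles at `c` remain,
  -- and inverting two of them shows that twice this sum vanishes.
  have hzero : (-V / U).arg + (-D / V).arg + (-U / D).arg = 0 := by
    linarith
  have hU0 : U ≠ 0 := sub_ne_zero.2 fun h0 => huc (toC.injective h0)
  have hV0 : V ≠ 0 := sub_ne_zero.2 fun h0 => hvc (toC.injective h0)
  have hD0 : D ≠ 0 := sub_ne_zero.2 fun h0 => hdc (toC.injective h0)
  -- The product of the three quotients is -1, so modulo `2π` their arguments add up to `π`, not 0.
  have hcoe := congrArg (fun r : ℝ => (r : Real.Angle)) hzero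
  simp only [Real.Angle.coe_add, Real.Angle.coe_zero] at hcoe
  rw [← Complex.arg_mul_coe_angle (by simp [hU0, hV0]) (by simp [hV0, hD0]),
    ← Complex.arg_mul_coe_angle (by simp [hU0, hV0, hD0]) (by simp [hU0, hD0]),
    show -V / U * (-D / V) * (-U / D) = -1 by field_simp, Complex.arg_neg_one] at hcoe
  exact Real.Angle.pi_ne_zero hcoe

end PlanePolygon

namespace PlanePolygon

open Filter Topology

/-! ## Components of the complement of the curve -/

theorem mem_closure_of_add_smul {N S : Set Plane} (hN : IsOpen N) {x w : Plane} (hx : x ∈ N)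
    (h : ∀ ε : ℝ, 0 < ε → x + ε • w ∈ N → x + ε • w ∈ S) : x ∈ closure S := by
  have hlim : Tendsto (fun ε : ℝ => x + ε • w) (𝓝[>] 0) (𝓝 x) := by
    have : Continuous (fun ε : ℝ => x + ε • w) := by fun_prop
    simpa using (this.tendsto 0).mono_left nhdsWithin_le_nhds
  refine mem_closure_of_tendsto hlim ?_
  filter_upwards [self_mem_nhdsWithin, hlim.eventually (hN.mem_nhds hx)] with ε h1 h2
  exact h ε h1 h2

/-- Near `q`, the set `K` separates the plane into at most two pieces, which it bounds. -/
def LocallyTwoSided (K : Set Plane) (q : Plane) : Prop :=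
  ∃ N S₁ S₂ : Set Plane, IsOpen N ∧ q ∈ N ∧ IsPreconnected S₁ ∧ IsPreconnected S₂ ∧
    S₁ ⊆ Kᶜ ∧ S₂ ⊆ Kᶜ ∧ N \ K ⊆ S₁ ∪ S₂ ∧ N ∩ K ⊆ closure S₁ ∧ N ∩ K ⊆ closure S₂

/-- In a disc that misses `R` and is no larger than either segment, `K` consists of two radii. If
they are opposite, the sides are two half-discs. Otherwise one side is the convex sector where both
coordinates are positive; the other is the union of two half-discs with a common point. `hab`
excludes radii in the same direction. -/
theorem locallyTwoSided_of_segments {K R : Set Plane} {q a b : Plane} (ha : a ≠ q) (hb : b ≠ q)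
    (hKa : segment ℝ q a ⊆ K) (hKb : segment ℝ q b ⊆ K) (hR : IsClosed R) (hqR : q ∉ R)
    (hK : K ⊆ R ∪ (segment ℝ q a ∪ segment ℝ q b))
    (hab : ∀ x, x ∈ openSegment ℝ q a → x ∈ openSegment ℝ q b → False) :
    LocallyTwoSided K q := by
  have hu0 : a - q ≠ 0 := sub_ne_zero.2 ha
  have hv0 : b - q ≠ 0 := sub_ne_zero.2 hb
  obtain ⟨r', hr'0, hr'⟩ := Metric.isOpen_iff.1 hR.isOpen_compl q hqR
  set r := min r' (min ‖a - q‖ ‖b - q‖) with hr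
  have hr0 : 0 < r := lt_min hr'0 (lt_min (norm_pos_iff.2 hu0) (norm_pos_iff.2 hv0))
  set N := Metric.ball q r with hN
  have hNo : IsOpen N := Metric.isOpen_ball
  have hNc : Convex ℝ N := convex_ball q r
  have hqN : q ∈ N := Metric.mem_ball_self hr0
  have hNK : ∀ x ∈ N, x ∈ K → ∃ t : ℝ, 0 ≤ t ∧ (x = q + t • (a - q) ∨ x = q + t • (b - q)) := by
    intro x hx hxK
    rcases hK hxK with h1 | h1 | h1
    · exact absurd h1 (hr' (Metric.ball_subset_ball (min_le_left _ _) hx))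
    · rw [segment_eq_image'] at h1
      obtain ⟨t, ht, rfl⟩ := h1
      exact ⟨t, ht.1, Or.inl rfl⟩
    · rw [segment_eq_image'] at h1
      obtain ⟨t, ht, rfl⟩ := h1
      exact ⟨t, ht.1, Or.inr rfl⟩
  have hray : ∀ c, r ≤ ‖c - q‖ → segment ℝ q c ⊆ K → ∀ t : ℝ, 0 ≤ t → q + t • (c - q) ∈ N →
      q + t • (c - q) ∈ K := by
    intro c hc hcK t ht h1
    apply hcK
    rw [segment_eq_image']
    refine ⟨t, ⟨ht, ?_⟩, rfl⟩
    rw [hN, Metric.mem_ball, dist_eq_norm, add_sub_cancel_left, norm_smul, Real.norm_of_nonneg ht]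
      at h1
    by_contra! h2
    nlinarith
  have hraya := hray a ((min_le_right _ _).trans (min_le_left _ _)) hKa
  have hrayb := hray b ((min_le_right _ _).trans (min_le_right _ _)) hKb
  have hhalf : ∀ f : Plane →L[ℝ] ℝ, Convex ℝ {x | 0 < f (x - q)} := by
    intro f
    have : {x | 0 < f (x - q)} = {x | f q < f x} := by
      ext x
      show 0 < f (x - q) ↔ f q < f x
      rw [map_sub, sub_pos]
    rw [this]
    exact convex_halfSpace_gt f.toLinearMap.isLinear _
  by_cases hcr : cross (a - q) (b - q) = 0
  · -- opposite directions
    obtain ⟨κ, hκ, hbκ⟩ : ∃ κ : ℝ, 0 < κ ∧ b - q = -(κ • (a - q)) := by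
      set u := a - q
      set v := b - q
      simp only [cross] at hcr
      have hpos : 0 < u 0 ^ 2 + u 1 ^ 2 := by
        by_contra! h0
        apply hu0
        ext i
        fin_cases i
        · simp; nlinarith [sq_nonneg (u 0), sq_nonneg (u 1)]
        · simp; nlinarith [sq_nonneg (u 0), sq_nonneg (u 1)]
      have hvc : v = ((u 0 * v 0 + u 1 * v 1) / (u 0 ^ 2 + u 1 ^ 2)) • u := by
        ext i
        fin_cases i
        · simp; field_simp; linear_combination -u 1 * hcr
        · simp; field_simp; linear_combination u 0 * hcr
      set c := (u 0 * v 0 + u 1 * v 1) / (u 0 ^ 2 + u 1 ^ 2)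
      refine ⟨-c, ?_, by rw [hvc]; module⟩
      by_contra! hc
      have hc0 : 0 < c := by
        refine lt_of_le_of_ne (by linarith) fun h0 => hv0 ?_
        rw [hvc, ← h0, zero_smul]
      refine hab (q + (1 / (1 + c)) • v) ?_ ?_
      · refine mem_openSegment_of_sub (r := c / (1 + c)) (by positivity)
          ((div_lt_one (by linarith)).2 (by linarith)) ?_
        rw [add_sub_cancel_left, hvc, smul_smul]
        congr 1; ring
      · exact mem_openSegment_of_sub (r := 1 / (1 + c)) (by positivity)
          ((div_lt_one (by linarith)).2 (by linarith)) (by rw [add_sub_cancel_left])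
    set ν : Plane := !₂[-(a - q) 1, (a - q) 0] with hν
    have hcν : cross (a - q) ν ≠ 0 := by
      intro h0
      apply hu0
      simp only [cross, hν] at h0
      ext i
      fin_cases i
      · simp at h0 ⊢; nlinarith [sq_nonneg (a 0 - q 0), sq_nonneg (a 1 - q 1)]
      · simp at h0 ⊢; nlinarith [sq_nonneg (a 0 - q 0), sq_nonneg (a 1 - q 1)]
    obtain ⟨s, t, hst, hsu, htu, hsν, htν⟩ := exists_coords hcν
    have htK : ∀ x ∈ N, x ∈ K → t (x - q) = 0 := by
      intro x hx hxK
      obtain ⟨τ, -, rfl | rfl⟩ := hNK x hx hxK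
      · rw [add_sub_cancel_left, map_smul, htu, smul_zero]
      · rw [add_sub_cancel_left, map_smul, hbκ, map_neg, map_smul, htu]; simp
    have hKt : ∀ x ∈ N, t (x - q) = 0 → x ∈ K := by
      intro x hx h0
      have h1 := hst (x - q)
      rw [h0, zero_smul, add_zero] at h1
      rcases le_total 0 (s (x - q)) with h2 | h2
      · have h3 : x = q + s (x - q) • (a - q) := by rw [← h1]; abel
        rw [h3]
        exact hraya _ h2 (h3 ▸ hx)
      · have h3 : x = q + (-s (x - q) / κ) • (b - q) := by
          rw [hbκ, smul_neg, smul_smul, div_mul_cancel₀ _ hκ.ne', neg_smul, neg_neg, ← h1]; abel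
        have h4 := hrayb (-s (x - q) / κ) (div_nonneg (by linarith) hκ.le) (h3 ▸ hx)
        rwa [← h3] at h4
    refine ⟨N, N ∩ {x | 0 < t (x - q)}, N ∩ {x | 0 < (-t) (x - q)}, hNo, hqN,
      (hNc.inter (hhalf t)).isPreconnected, (hNc.inter (hhalf (-t))).isPreconnected, ?_, ?_, ?_,
      ?_, ?_⟩
    · rintro x ⟨hx, h1⟩ hxK
      exact (ne_of_gt h1) (htK x hx hxK)
    · rintro x ⟨hx, h1⟩ hxK
      have h2 : 0 < -t (x - q) := h1
      rw [htK x hx hxK] at h2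
      simp at h2
    · rintro x ⟨hx, hxK⟩
      rcases lt_trichotomy (t (x - q)) 0 with h1 | h1 | h1
      · exact Or.inr ⟨hx, show 0 < -t (x - q) by linarith⟩
      · exact absurd (hKt x hx h1) hxK
      · exact Or.inl ⟨hx, h1⟩
    · rintro x ⟨hx, hxK⟩
      refine mem_closure_of_add_smul hNo hx (w := ν) fun ε hε hεN => ⟨hεN, ?_⟩
      show 0 < t (x + ε • ν - q)
      rw [show x + ε • ν - q = (x - q) + ε • ν by abel, map_add, map_smul, htK x hx hxK, htν]
      simpa using hε
    · rintro x ⟨hx, hxK⟩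
      refine mem_closure_of_add_smul hNo hx (w := -ν) fun ε hε hεN => ⟨hεN, ?_⟩
      show 0 < -t (x + ε • -ν - q)
      rw [show x + ε • -ν - q = (x - q) - ε • ν by rw [smul_neg]; abel, map_sub, map_smul,
        htK x hx hxK, htν]
      simpa using hε
  · obtain ⟨s, t, hst, hsu, htu, hsv, htv⟩ := exists_coords hcr
    have hcoord : ∀ x ∈ N, x ∈ K → 0 ≤ s (x - q) ∧ 0 ≤ t (x - q) ∧
        (s (x - q) = 0 ∨ t (x - q) = 0) := by
      intro x hx hxK
      obtain ⟨τ, hτ, rfl | rfl⟩ := hNK x hx hxK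
      · rw [add_sub_cancel_left, map_smul, map_smul, hsu, htu]; simpa using hτ
      · rw [add_sub_cancel_left, map_smul, map_smul, hsv, htv]; simpa using hτ
    have hKs : ∀ x ∈ N, 0 ≤ s (x - q) → t (x - q) = 0 → x ∈ K := by
      intro x hx h2 h0
      have h1 := hst (x - q)
      rw [h0, zero_smul, add_zero] at h1
      have h3 : x = q + s (x - q) • (a - q) := by rw [← h1]; abel
      have h4 := hraya _ h2 (h3 ▸ hx)
      rwa [← h3] at h4
    have hKt : ∀ x ∈ N, s (x - q) = 0 → 0 ≤ t (x - q) → x ∈ K := by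
      intro x hx h0 h2
      have h1 := hst (x - q)
      rw [h0, zero_smul, zero_add] at h1
      have h3 : x = q + t (x - q) • (b - q) := by rw [← h1]; abel
      have h4 := hrayb _ h2 (h3 ▸ hx)
      rwa [← h3] at h4
    have hS₂ : IsPreconnected (N ∩ {x | 0 < (-s) (x - q)} ∪ N ∩ {x | 0 < (-t) (x - q)}) := by
      have hw : q ∈ closure {x : Plane | x ∈ N ∧ 0 < (-s) (x - q) ∧ 0 < (-t) (x - q)} := by
        refine mem_closure_of_add_smul hNo hqN (w := -((a - q) + (b - q)))
          fun ε hε hεN => ⟨hεN, ?_, ?_⟩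
        · show 0 < -s _
          rw [add_sub_cancel_left, map_smul, map_neg, map_add, hsu, hsv]; simpa using hε
        · show 0 < -t _
          rw [add_sub_cancel_left, map_smul, map_neg, map_add, htu, htv]; simpa using hε
      obtain ⟨w, hwN, hw1, hw2⟩ := closure_nonempty_iff.1 ⟨q, hw⟩
      exact IsPreconnected.union w ⟨hwN, hw1⟩ ⟨hwN, hw2⟩ (hNc.inter (hhalf (-s))).isPreconnected
        (hNc.inter (hhalf (-t))).isPreconnected
    refine ⟨N, N ∩ ({x | 0 < s (x - q)} ∩ {x | 0 < t (x - q)}), _, hNo, hqN,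
      (hNc.inter ((hhalf s).inter (hhalf t))).isPreconnected, hS₂, ?_, ?_, ?_, ?_, ?_⟩
    · rintro x ⟨hx, h1, h2⟩ hxK
      rcases (hcoord x hx hxK).2.2 with h3 | h3
      · exact ne_of_gt h1 h3
      · exact ne_of_gt h2 h3
    · rintro x (⟨hx, h1⟩ | ⟨hx, h1⟩) hxK
      · have h2 : 0 < -s (x - q) := h1
        linarith [(hcoord x hx hxK).1]
      · have h2 : 0 < -t (x - q) := h1
        linarith [(hcoord x hx hxK).2.1]
    · rintro x ⟨hx, hxK⟩
      rcases lt_trichotomy (s (x - q)) 0 with h1 | h1 | h1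
      · exact Or.inr (Or.inl ⟨hx, show 0 < -s (x - q) by linarith⟩)
      · rcases lt_or_ge (t (x - q)) 0 with h2 | h2
        · exact Or.inr (Or.inr ⟨hx, show 0 < -t (x - q) by linarith⟩)
        · exact absurd (hKt x hx h1 h2) hxK
      · rcases lt_trichotomy (t (x - q)) 0 with h2 | h2 | h2
        · exact Or.inr (Or.inr ⟨hx, show 0 < -t (x - q) by linarith⟩)
        · exact absurd (hKs x hx h1.le h2) hxK
        · exact Or.inl ⟨hx, h1, h2⟩
    · rintro x ⟨hx, hxK⟩
      obtain ⟨h1, h2, -⟩ := hcoord x hx hxK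
      refine mem_closure_of_add_smul hNo hx (w := (a - q) + (b - q))
        fun ε hε hεN => ⟨hεN, ?_, ?_⟩
      · show 0 < s _
        rw [show x + ε • ((a - q) + (b - q)) - q = (x - q) + ε • ((a - q) + (b - q)) by abel,
          map_add, map_smul, map_add, hsu, hsv, smul_eq_mul]
        linarith
      · show 0 < t _
        rw [show x + ε • ((a - q) + (b - q)) - q = (x - q) + ε • ((a - q) + (b - q)) by abel,
          map_add, map_smul, map_add, htu, htv, smul_eq_mul]
        linarith
    · rintro x ⟨hx, hxK⟩
      obtain ⟨h1, h2, h3 | h3⟩ := hcoord x hx hxK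
      · refine mem_closure_of_add_smul hNo hx (w := -(a - q))
          fun ε hε hεN => Or.inl ⟨hεN, ?_⟩
        show 0 < -s _
        rw [show x + ε • -(a - q) - q = (x - q) - ε • (a - q) by rw [smul_neg]; abel,
          map_sub, map_smul, hsu, h3]
        simpa using hε
      · refine mem_closure_of_add_smul hNo hx (w := -(b - q))
          fun ε hε hεN => Or.inr ⟨hεN, ?_⟩
        show 0 < -t _
        rw [show x + ε • -(b - q) - q = (x - q) - ε • (b - q) by rw [smul_neg]; abel,
          map_sub, map_smul, htv, h3]
        simpa using hε

/-! ### The components of the complement of a polygon -/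

variable {n : ℕ} {p : ℕ → Plane}

theorem isClosed_edges (n : ℕ) (p : ℕ → Plane) (P : ℕ → Prop) :
    IsClosed (⋃ k ∈ {k | k < n ∧ P k}, segment ℝ (p k) (p (k + 1))) := by
  refine Set.Finite.isClosed_biUnion ((Set.finite_Iio n).subset fun k hk => hk.1) fun k _ => ?_
  rw [segment_eq_image_lineMap]
  exact (isCompact_Icc.image (by fun_prop)).isClosed

theorem IsCycle.curve_subset (h : IsCycle n p) (P : ℕ → Prop) {x : Plane} (hx : x ∈ curve p) :
    x ∈ (⋃ k ∈ {k | k < n ∧ P k}, segment ℝ (p k) (p (k + 1))) ∨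
      ∃ k < n, ¬ P k ∧ x ∈ segment ℝ (p k) (p (k + 1)) := by
  obtain ⟨k, hk⟩ := Set.mem_iUnion.1 hx
  rw [h.modEq (Nat.mod_modEq k n).symm, h.modEq ((Nat.mod_modEq k n).symm.add_right 1)] at hk
  have hlt := Nat.mod_lt k (show 0 < n by have := h.three_le; omega)
  by_cases hP : P (k % n)
  · exact Or.inl (Set.mem_biUnion (show k % n ∈ {k | k < n ∧ P k} from ⟨hlt, hP⟩) hk)
  · exact Or.inr ⟨k % n, hlt, hP, hk⟩

/-- At a vertex the two segments are the adjacent edges, at an inner point of an edge the two parts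
of that edge. All other edges form a closed set that misses the point. -/
theorem IsCycle.locallyTwoSided (h : IsCycle n p) {q : Plane} (hq : q ∈ curve p) :
    LocallyTwoSided (curve p) q := by
  obtain ⟨k, hk⟩ := Set.mem_iUnion.1 hq
  have hvert : ∀ k, LocallyTwoSided (curve p) (p k) := by
    intro k
    obtain ⟨k', hk'⟩ : ∃ k', k' + 1 = k + n := ⟨k + n - 1, by have := h.three_le; omega⟩
    rw [← h.period k, ← hk']
    have huc : p k' ≠ p (k' + 1) := by rw [Ne, h.eq_iff]; exact h.not_modEq_succ k'
    have hvc : p (k' + 2) ≠ p (k' + 1) := by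
      rw [Ne, eq_comm, h.eq_iff]; exact h.not_modEq_succ (k' + 1)
    refine locallyTwoSided_of_segments (a := p k') (b := p (k' + 2)) huc hvc
      (by rw [segment_symm]; exact edge_subset_curve p k') (edge_subset_curve p (k' + 1))
      (isClosed_edges n p fun r => ¬ r ≡ k' [MOD n] ∧ ¬ r ≡ k' + 1 [MOD n]) ?_ ?_ ?_
    · intro hmem
      obtain ⟨r, ⟨-, hr1, hr2⟩, hr⟩ := Set.mem_iUnion₂.1 hmem
      rcases h.mem_edge hr with h1 | h1
      · exact hr2 h1.symm
      · exact hr1 (Nat.ModEq.add_right_cancel' 1 h1.symm)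
    · intro x hx
      rcases h.curve_subset (fun r => ¬ r ≡ k' [MOD n] ∧ ¬ r ≡ k' + 1 [MOD n]) hx with
        h1 | ⟨r, -, h1, h2⟩
      · exact Or.inl h1
      · right
        by_cases h3 : r ≡ k' [MOD n]
        · left
          rw [segment_symm, ← h.modEq h3, ← h.modEq (h3.add_right 1)]; exact h2
        · right
          have h4 : r ≡ k' + 1 [MOD n] := by tauto
          rw [show k' + 2 = k' + 1 + 1 from rfl, ← h.modEq h4, ← h.modEq (h4.add_right 1)]
          exact h2
    · intro x h1 h2
      have h3 := (h.inter k' (k' + 1) (h.not_modEq_succ k') x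
        (by rw [segment_symm]; exact openSegment_subset_segment _ _ _ h1)
        (openSegment_subset_segment _ _ _ h2)).1
      rcases h3 with rfl | rfl
      · exact huc (right_mem_openSegment_iff.1 h1).symm
      · exact huc (left_mem_openSegment_iff.1 h1).symm
  rcases mem_segment_iff_open hk with rfl | rfl | hko
  · exact hvert k
  · exact hvert (k + 1)
  have hnv : ∀ r, q ≠ p r := by
    rintro r rfl
    exact h.isPlanarFamily.free _ ⟨k, rfl⟩ (p r) ⟨r, rfl⟩ hko
  refine locallyTwoSided_of_segments (a := p k) (b := p (k + 1)) (hnv k).symm (hnv (k + 1)).symm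
    ?_ ?_ (isClosed_edges n p fun r => ¬ r ≡ k [MOD n]) ?_ ?_ ?_
  · exact ((convex_segment _ _).segment_subset hk (left_mem_segment ..)).trans
      (edge_subset_curve p k)
  · exact ((convex_segment _ _).segment_subset hk (right_mem_segment ..)).trans
      (edge_subset_curve p k)
  · intro hmem
    obtain ⟨r, ⟨-, hr1⟩, hr⟩ := Set.mem_iUnion₂.1 hmem
    rcases (h.inter r k hr1 q hr hk).1 with h1 | h1
    exacts [hnv _ h1, hnv _ h1]
  · intro x hx
    rcases h.curve_subset (fun r => ¬ r ≡ k [MOD n]) hx with h1 | ⟨r, -, h1, h2⟩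
    · exact Or.inl h1
    · right
      have h1 : r ≡ k [MOD n] := not_not.1 h1
      rw [h.modEq h1, h.modEq (h1.add_right 1)] at h2
      obtain ⟨τ, ⟨hτ0, hτ1⟩, hτ⟩ := (segment_eq_image' ℝ (p k) (p (k + 1))) ▸ hk
      obtain ⟨σ, ⟨hσ0, hσ1⟩, hσ⟩ := (segment_eq_image' ℝ (p k) (p (k + 1))) ▸ h2
      simp only at hτ hσ
      have hτ0' : 0 < τ := lt_of_le_of_ne hτ0 fun h0 => hnv k (by rw [← hτ, ← h0]; simp)
      have hτ1' : τ < 1 := lt_of_le_of_ne hτ1 fun h0 => hnv (k + 1) (by rw [← hτ, h0]; simp)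
      rcases le_total σ τ with h3 | h3
      · left
        rw [segment_eq_image']
        refine ⟨(τ - σ) / τ, ⟨div_nonneg (by linarith) hτ0, (div_le_one hτ0').2 (by linarith)⟩, ?_⟩
        simp only
        rw [← hτ, ← hσ]
        match_scalars <;> field_simp <;> ring
      · right
        have h1τ : 0 < 1 - τ := by linarith
        rw [segment_eq_image']
        refine ⟨(σ - τ) / (1 - τ), ⟨div_nonneg (by linarith) h1τ.le,
          (div_le_one h1τ).2 (by linarith)⟩, ?_⟩
        simp only
        rw [← hτ, ← hσ]
        match_scalars <;> field_simp <;> ring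
  · intro x h1 h2
    rw [openSegment_eq_image'] at h1 h2 hko
    obtain ⟨τ, ⟨hτ0, hτ1⟩, hτ⟩ := hko
    obtain ⟨δ, ⟨hδ0, hδ1⟩, hδ⟩ := h1
    obtain ⟨ε, ⟨hε0, hε1⟩, hε⟩ := h2
    simp only at hτ hδ hε
    have h3 : (δ * τ + ε * (1 - τ)) • (p (k + 1) - p k) = 0 := by
      have h4 : x - x = 0 := sub_self x
      nth_rewrite 1 [← hε] at h4
      rw [← hδ, ← hτ] at h4
      rw [← h4]; module
    have h5 : 0 < δ * τ + ε * (1 - τ) := by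
      have : 0 < 1 - τ := by linarith
      positivity
    rcases smul_eq_zero.1 h3 with h6 | h6
    · linarith
    · have : p (k + 1) = p k := sub_eq_zero.1 h6
      rw [h.eq_iff] at this
      exact h.not_modEq_succ k this.symm

/-- The closure of a component meets the curve, for otherwise the component would be clopen in the
plane. The curve points in the closure form a relatively closed set, and a relatively open one
because each local side bounds all of the nearby curve. Connectedness of the curve finishes. -/
theorem IsCycle.mem_closure_component (h : IsCycle n p) {x : Plane} (hx : x ∉ curve p) :
    curve p ⊆ closure (connectedComponentIn (curve p)ᶜ x) := by
  set K := connectedComponentIn (curve p)ᶜ x with hK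
  have hxc : x ∈ (curve p)ᶜ := hx
  have hopen : IsOpen K := h.isCompact_curve.isClosed.isOpen_compl.connectedComponentIn
  have hmeet : (curve p ∩ closure K).Nonempty := by
    by_contra hne
    rw [Set.not_nonempty_iff_eq_empty] at hne
    have hsub : closure K ⊆ K := by
      refine IsPreconnected.subset_connectedComponentIn
        isPreconnected_connectedComponentIn.closure
        (subset_closure (mem_connectedComponentIn hxc)) ?_
      intro y hy hyc
      exact (Set.eq_empty_iff_forall_notMem.1 hne) y ⟨hyc, hy⟩
    have hcl : IsClopen K := ⟨isClosed_of_closure_subset hsub, hopen⟩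
    have huniv := hcl.eq_univ ⟨x, mem_connectedComponentIn hxc⟩
    have h0 : p 0 ∈ K := huniv ▸ Set.mem_univ _
    exact (connectedComponentIn_subset _ _ h0) (vertex_mem_curve p 0)
  intro y hy
  by_contra hyK
  have hloc : ∀ q ∈ curve p ∩ closure K, ∃ N, IsOpen N ∧ q ∈ N ∧ N ∩ curve p ⊆ closure K := by
    rintro q ⟨hq, hqK⟩
    obtain ⟨N, S₁, S₂, hN, hqN, h1, h2, h3, h4, h5, h6, h7⟩ := h.locallyTwoSided hq
    refine ⟨N, hN, hqN, ?_⟩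
    obtain ⟨z, hzN, hzK⟩ := mem_closure_iff.1 hqK N hN hqN
    have hzc : z ∉ curve p := connectedComponentIn_subset _ _ hzK
    have hKz : K = connectedComponentIn (curve p)ᶜ z := connectedComponentIn_eq hzK
    rcases h5 ⟨hzN, hzc⟩ with h8 | h8
    · exact h6.trans (closure_mono (hKz ▸ h1.subset_connectedComponentIn h8 h3))
    · exact h7.trans (closure_mono (hKz ▸ h2.subset_connectedComponentIn h8 h4))
  choose! N hN hqN hsub using hloc
  obtain ⟨q, hq⟩ := hmeet
  obtain ⟨z, hzc, hzU, hzV⟩ := isPreconnected_curve p (⋃ q ∈ curve p ∩ closure K, N q)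
    (closure K)ᶜ (isOpen_biUnion fun q hq => hN q hq) isClosed_closure.isOpen_compl
    (by
      intro z hz
      by_cases hzK : z ∈ closure K
      · exact Or.inl (Set.mem_biUnion ⟨hz, hzK⟩ (hqN z ⟨hz, hzK⟩))
      · exact Or.inr hzK)
    ⟨q, hq.1, Set.mem_biUnion hq (hqN q hq)⟩ ⟨y, hy, hyK⟩
  obtain ⟨q', hq', hzN⟩ := Set.mem_iUnion₂.1 hzU
  exact hzV (hsub q' hq' ⟨hzN, hzc⟩)

/-- The complement of a simple closed polygon has at most two components. -/
theorem IsCycle.component_eq (h : IsCycle n p) {x y z : Plane} (hx : x ∉ curve p)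
    (hy : y ∉ curve p) (hz : z ∉ curve p) :
    connectedComponentIn (curve p)ᶜ x = connectedComponentIn (curve p)ᶜ y ∨
    connectedComponentIn (curve p)ᶜ x = connectedComponentIn (curve p)ᶜ z ∨
    connectedComponentIn (curve p)ᶜ y = connectedComponentIn (curve p)ᶜ z := by
  obtain ⟨N, S₁, S₂, hN, hqN, h1, h2, h3, h4, h5, -, -⟩ :=
    h.locallyTwoSided (vertex_mem_curve p 0)
  -- Every component comes near `p 0` and so contains one of the two local sides; two of three
  -- components must share a side.
  have key : ∀ x, x ∉ curve p →
      (∀ w ∈ S₁, connectedComponentIn (curve p)ᶜ x = connectedComponentIn (curve p)ᶜ w) ∧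
        S₁.Nonempty ∨
      (∀ w ∈ S₂, connectedComponentIn (curve p)ᶜ x = connectedComponentIn (curve p)ᶜ w) ∧
        S₂.Nonempty := by
    intro x hx
    obtain ⟨w, hwN, hwK⟩ := mem_closure_iff.1 (h.mem_closure_component hx (vertex_mem_curve p 0))
      N hN hqN
    have hwc : w ∉ curve p := connectedComponentIn_subset _ _ hwK
    have hxw := connectedComponentIn_eq hwK
    rcases h5 ⟨hwN, hwc⟩ with h8 | h8
    · left
      refine ⟨fun w' hw' => ?_, w, h8⟩
      rw [hxw]
      exact connectedComponentIn_eq (h1.subset_connectedComponentIn h8 h3 hw')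
    · right
      refine ⟨fun w' hw' => ?_, w, h8⟩
      rw [hxw]
      exact connectedComponentIn_eq (h2.subset_connectedComponentIn h8 h4 hw')
  rcases key x hx with ⟨hx, w, hw⟩ | ⟨hx, w, hw⟩ <;> rcases key y hy with ⟨hy, w', hw'⟩ | ⟨hy, w', hw'⟩ <;>
    rcases key z hz with ⟨hz, -⟩ | ⟨hz, -⟩
  · exact Or.inl ((hx w hw).trans (hy w hw).symm)
  · exact Or.inl ((hx w hw).trans (hy w hw).symm)
  · exact Or.inr (Or.inl ((hx w hw).trans (hz w hw).symm))
  · exact Or.inr (Or.inr ((hy w' hw').trans (hz w' hw').symm))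
  · exact Or.inr (Or.inr ((hy w' hw').trans (hz w' hw').symm))
  · exact Or.inr (Or.inl ((hx w hw).trans (hz w hw).symm))
  · exact Or.inl ((hx w hw).trans (hy w hw).symm)
  · exact Or.inl ((hx w hw).trans (hy w hw).symm)

end PlanePolygon

namespace PlanePolygon

open Filter Topology

/-! ## Good index sets -/

/-- The chords with ends `i`, `j` and `k`, `l` separate each other on the cycle. -/
def Interleaved (i j k l : ℕ) : Prop :=
  min i j < k ∧ k < max i j ∧ (l < min i j ∨ max i j < l)

/-- Cyclic distance of two indices below `n`. -/
def cycDist (n i j : ℕ) : ℕ := min (i - j + (j - i)) (n - (i - j + (j - i)))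

/-- A shared index gives distance 0. Otherwise noninterleaving puts all of `u, v, w` in one gap of
`i, j, k`. The two stretches of the cycle between the triples have total length at most `n - 4`, as
each triple spans at least two edges; the shorter stretch is the one wanted. -/
theorem exists_close_of_triples {n i j k u v w : ℕ} (hij : i < j) (hjk : j < k) (hk : k < n)
    (huv : u < v) (hvw : v < w) (hw : w < n) (hn : 4 ≤ n)
    (h : ∀ a ∈ ({i, j, k} : Finset ℕ), ∀ b ∈ ({i, j, k} : Finset ℕ),
      ∀ c ∈ ({u, v, w} : Finset ℕ), ∀ d ∈ ({u, v, w} : Finset ℕ), a ≠ b → c ≠ d →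
        ¬ Interleaved a b c d) :
    ∃ a ∈ ({i, j, k} : Finset ℕ), ∃ c ∈ ({u, v, w} : Finset ℕ), 2 * cycDist n a c + 4 ≤ n := by
  by_contra! hcon
  simp only [Finset.mem_insert, Finset.mem_singleton, forall_eq_or_imp, forall_eq] at hcon
  unfold cycDist at hcon
  have hreg : ∀ c ∈ ({u, v, w} : Finset ℕ), ∀ d ∈ ({u, v, w} : Finset ℕ), c ≠ d →
      (i < c → c < j → i ≤ d ∧ d ≤ j) ∧ (j < c → c < k → j ≤ d ∧ d ≤ k) := by
    intro c hc d hd hcd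
    have h1 := h i (by simp) j (by simp) c hc d hd (by omega) hcd
    have h2 := h j (by simp) k (by simp) c hc d hd (by omega) hcd
    unfold Interleaved at h1 h2
    omega
  have huv' := hreg u (by simp) v (by simp) (by omega)
  have huw' := hreg u (by simp) w (by simp) (by omega)
  have hvu' := hreg v (by simp) u (by simp) (by omega)
  have hvw' := hreg v (by simp) w (by simp) (by omega)
  have hwu' := hreg w (by simp) u (by simp) (by omega)
  have hwv' := hreg w (by simp) v (by simp) (by omega)
  obtain ⟨⟨h1, h2, h3⟩, ⟨h4, h5, h6⟩, h7, h8, h9⟩ := hcon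
  have hne : i ≠ u ∧ i ≠ v ∧ i ≠ w ∧ j ≠ u ∧ j ≠ v ∧ j ≠ w ∧ k ≠ u ∧ k ≠ v ∧ k ≠ w := by
    refine ⟨?_, ?_, ?_, ?_, ?_, ?_, ?_, ?_, ?_⟩ <;> rintro rfl <;> omega
  clear h hreg
  -- The cases say which gap contains `u, v, w` and, for the gap through 0, where that triple wraps
  -- around. In each case only the distances across the two stretches between the triples are kept.
  rcases lt_or_gt_of_ne hne.1 with hu | hu
  · rcases lt_or_gt_of_ne hne.2.2.2.1.symm with hu' | hu'
    · clear h2 h4 h5 h7 h8 h9 h3; omega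
    · rcases lt_or_gt_of_ne hne.2.2.2.2.2.2.1.symm with hu'' | hu''
      · clear h1 h2 h3 h5 h6 h7 h8; omega
      · clear h1 h2 h4 h5 h6 h8 h9; omega
  · rcases lt_or_gt_of_ne hne.2.1 with hv | hv
    · have : k < v := by omega
      clear h2 h3 h4 h5 h6 h7 h9; omega
    · rcases lt_or_gt_of_ne hne.2.2.1 with hw' | hw'
      · have : k < w := by omega
        clear h1 h3 h4 h5 h6 h7 h8; omega
      · clear h1 h2 h4 h5 h6 h8 h9; omega

/-- As for two triples, but the pair spans only one edge at least, so the two stretches have total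
length at most `n - 3`. -/
theorem exists_close_of_triple_pair {n i j k u v : ℕ} (hij : i < j) (hjk : j < k) (hk : k < n)
    (huv : u < v) (hv : v < n)
    (h : ∀ a ∈ ({i, j, k} : Finset ℕ), ∀ b ∈ ({i, j, k} : Finset ℕ),
      ∀ c ∈ ({u, v} : Finset ℕ), ∀ d ∈ ({u, v} : Finset ℕ), a ≠ b → c ≠ d →
        ¬ Interleaved a b c d) :
    ∃ a ∈ ({i, j, k} : Finset ℕ), ∃ c ∈ ({u, v} : Finset ℕ), 2 * cycDist n a c + 3 ≤ n := by
  by_contra! hcon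
  simp only [Finset.mem_insert, Finset.mem_singleton, forall_eq_or_imp, forall_eq] at hcon
  unfold cycDist at hcon
  have hreg : ∀ c ∈ ({u, v} : Finset ℕ), ∀ d ∈ ({u, v} : Finset ℕ), c ≠ d →
      (i < c → c < j → i ≤ d ∧ d ≤ j) ∧ (j < c → c < k → j ≤ d ∧ d ≤ k) := by
    intro c hc d hd hcd
    have h1 := h i (by simp) j (by simp) c hc d hd (by omega) hcd
    have h2 := h j (by simp) k (by simp) c hc d hd (by omega) hcd
    unfold Interleaved at h1 h2
    omega
  have huv' := hreg u (by simp) v (by simp) (by omega)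
  have hvu' := hreg v (by simp) u (by simp) (by omega)
  obtain ⟨⟨h1, h2⟩, ⟨h4, h5⟩, h7, h8⟩ := hcon
  have hne : i ≠ u ∧ i ≠ v ∧ j ≠ u ∧ j ≠ v ∧ k ≠ u ∧ k ≠ v := by
    refine ⟨?_, ?_, ?_, ?_, ?_, ?_⟩ <;> rintro rfl <;> omega
  clear h hreg
  omega

theorem exists_sorted_three {I : Finset ℕ} (hI : I.card = 3) :
    ∃ i j k, i < j ∧ j < k ∧ I = {i, j, k} := by
  refine ⟨I.orderEmbOfFin hI 0, I.orderEmbOfFin hI 1, I.orderEmbOfFin hI 2, by simp, by simp, ?_⟩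
  ext x
  rw [← Finset.mem_coe, ← Finset.range_orderEmbOfFin I hI]
  simp only [Set.mem_range, Fin.exists_fin_succ, Finset.mem_insert, Finset.mem_singleton]
  simp [eq_comm]

theorem exists_sorted_two {I : Finset ℕ} (hI : I.card = 2) :
    ∃ i j, i < j ∧ I = {i, j} := by
  obtain ⟨x, y, hxy, rfl⟩ := Finset.card_eq_two.1 hI
  rcases lt_or_gt_of_ne hxy with h | h
  · exact ⟨x, y, h, rfl⟩
  · exact ⟨y, x, h, Finset.pair_comm _ _⟩

theorem exists_close_three_three {n : ℕ} (hn : 4 ≤ n) {I U : Finset ℕ} (hI : I.card = 3)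
    (hU : U.card = 3) (hIn : ∀ i ∈ I, i < n) (hUn : ∀ i ∈ U, i < n)
    (h : ∀ a ∈ I, ∀ b ∈ I, ∀ c ∈ U, ∀ d ∈ U, a ≠ b → c ≠ d → ¬ Interleaved a b c d) :
    ∃ a ∈ I, ∃ c ∈ U, 2 * cycDist n a c + 4 ≤ n := by
  obtain ⟨i, j, k, h1, h2, rfl⟩ := exists_sorted_three hI
  obtain ⟨u, v, w, h3, h4, rfl⟩ := exists_sorted_three hU
  exact exists_close_of_triples h1 h2 (hIn k (by simp)) h3 h4 (hUn w (by simp)) hn h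

theorem exists_close_three_two {n : ℕ} {I U : Finset ℕ} (hI : I.card = 3)
    (hU : U.card = 2) (hIn : ∀ i ∈ I, i < n) (hUn : ∀ i ∈ U, i < n)
    (h : ∀ a ∈ I, ∀ b ∈ I, ∀ c ∈ U, ∀ d ∈ U, a ≠ b → c ≠ d → ¬ Interleaved a b c d) :
    ∃ a ∈ I, ∃ c ∈ U, 2 * cycDist n a c + 3 ≤ n := by
  obtain ⟨i, j, k, h1, h2, rfl⟩ := exists_sorted_three hI
  obtain ⟨u, v, h3, rfl⟩ := exists_sorted_two hU
  exact exists_close_of_triple_pair h1 h2 (hIn k (by simp)) h3 (hUn v (by simp)) h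

/-! ### Chords in one component do not interleave -/

variable {n : ℕ} {p : ℕ → Plane}

/-- The chord from `p i` to `p j` is an edge, or avoids the curve and meets the set `K`. -/
def GoodChord (p : ℕ → Plane) (K : Set Plane) (A B : Plane) : Prop :=
  (∃ k, (A, B) = (p k, p (k + 1)) ∨ (B, A) = (p k, p (k + 1))) ∨
    ((∀ z ∈ openSegment ℝ A B, z ∉ curve p) ∧ ∃ m ∈ openSegment ℝ A B, m ∈ K)

theorem GoodChord.symm {K : Set Plane} {A B : Plane} (h : GoodChord p K A B) :
    GoodChord p K B A := by
  rcases h with ⟨k, h⟩ | h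
  · exact Or.inl ⟨k, h.symm⟩
  · right; rwa [openSegment_symm]

/-- The indices of the ends of an edge are `i` and `i + 1`, or `n - 1` and 0. No index is strictly
between them, or none is outside, so an edge separates nothing. -/
theorem IsCycle.not_interleaved_edge (h : IsCycle n p) {i j k l r : ℕ} (hi : i < n) (hj : j < n)
    (hk : k < n) (hl : l < n) (hr : (p i, p j) = (p r, p (r + 1))) :
    ¬ Interleaved i j k l ∧ ¬ Interleaved j i k l ∧ ¬ Interleaved k l i j ∧
      ¬ Interleaved k l j i := by
  rw [Prod.mk.injEq, h.eq_iff, h.eq_iff] at hr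
  have h1 : j ≡ i + 1 [MOD n] := hr.2.trans (hr.1.symm.add_right 1)
  have h2 : j = i + 1 ∨ (j = 0 ∧ i + 1 = n) := by
    rcases (by omega : i + 1 < n ∨ i + 1 = n) with h3 | h3
    · left; exact Nat.ModEq.eq_of_lt_of_lt h1 hj h3
    · right
      refine ⟨?_, h3⟩
      rw [h3] at h1
      exact Nat.ModEq.eq_of_lt_of_lt (h1.trans (by simp [Nat.ModEq])) hj (by omega)
  unfold Interleaved
  omega

theorem IsCycle.not_interleaved_aux (h : IsCycle n p) {i j k l : ℕ} (hj : j < n)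
    (hik : i < k) (hkj : k < j) (hl : l < n) (hlij : l < i ∨ j < l)
    (hd : ∀ x ∈ openSegment ℝ (p i) (p j), x ∉ curve p)
    (he : ∀ x ∈ openSegment ℝ (p k) (p l), x ∉ curve p)
    (hde : ∀ x ∈ openSegment ℝ (p i) (p j), x ∉ openSegment ℝ (p k) (p l))
    {S : Set Plane} (hS : IsPreconnected S) (hSc : ∀ x ∈ S, x ∉ curve p) {m m' : Plane}
    (hm : m ∈ S) (hm' : m' ∈ S) (hmd : m ∈ openSegment ℝ (p i) (p j))
    (hme : m' ∈ openSegment ℝ (p k) (p l)) : False := by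
  rcases hlij with h1 | h1
  · rw [← h.period l] at he hde hme
    exact h.not_crossing hik hkj (by omega) (by omega) hd he hde hS hSc hm hm' hmd hme
  · exact h.not_crossing hik hkj h1 (by omega) hd he hde hS hSc hm hm' hmd hme

/-- Edges never interleave with anything. Two proper diagonals that meet have the same ends by
`hdisj`, which the strict inequalities exclude; disjoint ones reaching the same component fall under
`IsCycle.not_crossing`. -/
theorem IsCycle.not_interleaved (h : IsCycle n p) {i j k l : ℕ} (hi : i < n) (hj : j < n)
    (hk : k < n) (hl : l < n) {K : Set Plane} (hK : IsPreconnected K)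
    (hKc : ∀ x ∈ K, x ∉ curve p) (h1 : GoodChord p K (p i) (p j))
    (h2 : GoodChord p K (p k) (p l))
    (hdisj : ∀ z, z ∈ openSegment ℝ (p i) (p j) → z ∈ openSegment ℝ (p k) (p l) →
      (p i, p j) = (p k, p l) ∨ (p i, p j) = (p l, p k)) : ¬ Interleaved i j k l := by
  rcases h1 with ⟨r, hr | hr⟩ | ⟨hd, m, hmd, hmK⟩
  · exact (h.not_interleaved_edge hi hj hk hl hr).1
  · exact (h.not_interleaved_edge hj hi hk hl hr).2.1
  rcases h2 with ⟨r, hr | hr⟩ | ⟨he, m', hme, hmK'⟩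
  · exact (h.not_interleaved_edge hk hl hi hj hr).2.2.1
  · exact (h.not_interleaved_edge hl hk hi hj hr).2.2.2
  intro hint
  have heq : ∀ {a b}, a < n → b < n → p a = p b → a = b := fun ha hb hab =>
    Nat.ModEq.eq_of_lt_of_lt (h.inj _ _ hab) ha hb
  unfold Interleaved at hint
  have hde : ∀ x ∈ openSegment ℝ (p i) (p j), x ∉ openSegment ℝ (p k) (p l) := by
    intro z hz hz'
    rcases hdisj z hz hz' with h3 | h3 <;> rw [Prod.mk.injEq] at h3
    · have h4 := heq hi hk h3.1
      have h5 := heq hj hl h3.2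
      omega
    · have h4 := heq hi hl h3.1
      have h5 := heq hj hk h3.2
      omega
  rcases lt_or_ge i j with hij | hij
  · rw [min_eq_left hij.le, max_eq_right hij.le] at hint
    exact h.not_interleaved_aux hj hint.1 hint.2.1 hl hint.2.2 hd he hde hK hKc hmK hmK'
      hmd hme
  · rw [min_eq_right hij, max_eq_left hij] at hint
    rw [openSegment_symm] at hd hde hmd
    exact h.not_interleaved_aux hi hint.1 hint.2.1 hl hint.2.2 hd he hde hK hKc hmK hmK'
      hmd hme

/-! ### Seen vertices and the chords between them -/

section Chords

variable {G : Set (Plane × Plane)} {A B C a : Plane}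

theorem IsSide.free_or_edge (hG : edges p ⊆ G) (hs : IsSide G A B) :
    (∃ k, (A, B) = (p k, p (k + 1)) ∨ (B, A) = (p k, p (k + 1))) ∨
      ∀ z ∈ openSegment ℝ A B, z ∉ curve p := by
  by_cases hc : ∀ z ∈ openSegment ℝ A B, z ∉ curve p
  · exact Or.inr hc
  push Not at hc
  obtain ⟨z, hz, hzc⟩ := hc
  obtain ⟨k, hk⟩ := Set.mem_iUnion.1 hzc
  rcases hs (p k, p (k + 1)) (hG ⟨k, rfl⟩) z hz hk with h1 | h1
  · exact Or.inl ⟨k, Or.inl h1.symm⟩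
  · exact Or.inl ⟨k, Or.inr h1.symm⟩

theorem IsSide.free (hG : edges p ⊆ G) (hs : IsSide G A B) (ha : a ∈ openSegment ℝ A B)
    (hac : a ∉ curve p) : ∀ z ∈ openSegment ℝ A B, z ∉ curve p := by
  rcases hs.free_or_edge hG with ⟨k, h1 | h1⟩ | h1
  · rw [Prod.mk.injEq] at h1
    rw [h1.1, h1.2] at ha
    exact absurd (edge_subset_curve p k (openSegment_subset_segment _ _ _ ha)) hac
  · rw [Prod.mk.injEq] at h1
    rw [h1.1, h1.2, openSegment_symm] at ha
    exact absurd (edge_subset_curve p k (openSegment_subset_segment _ _ _ ha)) hac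
  · exact h1

theorem IsEmptyTriangle.interior_notMem (hG : edges p ⊆ G)
    (hT : IsEmptyTriangle (Set.range p) G A B C) {x y z : ℝ} (hx : 0 < x) (hy : 0 < y)
    (hz : 0 < z) (hs : x + y + z = 1) : x • A + y • B + z • C ∉ curve p := by
  intro hc
  obtain ⟨k, hk⟩ := Set.mem_iUnion.1 hc
  exact hT.interior x y z hx hy hz hs _ (hG ⟨k, rfl⟩) hk

theorem mem_convexHull_triple (ha : a ∈ convexHull ℝ {A, B, C}) :
    ∃ x y z : ℝ, 0 ≤ x ∧ 0 ≤ y ∧ 0 ≤ z ∧ x + y + z = 1 ∧ x • A + y • B + z • C = a := by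
  rw [convexHull_insert (by simp), convexHull_pair] at ha
  simp only [convexJoin_singleton_left, Set.mem_iUnion] at ha
  obtain ⟨w, ⟨β, γ, hβ, hγ, hβγ, rfl⟩, α, δ, hα, hδ, hαδ, rfl⟩ := ha
  refine ⟨α, δ * β, δ * γ, hα, by positivity, by positivity, ?_, ?_⟩
  · linear_combination hαδ + δ * hβγ
  · module

theorem convexHull_rotate : convexHull ℝ ({B, C, A} : Set Plane) = convexHull ℝ {A, B, C} := by
  congr 1
  ext x; simp; tauto

/-- The points of `]a, A[` are inside the triangle, or they are on the same side as `a`. A side that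
contains the point `a` off the curve is no edge, and then the curve misses its interior. -/
theorem IsEmptyTriangle.sees (hG : edges p ⊆ G)
    (hT : IsEmptyTriangle (Set.range p) G A B C) (ha : a ∈ convexHull ℝ {A, B, C})
    (hac : a ∉ curve p) : ∀ z ∈ openSegment ℝ a A, z ∉ curve p := by
  obtain ⟨x, y, z, hx, hy, hz, hs, rfl⟩ := mem_convexHull_triple ha
  have hV : ∀ X ∈ Set.range p, X ∈ curve p := by
    rintro _ ⟨k, rfl⟩; exact vertex_mem_curve p k
  rintro _ ⟨c, d, hc, hd, hcd, rfl⟩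
  have hw : c • (x • A + y • B + z • C) + d • A = (c * x + d) • A + (c * y) • B + (c * z) • C := by
    module
  rcases hy.eq_or_lt with rfl | hy
  · rcases hz.eq_or_lt with rfl | hz
    · obtain rfl : x = 1 := by linarith
      simp only [one_smul, zero_smul, add_zero] at hac
      exact absurd (hV A hT.memA) hac
    · rcases hx.eq_or_lt with rfl | hx
      · obtain rfl : z = 1 := by linarith
        simp only [one_smul, zero_smul, zero_add] at hac
        exact absurd (hV C hT.memC) hac
      · refine hT.sideCA.free hG (a := x • A + (0 : ℝ) • B + z • C)
          ⟨z, x, hz, hx, by linarith, by module⟩ hac _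
          ⟨c * z, c * x + d, by positivity, by positivity, ?_, by rw [hw]; module⟩
        linear_combination c * hs + hcd
  · rcases hz.eq_or_lt with rfl | hz
    · rcases hx.eq_or_lt with rfl | hx
      · obtain rfl : y = 1 := by linarith
        simp only [one_smul, zero_smul, zero_add, add_zero] at hac
        exact absurd (hV B hT.memB) hac
      · refine hT.sideAB.free hG (a := x • A + y • B + (0 : ℝ) • C)
          ⟨x, y, hx, hy, by linarith, by module⟩ hac _
          ⟨c * x + d, c * y, by positivity, by positivity, ?_, by rw [hw]; module⟩
        linear_combination c * hs + hcd
    · rw [hw]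
      exact hT.interior_notMem hG (by positivity) (by positivity) (by positivity)
        (by linear_combination c * hs + hcd)

/-- If the side is not an edge, the segment from `a` to its midpoint stays off the curve, and the
chord meets the component of `a` there. -/
theorem IsEmptyTriangle.goodChord (hG : edges p ⊆ G)
    (hT : IsEmptyTriangle (Set.range p) G A B C) (ha : a ∈ convexHull ℝ {A, B, C})
    (hac : a ∉ curve p) : GoodChord p (connectedComponentIn (curve p)ᶜ a) A B := by
  rcases hT.sideAB.free_or_edge hG with h1 | h1
  · exact Or.inl h1
  refine Or.inr ⟨h1, ?_⟩
  obtain ⟨x, y, z, hx, hy, hz, hs, rfl⟩ := mem_convexHull_triple ha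
  have hm : (1 / 2 : ℝ) • A + (1 / 2 : ℝ) • B ∈ openSegment ℝ A B :=
    ⟨1 / 2, 1 / 2, by norm_num, by norm_num, by norm_num, rfl⟩
  refine ⟨_, hm, ?_⟩
  refine (convex_segment (x • A + y • B + z • C)
    ((1 / 2 : ℝ) • A + (1 / 2 : ℝ) • B)).isPreconnected.subset_connectedComponentIn
    (left_mem_segment ..) ?_ (right_mem_segment ..)
  intro q hq
  rcases mem_segment_iff_open hq with rfl | rfl | ⟨c, d, hc, hd, hcd, rfl⟩
  · exact hac
  · exact h1 _ hm
  have hw : c • (x • A + y • B + z • C) + d • ((1 / 2 : ℝ) • A + (1 / 2 : ℝ) • B) =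
      (c * x + d / 2) • A + (c * y + d / 2) • B + (c * z) • C := by
    module
  rw [hw]
  rcases hz.eq_or_lt with rfl | hz
  · refine h1 _ ⟨c * x + d / 2, c * y + d / 2, by positivity, by positivity, ?_, by module⟩
    linear_combination c * hs + hcd
  · exact hT.interior_notMem hG (by positivity) (by positivity) (by positivity)
        (by linear_combination c * hs + hcd)

/-- The chords in `U`, seen from `a`, relative to a family `G`. -/
structure IsGoodIndexSet (n : ℕ) (p : ℕ → Plane) (G : Set (Plane × Plane)) (a : Plane)
    (I : Finset ℕ) : Prop where
  lt : ∀ i ∈ I, i < n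
  sees : ∀ i ∈ I, ∀ z ∈ openSegment ℝ a (p i), z ∉ curve p
  good : ∀ i ∈ I, ∀ j ∈ I, i ≠ j → GoodChord p (connectedComponentIn (curve p)ᶜ a) (p i) (p j)
  side : ∀ i ∈ I, ∀ j ∈ I, i ≠ j → IsSide G (p i) (p j)

theorem IsCycle.exists_index (h : IsCycle n p) {X : Plane} (hX : X ∈ Set.range p) :
    ∃ i < n, p i = X := by
  obtain ⟨k, rfl⟩ := hX
  exact ⟨k % n, Nat.mod_lt _ (by have := h.three_le; omega), h.modEq (Nat.mod_modEq k n)⟩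

theorem IsCycle.exists_goodIndexSet_three (h : IsCycle n p) (hG : edges p ⊆ G)
    (hGp : IsPlanarFamily (Set.range p) G) (ha : a ∈ convexHull ℝ (Set.range p))
    (hac : a ∉ curve p) :
    ∃ (I : Finset ℕ) (G' : Set (Plane × Plane)), I.card = 3 ∧ IsGoodIndexSet n p G a I ∧ G ⊆ G' ∧
      IsPlanarFamily (Set.range p) G' ∧
      ∀ i ∈ I, ∀ j ∈ I, i ≠ j → (p i, p j) ∈ G' ∨ (p j, p i) ∈ G' := by
  obtain ⟨A, B, C, hT, haT⟩ := exists_isEmptyTriangle h.finite_range h.nontrivial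
    h.interior_nonempty hGp ha
  obtain ⟨i, hi, hiA⟩ := h.exists_index hT.memA
  obtain ⟨j, hj, hjB⟩ := h.exists_index hT.memB
  obtain ⟨k, hk, hkC⟩ := h.exists_index hT.memC
  have hAB := ne_of_area_ne hT.area_ne
  have hBC := ne_of_area_ne hT.rotate.area_ne
  have hCA := ne_of_area_ne hT.rotate.rotate.area_ne
  have haT' : a ∈ convexHull ℝ {B, C, A} := by rwa [convexHull_rotate]
  have haT'' : a ∈ convexHull ℝ {C, A, B} := by rwa [convexHull_rotate]
  -- The enlarged family records the three sides, so that any triangle chosen later respects them.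
  refine ⟨{i, j, k}, G ∪ {(A, B), (B, C), (C, A)}, ?_, ⟨?_, ?_, ?_, ?_⟩, Set.subset_union_left,
    hT.extend hGp, ?_⟩
  · rw [Finset.card_eq_three]
    refine ⟨i, j, k, ?_, ?_, ?_, rfl⟩ <;> rintro rfl
    exacts [hAB (hiA ▸ hjB), hCA (hkC ▸ hiA), hBC (hjB ▸ hkC)]
  · simp only [Finset.mem_insert, Finset.mem_singleton, forall_eq_or_imp, forall_eq]
    exact ⟨hi, hj, hk⟩
  · simp only [Finset.mem_insert, Finset.mem_singleton, forall_eq_or_imp, forall_eq]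
    rw [hiA, hjB, hkC]
    exact ⟨hT.sees hG haT hac, hT.rotate.sees hG haT' hac, hT.rotate.rotate.sees hG haT'' hac⟩
  · have h1 := hT.goodChord hG haT hac
    have h2 := hT.rotate.goodChord hG haT' hac
    have h3 := hT.rotate.rotate.goodChord hG haT'' hac
    simp only [Finset.mem_insert, Finset.mem_singleton, forall_eq_or_imp, forall_eq]
    rw [hiA, hjB, hkC]
    exact ⟨⟨fun h => absurd rfl h, fun _ => h1, fun _ => h3.symm⟩,
      ⟨fun _ => h1.symm, fun h => absurd rfl h, fun _ => h2⟩,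
      ⟨fun _ => h3, fun _ => h2.symm, fun h => absurd rfl h⟩⟩
  · simp only [Finset.mem_insert, Finset.mem_singleton, forall_eq_or_imp, forall_eq]
    rw [hiA, hjB, hkC]
    exact ⟨⟨fun h => absurd rfl h, fun _ => hT.sideAB, fun _ => hT.sideCA.symm⟩,
      ⟨fun _ => hT.sideAB.symm, fun h => absurd rfl h, fun _ => hT.sideBC⟩,
      ⟨fun _ => hT.sideCA, fun _ => hT.sideBC.symm, fun h => absurd rfl h⟩⟩
  · simp only [Finset.mem_insert, Finset.mem_singleton, forall_eq_or_imp, forall_eq]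
    rw [hiA, hjB, hkC]
    refine ⟨⟨fun h => absurd rfl h, fun _ => ?_, fun _ => ?_⟩,
      ⟨fun _ => ?_, fun h => absurd rfl h, fun _ => ?_⟩,
      ⟨fun _ => ?_, fun _ => ?_, fun h => absurd rfl h⟩⟩ <;> simp

/-- A point outside the convex hull sees both ends of a chord on the boundary of the hull. -/
theorem IsCycle.exists_goodIndexSet_two (h : IsCycle n p) (hG : edges p ⊆ G)
    (hGp : IsPlanarFamily (Set.range p) G) (ha : a ∉ convexHull ℝ (Set.range p)) :
    ∃ I : Finset ℕ, I.card = 2 ∧ IsGoodIndexSet n p G a I := by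
  set H := convexHull ℝ (Set.range p) with hH
  have hHc : IsCompact H := h.finite_range.isCompact_convexHull ℝ
  have hHconv : Convex ℝ H := convex_convexHull ℝ _
  have hVH : ∀ k, p k ∈ H := fun k => subset_convexHull ℝ _ ⟨k, rfl⟩
  -- `c` is chosen so that the line from `c` to `a` passes through no vertex; the point `q` where it
  -- leaves the hull is then inside a hull side.
  obtain ⟨c, hc, hcgen⟩ : ∃ c ∈ interior H, ∀ k, cross (a - c) (p k - c) ≠ 0 := by
    have hd := dense_finite_cross_ne_zero (L := (fun v => (a, v)) '' Set.range p)
      (h.finite_range.image _) (by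
        rintro _ ⟨_, ⟨k, rfl⟩, rfl⟩ (h0 : a = p k)
        exact ha (h0 ▸ hVH k))
    obtain ⟨c, hc, hcd⟩ := hd.inter_open_nonempty _ isOpen_interior h.interior_nonempty
    exact ⟨c, hc, fun k => hcd (a, p k) ⟨p k, ⟨k, rfl⟩, rfl⟩⟩
  obtain ⟨t, ⟨⟨ht0, ht1⟩, htH⟩, htmax⟩ : ∃ t, IsGreatest
      {t : ℝ | t ∈ Set.Icc 0 1 ∧ c + t • (a - c) ∈ H} t := by
    apply IsCompact.exists_isGreatest
    · exact (isCompact_Icc (a := (0 : ℝ)) (b := 1)).inter_right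
        (hHc.isClosed.preimage (f := fun t : ℝ => c + t • (a - c)) (by fun_prop))
    · exact ⟨0, ⟨le_rfl, zero_le_one⟩, by simpa using interior_subset hc⟩
  set q := c + t • (a - c) with hq
  have ht1' : t < 1 := by
    refine lt_of_le_of_ne ht1 fun h0 => ha ?_
    rw [hq, h0, one_smul, add_sub_cancel] at htH
    exact htH
  have hqV : ∀ k, q ≠ p k := by
    intro k hk
    refine hcgen k ?_
    rw [← hk, hq, add_sub_cancel_left, cross_smul_self]
  have hqint : q ∉ interior H := by
    intro h0
    have hcont : ContinuousAt (fun s : ℝ => c + s • (a - c)) t :=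
      Continuous.continuousAt (by fun_prop)
    have h1 := hcont.eventually (isOpen_interior.mem_nhds h0)
    have h2 : ∀ᶠ s in 𝓝[>] t, c + s • (a - c) ∈ interior H := nhdsWithin_le_nhds h1
    obtain ⟨s, h3, h4⟩ := (h2.and (Ioo_mem_nhdsGT ht1')).exists
    have := htmax ⟨⟨ht0.trans h4.1.le, h4.2.le⟩, interior_subset h3⟩
    exact absurd h4.1 (not_lt.2 this)
  -- A supporting line of the hull at `q`. Since `f c < f q`, the point `a` lies strictly beyond it
  -- and sees every point of the line.
  obtain ⟨f, hf⟩ := geometric_hahn_banach_open_point hHconv.interior isOpen_interior hqint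
  have hfH : ∀ y ∈ H, f y ≤ f q := by
    intro y hy
    have h1 : y ∈ closure (interior H) := by
      rw [hHconv.closure_interior_eq_closure_of_nonempty_interior h.interior_nonempty]
      exact subset_closure hy
    exact closure_minimal (fun z hz => (hf z hz).le)
      (isClosed_le f.continuous continuous_const) h1
  have hfc := hf c hc
  have hfa : f q < f a := by
    have h1 : f q = f c + t * (f a - f c) := by
      rw [hq, map_add, map_smul, map_sub, smul_eq_mul]
    have h2 : 0 < t * (f a - f c) := by linarith
    have h3 : 0 < f a - f c := pos_of_mul_pos_right h2 ht0
    nlinarith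
  clear_value q
  have hbeyond : ∀ y, f q < f y → y ∉ curve p := fun y hy hyc =>
    absurd (hfH y (curve_subset_convexHull p hyc)) (not_le.2 hy)
  have hseen : ∀ A, f A = f q → ∀ z ∈ openSegment ℝ a A, z ∉ curve p := by
    rintro A hA _ ⟨x, y, hx, hy, hxy, rfl⟩
    apply hbeyond
    rw [map_add, map_smul, map_smul, hA, smul_eq_mul, smul_eq_mul]
    obtain rfl : y = 1 - x := by linarith
    nlinarith
  have hac : a ∉ curve p := hbeyond a hfa
  -- the case where `q` lies on the side `A B`
  have hside : ∀ {A B C : Plane} {x y : ℝ}, IsEmptyTriangle (Set.range p) G A B C → 0 ≤ x → 0 ≤ y →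
      x + y = 1 → x • A + y • B = q → ∃ I : Finset ℕ, I.card = 2 ∧ IsGoodIndexSet n p G a I := by
    intro A B C x y hT hx hy hxy hqAB
    obtain ⟨i, hi, rfl⟩ := h.exists_index hT.memA
    obtain ⟨j, hj, rfl⟩ := h.exists_index hT.memB
    have hx' : 0 < x := by
      refine lt_of_le_of_ne hx fun h0 => hqV j ?_
      obtain rfl : y = 1 := by linarith
      rw [← hqAB, ← h0, zero_smul, zero_add, one_smul]
    have hy' : 0 < y := by
      refine lt_of_le_of_ne hy fun h0 => hqV i ?_
      obtain rfl : x = 1 := by linarith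
      rw [← hqAB, ← h0, zero_smul, add_zero, one_smul]
    have hfq : x * f (p i) + y * f (p j) = f q := by
      rw [← hqAB, map_add, map_smul, map_smul, smul_eq_mul, smul_eq_mul]
    obtain ⟨h1, h2⟩ := eq_zero_of_pos_comb hx' hy' (sub_nonpos.2 (hfH _ (hVH i)))
      (sub_nonpos.2 (hfH _ (hVH j))) (by linear_combination hfq - f q * hxy)
    have hij : i ≠ j := by rintro rfl; exact ne_of_area_ne hT.area_ne rfl
    have hqo : q ∈ openSegment ℝ (p i) (p j) := ⟨x, y, hx', hy', hxy, hqAB⟩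
    have hgood : GoodChord p (connectedComponentIn (curve p)ᶜ a) (p i) (p j) := by
      rcases hT.sideAB.free_or_edge hG with h3 | h3
      · exact Or.inl h3
      refine Or.inr ⟨h3, q, hqo, ?_⟩
      refine (convex_segment a q).isPreconnected.subset_connectedComponentIn
        (left_mem_segment ..) ?_ (right_mem_segment ..)
      intro z hz
      rcases mem_segment_iff_open hz with rfl | rfl | hz
      exacts [hac, h3 _ hqo, hseen q rfl z hz]
    refine ⟨{i, j}, Finset.card_pair hij, ?_, ?_, ?_, ?_⟩ <;>
      simp only [Finset.mem_insert, Finset.mem_singleton, forall_eq_or_imp, forall_eq]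
    · exact ⟨hi, hj⟩
    · exact ⟨hseen _ (by linarith), hseen _ (by linarith)⟩
    · exact ⟨⟨fun h => absurd rfl h, fun _ => hgood⟩, fun _ => hgood.symm, fun h => absurd rfl h⟩
    · exact ⟨⟨fun h => absurd rfl h, fun _ => hT.sideAB⟩, fun _ => hT.sideAB.symm,
        fun h => absurd rfl h⟩
  obtain ⟨A, B, C, hT, hqT⟩ := exists_isEmptyTriangle h.finite_range h.nontrivial
    h.interior_nonempty hGp htH
  obtain ⟨x, y, z, hx, hy, hz, hs, hxyz⟩ := mem_convexHull_triple hqT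
  rcases hz.eq_or_lt with hz0 | hz'
  · exact hside hT hx hy (by linarith) (by rw [← hxyz, ← hz0]; module)
  rcases hx.eq_or_lt with hx0 | hx'
  · exact hside hT.rotate hy hz (by linarith) (by rw [← hxyz, ← hx0]; module)
  rcases hy.eq_or_lt with hy0 | hy'
  · exact hside hT.rotate.rotate hz hx (by linarith) (by rw [← hxyz, ← hy0]; module)
  -- If `q` were inside the triangle, `f` would take its maximum at all three corners. The triangle
  -- is nondegenerate, so `f` would be constant, against `f c < f q`.
  exfalso
  have hA : f A ≤ f q := by obtain ⟨k, rfl⟩ := hT.memA; exact hfH _ (hVH k)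
  have hB : f B ≤ f q := by obtain ⟨k, rfl⟩ := hT.memB; exact hfH _ (hVH k)
  have hC : f C ≤ f q := by obtain ⟨k, rfl⟩ := hT.memC; exact hfH _ (hVH k)
  have hfq : x * f A + y * f B + z * f C = f q := by
    rw [← hxyz]; simp only [map_add, map_smul, smul_eq_mul]
  have m1 := mul_nonneg hx (sub_nonneg.2 hA)
  have m2 := mul_nonneg hy (sub_nonneg.2 hB)
  have m3 := mul_nonneg hz (sub_nonneg.2 hC)
  have hsum : x * (f q - f A) + y * (f q - f B) + z * (f q - f C) = 0 := by
    linear_combination f q * hs - hfq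
  have e1 : f q - f A = 0 := (mul_eq_zero.1 (by linarith : x * (f q - f A) = 0)).resolve_left hx'.ne'
  have e2 : f q - f B = 0 := (mul_eq_zero.1 (by linarith : y * (f q - f B) = 0)).resolve_left hy'.ne'
  have e3 : f q - f C = 0 := (mul_eq_zero.1 (by linarith : z * (f q - f C) = 0)).resolve_left hz'.ne'
  obtain ⟨s, t', hst, -⟩ := exists_coords hT.area_ne
  have h0 := hst (c - q)
  have h1 : f (c - q) = 0 := by
    rw [h0, map_add, map_smul, map_smul, map_sub f B A, map_sub f C A,
      show f B - f A = 0 by linarith, show f C - f A = 0 by linarith]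
    simp
  rw [map_sub] at h1
  linarith

end Chords

end PlanePolygon

namespace PlanePolygon

open Filter Topology

/-! ## Visible vertices of simple closed polygons -/

variable {n : ℕ} {p : ℕ → Plane} {a b x y : Plane}

/-! ### The unbounded component -/

/-- A point outside the hull is separated from the curve by a line. -/
theorem IsCycle.exists_separating (h : IsCycle n p) (hx : x ∉ convexHull ℝ (Set.range p)) :
    ∃ (f : StrongDual ℝ Plane) (u : ℝ), (∀ y ∈ curve p, f y < u) ∧ u < f x := by
  obtain ⟨f, u, h1, h2⟩ := geometric_hahn_banach_closed_point (convex_convexHull ℝ (Set.range p))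
    (h.finite_range.isCompact_convexHull ℝ).isClosed hx
  exact ⟨f, u, fun y hy => h1 y (curve_subset_convexHull p hy), h2⟩

/-- A point outside the hull has a half-plane around it that misses the curve, and this half-plane
is part of its component. -/
theorem IsCycle.not_isBounded_component (h : IsCycle n p)
    (hx : x ∉ convexHull ℝ (Set.range p)) :
    ¬ Bornology.IsBounded (connectedComponentIn (curve p)ᶜ x) := by
  obtain ⟨f, u, h1, h2⟩ := h.exists_separating hx
  have h0 : f (p 0) < f x := (h1 _ (vertex_mem_curve p 0)).trans h2
  have hsub : {y | u < f y} ⊆ connectedComponentIn (curve p)ᶜ x :=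
    (convex_halfSpace_gt f.isLinear u).isPreconnected.subset_connectedComponentIn h2
      fun y hy hyc => (h1 y hyc).not_gt hy
  intro hb
  obtain ⟨C, hC⟩ := hb.exists_norm_le
  obtain ⟨t, ht⟩ := exists_nat_gt ((‖f‖ * C - f x) / (f x - f (p 0)))
  rw [div_lt_iff₀ (sub_pos.2 h0)] at ht
  have h3 : f (x + (t : ℝ) • (x - p 0)) = f x + t * (f x - f (p 0)) := by simp
  have h4 : 0 ≤ (t : ℝ) * (f x - f (p 0)) := mul_nonneg t.cast_nonneg (sub_pos.2 h0).le
  have h5 := hC _ (hsub (show u < f (x + (t : ℝ) • (x - p 0)) by rw [h3]; linarith))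
  have h6 := (le_abs_self _).trans (f.le_opNorm (x + (t : ℝ) • (x - p 0)))
  have h7 := mul_le_mul_of_nonneg_left h5 (norm_nonneg f)
  linarith

theorem isPreconnected_norm_gt (r : ℝ) : IsPreconnected {y : Plane | r < ‖y‖} := by
  rcases lt_or_ge r 0 with hr | hr
  · have : {y : Plane | r < ‖y‖} = Set.univ := Set.eq_univ_of_forall fun y => hr.trans_le
      (norm_nonneg y)
    rw [this]
    exact isPreconnected_univ
  have hs : IsPreconnected (Metric.sphere (0 : Plane) 1) :=
    isPreconnected_sphere (by rw [← Module.finrank_eq_rank]; simp) 0 1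
  have h := (isPreconnected_Ioi.prod hs).image (fun q : ℝ × Plane => q.1 • q.2)
    (s := Set.Ioi r ×ˢ Metric.sphere (0 : Plane) 1) (by fun_prop)
  convert h using 1
  ext y
  simp only [Set.mem_ofPred_eq, Set.mem_image, Set.mem_prod, Set.mem_Ioi, Prod.exists,
    mem_sphere_zero_iff_norm]
  constructor
  · intro hy
    have h0 : ‖y‖ ≠ 0 := (hr.trans_lt hy).ne'
    exact ⟨‖y‖, ‖y‖⁻¹ • y, ⟨hy, by rw [norm_smul, norm_inv, norm_norm, inv_mul_cancel₀ h0]⟩,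
      smul_inv_smul₀ h0 y⟩
  · rintro ⟨t, z, ⟨ht, hz⟩, rfl⟩
    rw [norm_smul, hz, mul_one]
    exact ht.trans_le (le_abs_self t)

/-- Every unbounded component meets the complement of a large disc around the curve, and that
complement is connected. -/
theorem IsCycle.component_eq_of_not_isBounded (h : IsCycle n p)
    (hx : ¬ Bornology.IsBounded (connectedComponentIn (curve p)ᶜ x))
    (hy : ¬ Bornology.IsBounded (connectedComponentIn (curve p)ᶜ y)) :
    connectedComponentIn (curve p)ᶜ x = connectedComponentIn (curve p)ᶜ y := by
  obtain ⟨r, hr⟩ := h.isCompact_curve.isBounded.exists_norm_le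
  have key : ∀ {z}, ¬ Bornology.IsBounded (connectedComponentIn (curve p)ᶜ z) →
      ∃ w ∈ connectedComponentIn (curve p)ᶜ z, r < ‖w‖ := by
    intro z hz
    by_contra! hcon
    exact hz (isBounded_iff_forall_norm_le.2 ⟨r, hcon⟩)
  obtain ⟨v, hv, hvr⟩ := key hx
  obtain ⟨w, hw, hwr⟩ := key hy
  have hvw : w ∈ connectedComponentIn (curve p)ᶜ v :=
    (isPreconnected_norm_gt r).subset_connectedComponentIn hvr
      (fun z hz hzc => (hr z hzc).not_gt hz) hwr
  rw [connectedComponentIn_eq hv, connectedComponentIn_eq hvw, connectedComponentIn_eq hw]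

/-- A point outside the hull accounts for one unbounded component; among at most two components,
this leaves one bounded. -/
theorem IsCycle.component_eq_of_isBounded (h : IsCycle n p) (hxc : x ∉ curve p) (hyc : y ∉ curve p)
    (hx : Bornology.IsBounded (connectedComponentIn (curve p)ᶜ x))
    (hy : Bornology.IsBounded (connectedComponentIn (curve p)ᶜ y)) :
    connectedComponentIn (curve p)ᶜ x = connectedComponentIn (curve p)ᶜ y := by
  obtain ⟨z, hz⟩ : ∃ z, z ∉ convexHull ℝ (Set.range p) := by
    by_contra! hcon
    refine NormedSpace.unbounded_univ ℝ Plane ?_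
    rw [← Set.eq_univ_of_forall hcon]
    exact isBounded_convexHull.2 h.finite_range.isBounded
  have hzb := h.not_isBounded_component hz
  rcases h.component_eq hxc hyc fun hzc => hz (curve_subset_convexHull p hzc) with h1 | h1 | h1
  · exact h1
  · exact absurd (h1 ▸ hx) hzb
  · exact absurd (h1 ▸ hy) hzb

/-! ### Close visible vertices -/

/-- The chords of `I` belong to the family `G'` that the chords of `U` respect. A chord of each can
thus share an inner point only if they coincide, which is the hypothesis needed for
`IsCycle.not_interleaved`. -/
theorem IsGoodIndexSet.not_interleaved (h : IsCycle n p) {G G' : Set (Plane × Plane)}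
    {I U : Finset ℕ} (hI : IsGoodIndexSet n p G a I) (hU : IsGoodIndexSet n p G' b U)
    (hIG : ∀ i ∈ I, ∀ j ∈ I, i ≠ j → (p i, p j) ∈ G' ∨ (p j, p i) ∈ G')
    (hab : connectedComponentIn (curve p)ᶜ a = connectedComponentIn (curve p)ᶜ b) :
    ∀ i ∈ I, ∀ j ∈ I, ∀ k ∈ U, ∀ l ∈ U, i ≠ j → k ≠ l → ¬ Interleaved i j k l := by
  intro i hi j hj k hk l hl hij hkl
  refine h.not_interleaved (hI.lt i hi) (hI.lt j hj) (hU.lt k hk) (hU.lt l hl)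
    (isPreconnected_connectedComponentIn (F := (curve p)ᶜ) (x := a))
    (fun z hz => connectedComponentIn_subset _ _ hz) (hI.good i hi j hj hij)
    (hab ▸ hU.good k hk l hl hkl) ?_
  intro z hz hz'
  have hz2 := openSegment_subset_segment _ _ _ hz
  rcases hIG i hi j hj hij with h1 | h1
  · exact hU.side k hk l hl hkl _ h1 z hz' hz2
  · rcases hU.side k hk l hl hkl _ h1 z hz' (by rwa [segment_symm]) with h2 | h2
    · right; rw [Prod.mk.injEq] at h2 ⊢; exact h2.symm
    · left; rw [Prod.mk.injEq] at h2 ⊢; exact h2.symm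

/-- Two points of the hull in the same component see vertices that are close on the polygon. -/
theorem IsCycle.exists_close_of_mem_hull (h : IsCycle n p) (hn : 4 ≤ n)
    (ha : a ∈ convexHull ℝ (Set.range p)) (hb : b ∈ convexHull ℝ (Set.range p))
    (hac : a ∉ curve p) (hbc : b ∉ curve p)
    (hab : connectedComponentIn (curve p)ᶜ a = connectedComponentIn (curve p)ᶜ b) :
    ∃ i < n, ∃ j < n, (∀ z ∈ openSegment ℝ a (p i), z ∉ curve p) ∧
      (∀ z ∈ openSegment ℝ b (p j), z ∉ curve p) ∧ 2 * cycDist n i j + 4 ≤ n := by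
  obtain ⟨I, G, hI, hIgood, hG, hGp, hIG⟩ :=
    h.exists_goodIndexSet_three subset_rfl h.isPlanarFamily ha hac
  obtain ⟨U, -, hU, hUgood, -⟩ := h.exists_goodIndexSet_three hG hGp hb hbc
  obtain ⟨i, hi, j, hj, hij⟩ := exists_close_three_three hn hI hU hIgood.lt hUgood.lt
    (hIgood.not_interleaved h hUgood hIG hab)
  exact ⟨i, hIgood.lt i hi, j, hUgood.lt j hj, hIgood.sees i hi, hUgood.sees j hj, hij⟩

theorem IsCycle.exists_close_of_notMem_hull (h : IsCycle n p)
    (ha : a ∈ convexHull ℝ (Set.range p)) (hb : b ∉ convexHull ℝ (Set.range p))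
    (hac : a ∉ curve p)
    (hab : connectedComponentIn (curve p)ᶜ a = connectedComponentIn (curve p)ᶜ b) :
    ∃ i < n, ∃ j < n, (∀ z ∈ openSegment ℝ a (p i), z ∉ curve p) ∧
      (∀ z ∈ openSegment ℝ b (p j), z ∉ curve p) ∧ 2 * cycDist n i j + 3 ≤ n := by
  obtain ⟨I, G, hI, hIgood, hG, hGp, hIG⟩ :=
    h.exists_goodIndexSet_three subset_rfl h.isPlanarFamily ha hac
  obtain ⟨U, hU, hUgood⟩ := h.exists_goodIndexSet_two hG hGp hb
  obtain ⟨i, hi, j, hj, hij⟩ := exists_close_three_two hI hU hIgood.lt hUgood.lt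
    (hIgood.not_interleaved h hUgood hIG hab)
  exact ⟨i, hIgood.lt i hi, j, hUgood.lt j hj, hIgood.sees i hi, hUgood.sees j hj, hij⟩

/-- Two points outside the hull are joined by a path with three edges that avoids the curve. -/
theorem IsCycle.exists_path_of_notMem_hull (h : IsCycle n p)
    (ha : a ∉ convexHull ℝ (Set.range p)) (hb : b ∉ convexHull ℝ (Set.range p)) :
    ∃ x y, segment ℝ a x ⊆ (curve p)ᶜ ∧ segment ℝ x y ⊆ (curve p)ᶜ ∧
      segment ℝ y b ⊆ (curve p)ᶜ := by
  obtain ⟨f, u, hf, hfa⟩ := h.exists_separating ha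
  obtain ⟨g, v, hg, hgb⟩ := h.exists_separating hb
  -- A direction parallel to the line that separates `a`, oriented so as not to approach the line
  -- that separates `b`. Both points can move along it indefinitely.
  obtain ⟨w, hw0, hwf, hwg⟩ : ∃ w, w ≠ 0 ∧ 0 ≤ f w ∧ 0 ≤ g w := by
    obtain ⟨w, hw, hw0⟩ := Submodule.exists_mem_ne_zero_of_ne_bot
      (LinearMap.ker_ne_bot_of_finrank_lt (f := (f : Plane →ₗ[ℝ] ℝ)) (by simp))
    have hw : f w = 0 := hw
    rcases le_total 0 (g w) with h1 | h1
    · exact ⟨w, hw0, hw.ge, h1⟩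
    · exact ⟨-w, neg_ne_zero.2 hw0, by simp [hw], by simpa using h1⟩
  obtain ⟨r, hr⟩ := h.isCompact_curve.isBounded.exists_norm_le
  -- With this shift, the translate of the segment from `a` to `b` lies outside the disc of radius
  -- `r` that contains the curve.
  obtain ⟨t, ht⟩ := exists_nat_gt ((r + ‖a‖ + ‖b‖) / ‖w‖)
  rw [div_lt_iff₀ (norm_pos_iff.2 hw0)] at ht
  have hray : ∀ {c : Plane} {φ : StrongDual ℝ Plane} {m : ℝ}, (∀ y ∈ curve p, φ y < m) →
      m < φ c → 0 ≤ φ w → segment ℝ c (c + (t : ℝ) • w) ⊆ (curve p)ᶜ := by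
    intro c φ m h1 h2 h3 z hz hzc
    rw [segment_eq_image'] at hz
    obtain ⟨s, hs, rfl⟩ := hz
    have h4 := h1 _ hzc
    rw [add_sub_cancel_left, map_add, map_smul, map_smul, smul_eq_mul, smul_eq_mul] at h4
    have := mul_nonneg hs.1 (mul_nonneg t.cast_nonneg h3)
    linarith
  refine ⟨a + (t : ℝ) • w, b + (t : ℝ) • w, hray hf hfa hwf, ?_, ?_⟩
  · rintro _ ⟨α, β, hα, hβ, hαβ, rfl⟩ hzc
    have h1 := hr _ hzc
    have h2 : (t : ℝ) • w = (α • (a + (t : ℝ) • w) + β • (b + (t : ℝ) • w)) +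
        (-(α • a) + -(β • b)) := by
      obtain rfl : β = 1 - α := by linarith
      module
    have h3 : ‖α • a‖ ≤ ‖a‖ := by
      rw [norm_smul, Real.norm_of_nonneg hα]
      exact mul_le_of_le_one_left (norm_nonneg a) (by linarith)
    have h4 : ‖β • b‖ ≤ ‖b‖ := by
      rw [norm_smul, Real.norm_of_nonneg hβ]
      exact mul_le_of_le_one_left (norm_nonneg b) (by linarith)
    have h5 := norm_add_le (α • (a + (t : ℝ) • w) + β • (b + (t : ℝ) • w)) (-(α • a) + -(β • b))
    have h6 := norm_add_le (-(α • a)) (-(β • b))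
    rw [← h2, norm_smul, Real.norm_of_nonneg t.cast_nonneg] at h5
    rw [norm_neg, norm_neg] at h6
    linarith
  · rw [segment_symm]
    exact hray hg hgb hwg

/-! ### Closed polygons as periodic sequences -/

/-- The periodic sequence of the vertices of a polygon. -/
def vertexSeq (P : Polygon Plane n) (hn : 0 < n) (k : ℕ) : Plane := P ⟨k % n, Nat.mod_lt k hn⟩

variable {P : Polygon Plane n}

theorem vertexSeq_of_lt (hn : 0 < n) (i : Fin n) : vertexSeq P hn i = P i := by
  unfold vertexSeq
  congr 1
  exact Fin.ext (Nat.mod_eq_of_lt i.2)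

theorem vertexSeq_succ (hn : 0 < n) (k : ℕ) :
    vertexSeq P hn (k + 1) = P (finRotate n ⟨k % n, Nat.mod_lt k hn⟩) := by
  unfold vertexSeq
  congr 1
  rw [finRotate_apply]
  ext
  simp [Fin.val_add]

theorem edgeSet_eq_segment_vertexSeq (hn : 0 < n) (k : ℕ) :
    P.edgeSet ℝ ⟨k % n, Nat.mod_lt k hn⟩ =
      segment ℝ (vertexSeq P hn k) (vertexSeq P hn (k + 1)) := by
  rw [vertexSeq_succ, Polygon.edgeSet, affineSegment_eq_segment]
  rfl

theorem curve_vertexSeq (hn : 0 < n) : curve (vertexSeq P hn) = P.boundary ℝ := by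
  apply Set.Subset.antisymm
  · refine Set.iUnion_subset fun k => ?_
    rw [← edgeSet_eq_segment_vertexSeq]
    exact Set.subset_iUnion (P.edgeSet ℝ) _
  · refine Set.iUnion_subset fun i => ?_
    have h : (⟨i % n, Nat.mod_lt i hn⟩ : Fin n) = i := Fin.ext (Nat.mod_eq_of_lt i.2)
    rw [← h, edgeSet_eq_segment_vertexSeq]
    exact edge_subset_curve _ _

theorem IsSimpleClosed.pos (hP : IsSimpleClosed P) : 0 < n := by have := hP.three_le; omega

theorem IsSimpleClosed.isCycle (hP : IsSimpleClosed P) : IsCycle n (vertexSeq P hP.pos) where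
  three_le := hP.three_le
  period k := by simp [vertexSeq]
  inj i j h := congrArg Fin.val (hP.injective h)
  inter i j hij x hx hx' := by
    rw [← edgeSet_eq_segment_vertexSeq] at hx hx'
    have h := hP.inter_edges ⟨i % n, Nat.mod_lt i hP.pos⟩ ⟨j % n, Nat.mod_lt j hP.pos⟩
      (fun h => hij (congrArg Fin.val h)) ▸ Set.mem_inter hx hx'
    rw [vertexSeq_succ, vertexSeq_succ]
    exact h

theorem cycDist_comm (n i j : ℕ) : cycDist n i j = cycDist n j i := by
  unfold cycDist; omega

theorem edgesApart_eq_cycDist (i j : Fin n) : edgesApart i j = cycDist n i j := by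
  unfold edgesApart cycDist; omega

theorem connectedComponentIn_eq_of_segment {s : Set Plane} {z : Plane} (h : segment ℝ a b ⊆ s)
    (hz : z ∈ segment ℝ a b) : connectedComponentIn s a = connectedComponentIn s z :=
  connectedComponentIn_eq ((convex_segment a b).isPreconnected.subset_connectedComponentIn
    (left_mem_segment ℝ a b) h hz)

theorem segment_subset_outside (ha : a ∈ outside P) (h : segment ℝ a b ⊆ (P.boundary ℝ)ᶜ) :
    segment ℝ a b ⊆ outside P := fun _ hz =>
  ⟨h hz, connectedComponentIn_eq_of_segment h hz ▸ ha.2⟩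

theorem segment_subset_inside (ha : a ∈ inside P) (h : segment ℝ a b ⊆ (P.boundary ℝ)ᶜ) :
    segment ℝ a b ⊆ inside P := fun _ hz =>
  ⟨h hz, connectedComponentIn_eq_of_segment h hz ▸ ha.2⟩

theorem segment_subset_of_openSegment {s : Set Plane} {v z : Plane} (ha : a ∈ s)
    (h : openSegment ℝ a v ⊆ s) (hz : z ∈ openSegment ℝ a v) : segment ℝ a z ⊆ s := by
  intro y hy
  rcases mem_segment_iff_open hy with rfl | rfl | hy
  · exact ha
  · exact h hz
  · obtain ⟨α, β, hα, hβ, hαβ, rfl⟩ := hz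
    obtain ⟨γ, δ, hγ, hδ, hγδ, rfl⟩ := hy
    refine h ⟨γ + δ * α, δ * β, by positivity, by positivity, ?_, by module⟩
    linear_combination hγδ + δ * hαβ

/-- It is enough to avoid the boundary: points joined to `a` by a segment off the boundary are in
the component of `a`. -/
theorem seesVia_inside (ha : a ∈ inside P) {v : Plane}
    (h : ∀ z ∈ openSegment ℝ a v, z ∉ P.boundary ℝ) : SeesVia (inside P) a v := fun z hz =>
  segment_subset_inside ha (segment_subset_of_openSegment ha.1 h hz) (right_mem_segment ℝ a z)

theorem seesVia_outside (ha : a ∈ outside P) {v : Plane}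
    (h : ∀ z ∈ openSegment ℝ a v, z ∉ P.boundary ℝ) : SeesVia (outside P) a v := fun z hz =>
  segment_subset_outside ha (segment_subset_of_openSegment ha.1 h hz) (right_mem_segment ℝ a z)

theorem polygonalDist_le_three {s : Set Plane} (h1 : segment ℝ a x ⊆ s) (h2 : segment ℝ x y ⊆ s)
    (h3 : segment ℝ y b ⊆ s) : polygonalDist s a b ≤ 3 := by
  refine iInf₂_le (3 : ℕ) ⟨fun k => if k = 0 then a else if k = 1 then x else if k = 2 then y else b,
    rfl, rfl, fun i hi => ?_, fun i hi => ?_⟩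
  · interval_cases i
    exacts [h1 (left_mem_segment ℝ a x), h1 (right_mem_segment ℝ a x),
      h2 (right_mem_segment ℝ x y), h3 (right_mem_segment ℝ y b)]
  · interval_cases i
    exacts [h1, h2, h3]

theorem le_floor_half_sub_two {e : ℕ} (h : 2 * e + 4 ≤ n) : (e : ℤ) ≤ ⌊(n : ℚ) / 2⌋ - 2 := by
  have h' : (2 * e + 4 : ℚ) ≤ n := by exact_mod_cast h
  rw [le_sub_iff_add_le, Int.le_floor]
  push_cast
  linarith

theorem le_ceil_half_sub_two {e : ℕ} (h : 2 * e + 3 ≤ n) : (e : ℤ) ≤ ⌈(n : ℚ) / 2⌉ - 2 := by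
  have h' : (2 * e + 3 : ℚ) ≤ n := by exact_mod_cast h
  -- An integer is below the ceiling exactly when it is below `n / 2`, and `e + 3 / 2 ≤ n / 2`.
  suffices (e : ℤ) + 1 < ⌈(n : ℚ) / 2⌉ by omega
  rw [Int.lt_ceil]
  push_cast
  linarith

theorem IsSimpleClosed.exists_close_of_inside (hP : IsSimpleClosed P) (hn : 4 ≤ n)
    (ha : a ∈ inside P) (hb : b ∈ inside P) : ∃ i j : Fin n,
      SeesVia (inside P) a (P i) ∧ SeesVia (inside P) b (P j) ∧ 2 * edgesApart i j + 4 ≤ n := by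
  have h := hP.isCycle
  have hc := curve_vertexSeq (P := P) hP.pos
  have hmem : ∀ {x}, x ∈ inside P → x ∈ convexHull ℝ (Set.range (vertexSeq P hP.pos)) := by
    intro x hx
    by_contra hcon
    exact h.not_isBounded_component hcon (hc ▸ hx.2)
  obtain ⟨i, hi, j, hj, h1, h2, h3⟩ := h.exists_close_of_mem_hull hn (hmem ha) (hmem hb)
    (hc ▸ ha.1) (hc ▸ hb.1)
    (h.component_eq_of_isBounded (hc ▸ ha.1) (hc ▸ hb.1) (hc ▸ ha.2) (hc ▸ hb.2))
  rw [hc, vertexSeq_of_lt hP.pos ⟨i, hi⟩] at h1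
  rw [hc, vertexSeq_of_lt hP.pos ⟨j, hj⟩] at h2
  exact ⟨⟨i, hi⟩, ⟨j, hj⟩, seesVia_inside ha h1, seesVia_inside hb h2,
    by rwa [edgesApart_eq_cycDist]⟩

theorem IsSimpleClosed.exists_close_of_outside (hP : IsSimpleClosed P) (hn : 4 ≤ n)
    (ha : a ∈ outside P) (hb : b ∈ outside P) : (∃ i j : Fin n,
      SeesVia (outside P) a (P i) ∧ SeesVia (outside P) b (P j) ∧ 2 * edgesApart i j + 3 ≤ n) ∨
      polygonalDist (outside P) a b ≤ 3 := by
  have h := hP.isCycle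
  have hc := curve_vertexSeq (P := P) hP.pos
  have hab := h.component_eq_of_not_isBounded (hc ▸ ha.2 : ¬ Bornology.IsBounded
    (connectedComponentIn (curve (vertexSeq P hP.pos))ᶜ a)) (hc ▸ hb.2)
  by_cases hboth : a ∉ convexHull ℝ (Set.range (vertexSeq P hP.pos)) ∧
      b ∉ convexHull ℝ (Set.range (vertexSeq P hP.pos))
  · obtain ⟨x, y, h1, h2, h3⟩ := h.exists_path_of_notMem_hull hboth.1 hboth.2
    rw [hc] at h1 h2 h3
    have m1 := segment_subset_outside ha h1
    have m2 := segment_subset_outside (m1 (right_mem_segment ℝ a x)) h2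
    have m3 := segment_subset_outside (m2 (right_mem_segment ℝ x y)) h3
    exact Or.inr (polygonalDist_le_three m1 m2 m3)
  left
  obtain ⟨i, hi, j, hj, h1, h2, h3⟩ : ∃ i < n, ∃ j < n,
      (∀ z ∈ openSegment ℝ a (vertexSeq P hP.pos i), z ∉ curve (vertexSeq P hP.pos)) ∧
      (∀ z ∈ openSegment ℝ b (vertexSeq P hP.pos j), z ∉ curve (vertexSeq P hP.pos)) ∧
      2 * cycDist n i j + 3 ≤ n := by
    by_cases hah : a ∈ convexHull ℝ (Set.range (vertexSeq P hP.pos))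
    · by_cases hbh : b ∈ convexHull ℝ (Set.range (vertexSeq P hP.pos))
      · obtain ⟨i, hi, j, hj, h1, h2, h3⟩ := h.exists_close_of_mem_hull hn hah hbh
          (hc ▸ ha.1) (hc ▸ hb.1) hab
        exact ⟨i, hi, j, hj, h1, h2, by omega⟩
      · exact h.exists_close_of_notMem_hull hah hbh (hc ▸ ha.1) hab
    · have hbh := not_not.1 fun hbh => hboth ⟨hah, hbh⟩
      obtain ⟨i, hi, j, hj, h1, h2, h3⟩ :=
        h.exists_close_of_notMem_hull hbh hah (hc ▸ hb.1) hab.symm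
      exact ⟨j, hj, i, hi, h2, h1, by rwa [cycDist_comm]⟩
  rw [hc, vertexSeq_of_lt hP.pos ⟨i, hi⟩] at h1
  rw [hc, vertexSeq_of_lt hP.pos ⟨j, hj⟩] at h2
  exact ⟨⟨i, hi⟩, ⟨j, hj⟩, seesVia_outside ha h1, seesVia_outside hb h2,
    by rwa [edgesApart_eq_cycDist]⟩

end PlanePolygon

theorem theorem4p2 (n : ℕ) (P : Polygon Plane n) (hP : PlanePolygon.IsSimpleClosed P) :
    (4 ≤ n → ∀ a ∈ PlanePolygon.inside P, ∀ b ∈ PlanePolygon.inside P,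
      ∃ i j : Fin n,
        PlanePolygon.SeesVia (PlanePolygon.inside P) a (P i) ∧
        PlanePolygon.SeesVia (PlanePolygon.inside P) b (P j) ∧
        (PlanePolygon.edgesApart i j : ℤ) ≤ ⌊(n : ℚ) / 2⌋ - 2) ∧
    (5 ≤ n → ∀ a ∈ PlanePolygon.outside P, ∀ b ∈ PlanePolygon.outside P,
      (∃ i j : Fin n,
        PlanePolygon.SeesVia (PlanePolygon.outside P) a (P i) ∧
        PlanePolygon.SeesVia (PlanePolygon.outside P) b (P j) ∧
        (PlanePolygon.edgesApart i j : ℤ) ≤ ⌈(n : ℚ) / 2⌉ - 2) ∨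
      PlanePolygon.polygonalDist (PlanePolygon.outside P) a b ≤ 3) := by
  refine ⟨fun hn a ha b hb => ?_, fun hn a ha b hb => ?_⟩
  · obtain ⟨i, j, h1, h2, h3⟩ := hP.exists_close_of_inside hn ha hb
    exact ⟨i, j, h1, h2, PlanePolygon.le_floor_half_sub_two h3⟩
  · rcases hP.exists_close_of_outside (by omega) ha hb with ⟨i, j, h1, h2, h3⟩ | h
    · exact Or.inl ⟨i, j, h1, h2, PlanePolygon.le_ceil_half_sub_two h3⟩
    · exact Or.inr h
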